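/- Let $\mathcal S$ be a supercategory: a well-powered, complete, $\mathbb Q$-linear abelian symmetric tensor category (with bilinear tensor product) with a distinguished object $P$ with $\Lambda^2P\cong I$ (a fixed isomorphism) and $S^2P\cong 0$, where $I$ is the unit object. Assume moreover that $\mathcal S$ has countable direct sums and that these are preserved by $\otimes$. For a Lie algebra $\mathfrak g$ in a symmetric tensor category, $\mathrm{Mod}(\mathfrak g)$ denotes the tensor category of $\mathfrak g$-modules (Leibniz action on tensor products, zero action on $I$), and $X\mapsto X^{\mathfrak g}$ the right adjoint of the functor giving each object the zero action (it exists, and is lax monoidal, in the cases used below). Let $Q$ be the abelian Lie algebra with underlying object $P$, and $\mathcal Q=\mathrm{Mod}(Q)$ the category of supercomplexes; write $d\colon P\otimes X\to X$ for the action on $X$, $\ker d=X^Q$, and $H^{\mathcal Q}(X)=\ker d/\operatorname{im} d$. Let $D=S(P)=I\oplus P$ be the commutative algebra in $\mathcal Q$ in which $d$ maps $P\otimes P$ to $I$ by the fixed isomorphism and is zero on $I$. Let $L_0$ be a Lie algebra in $\mathcal S$ whose underlying object has a dual $L_0^*$, regarded as an $L_0$-module by the coadjoint action. Let $L=D\otimes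 L_0$, a Lie algebra in $\mathcal Q$ (with $L_0$ given zero differential), which contains $L_0$ and $PL_0=P\otimes L_0$, and let $\mathcal L=\mathrm{Mod}(L)$ be the category of $L$-modules in $\mathcal Q$. For $X,Z$ in $\mathcal L$ put $H(X)=H^{\mathcal Q}(X^L)$ and $H_Z(X)=H(Z\otimes X)$. For an algebra $A$ in $\mathcal L$, the object $\ker(d\mid A^L)$ is an algebra in $\mathcal S$; an algebra structure on $H(A)$ is called induced if the projection $\ker(d\mid A^L)\to H(A)$ is a morphism of algebras. A connection on a commutative algebra $A$ in $\mathcal L$ is an odd morphism from $L_0^*$ to $A$, i.e. a morphism $\theta\colon P\otimes L_0^*\to A$ in $\mathcal S$, which is $L_0$-equivariant and such that the contraction $$PL_0\otimes (P\otimes L_0^*)\xrightarrow{\;1\otimes\theta\;}PL_0\otimes A\xrightarrow{\ \mathrm{action}\ }A$$ is the evaluation pairing $PL_0\otimes PL_0^*\to I$ followed by the unit $I\to A$. The commutative Weil object $C_L$ is a commutative algebra in $\mathcal L$ which represents the functor sending a commutative algebra in $\mathcal L$ to its set of connections; equivariant cohomology is $H_{eq}=H_{C_L}$. Let $S(L_0^*)$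 be the symmetric algebra of $L_0^*$, i.e. the free commutative algebra in $\mathrm{Mod}(L_0)$ on the module $L_0^*$. Then $C_L$ and $S(L_0^*)$ exist, and, for any choice of them, $H_{eq}(I)=H(C_L\otimes I)$ and $H(C_L)$ each have a unique induced algebra structure, and for these structures the isomorphism $H_{eq}(I)=H(C_L\otimes I)\cong H(C_L)$ coming from the unit isomorphism $C_L\otimes I\cong C_L$ is an isomorphism of algebras, and there is an isomorphism of algebras in $\mathcal S$ $$H(C_L)\;\cong\;S(L_0^*)^{L_0}.$$ -/

import Mathlib

open CategoryTheory MonoidalCategory BraidedCategory Limits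

universe v u

set_option linter.unusedSectionVars false

namespace SuperTensor

section Strings

variable {C : Type u} [Category.{v} C] [MonoidalCategory C] [SymmetricCategory C]

/-- Given an action `a` of `L` on `M`, the action on the first factor: `x (m ⊗ n) = (x m) ⊗ n`. -/
def actL (M N : C) {L : C} (a : L ⊗ M ⟶ M) : L ⊗ (M ⊗ N) ⟶ M ⊗ N :=
  (α_ _ _ _).inv ≫ a ▷ N

/-- Given an action `b` of `L` on `N`, the action on the second factor: `x (m ⊗ n) = m ⊗ (x n)`,
with the sign of the braiding of `x` past `m`. -/
def actR (M N : C) {L : C} (b : L ⊗ N ⟶ N) : L ⊗ (M ⊗ N) ⟶ M ⊗ N :=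
  (α_ _ _ _).inv ≫ (β_ L M).hom ▷ N ≫ (α_ _ _ _).hom ≫ M ◁ b

lemma actL_actL {L M N : C} (a : L ⊗ M ⟶ M) :
    (α_ L L (M ⊗ N)).hom ≫ L ◁ actL M N a ≫ actL M N a =
      (α_ (L ⊗ L) M N).inv ≫ ((α_ L L M).hom ≫ L ◁ a ≫ a) ▷ N := by
  simp [actL]

lemma actR_actR {L M N : C} (b : L ⊗ N ⟶ N) :
    (α_ L L (M ⊗ N)).hom ≫ L ◁ actR M N b ≫ actR M N b =
      (α_ (L ⊗ L) M N).inv ≫ (β_ (L ⊗ L) M).hom ▷ N ≫ (α_ _ _ _).hom ≫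
        M ◁ ((α_ L L N).hom ≫ L ◁ b ≫ b) := by
  simp only [actR, MonoidalCategory.whiskerLeft_comp, Category.assoc, braiding_tensor_left_hom]
  have : L ◁ M ◁ b ≫ (α_ L M N).inv ≫ (β_ L M).hom ▷ N =
    (α_ _ _ _).inv ≫ (β_ L M).hom ▷ _ ≫ (α_ _ _ _).hom ≫ M ◁ L ◁ b ≫ (α_ _ _ _).inv := by
    rw [associator_inv_naturality_right_assoc, whisker_exchange]
    simp
  rw [reassoc_of% this]
  monoidal

lemma actL_actR {L M N : C} (a : L ⊗ M ⟶ M) (b : L ⊗ N ⟶ N) :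
    (α_ L L (M ⊗ N)).hom ≫ L ◁ actR M N b ≫ actL M N a =
      (β_ L L).hom ▷ (M ⊗ N) ≫ (α_ L L (M ⊗ N)).hom ≫ L ◁ actL M N a ≫ actR M N b := by
  simp only [actR, actL, MonoidalCategory.whiskerLeft_comp, Category.assoc]
  have h1 : L ◁ a ▷ N ≫ (α_ L M N).inv ≫ (β_ L M).hom ▷ N =
     (α_ _ _ _).inv ≫ (β_ L (L ⊗ M)).hom ▷ N ≫ (a ▷ L) ▷ N  := by
    rw [← comp_whiskerRight, ← braiding_naturality_right]
    rw [associator_inv_naturality_middle_assoc, comp_whiskerRight]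
  rw [reassoc_of% h1, braiding_tensor_right_hom]
  have h2 : a ▷ L ▷ N ≫ (α_ _ _ _).hom ≫ M ◁ b =
     (α_ _ _ _).hom ≫ (L ⊗ M) ◁ b ≫ a ▷ N := by
    rw [associator_naturality_left_assoc, ← whisker_exchange]
  rw [h2]
  have h3 : L ◁ M ◁ b ≫ (α_ _ _ _).inv ≫ a ▷ N = (α_ _ _ _).inv ≫ (L ⊗ M) ◁ b ≫ a ▷ N := by
    rw [associator_inv_naturality_right_assoc]
  rw [h3]
  simp only [← Category.assoc]
  congr 2
  simp only [Category.assoc]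
  have h4 : (β_ L L).hom ▷ (M ⊗ N) ≫ (α_ _ _ _).hom ≫ L ◁ (α_ _ _ _).inv ≫ (α_ _ _ _).inv ≫
      (α_ _ _ _).inv ▷ N ≫ (β_ L L).hom ▷ M ▷ N = 𝟙 _ ⊗≫ (((β_ L L).hom ≫ (β_ L L).hom) ▷ M ▷ N) ⊗≫ 𝟙 _ := by
    monoidal
  simp only [SymmetricCategory.symmetry] at h4
  simp only [comp_whiskerRight, Category.assoc]
  rw [reassoc_of% h4]
  monoidal

lemma nat1 {L M M' N : C} {a : L ⊗ M ⟶ M} {a' : L ⊗ M' ⟶ M'} (f : M ⟶ M') (h : a ≫ f = L ◁ f ≫ a') :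
   actL M N a ≫ f ▷ N = L ◁ f ▷ N ≫ actL M' N a' := by
  simp only [Category.assoc, ← comp_whiskerRight, h, actL]; simp
lemma nat2 {L M N N' : C} {a : L ⊗ M ⟶ M} (g : N ⟶ N') :
   actL M N a ≫ M ◁ g = L ◁ M ◁ g ≫ actL M N' a := by
  simp only [Category.assoc, ← whisker_exchange, actL]; simp
lemma nat3 {L M M' N : C} {b : L ⊗ N ⟶ N} (f : M ⟶ M') :
   actR M N b ≫ f ▷ N = L ◁ f ▷ N ≫ actR M' N b := by
  simp only [Category.assoc, whisker_exchange, actR]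
  rw [associator_inv_naturality_middle_assoc, ← comp_whiskerRight_assoc, braiding_naturality_right]
  simp
lemma nat4 {L M N N' : C} {b : L ⊗ N ⟶ N} {b' : L ⊗ N' ⟶ N'} (g : N ⟶ N') (h : b ≫ g = L ◁ g ≫ b') :
   actR M N b ≫ M ◁ g = L ◁ M ◁ g ≫ actR M N' b' := by
  simp only [Category.assoc, ← MonoidalCategory.whiskerLeft_comp, h, actR]
  rw [associator_inv_naturality_right_assoc, whisker_exchange_assoc]
  simp
lemma ass1 {L M N K : C} (a : L ⊗ M ⟶ M) :
   actL (M ⊗ N) K (actL M N a) ≫ (α_ M N K).hom = L ◁ (α_ M N K).hom ≫ actL M (N ⊗ K) a := by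
  simp [actL]
lemma ass2 {L M N K : C} (b : L ⊗ N ⟶ N) :
   actL (M ⊗ N) K (actR M N b) ≫ (α_ M N K).hom = L ◁ (α_ M N K).hom ≫ actR M (N ⊗ K) (actL N K b) := by
  simp [actL, actR]
lemma ass3 {L M N K : C} (c : L ⊗ K ⟶ K) :
   actR (M ⊗ N) K c ≫ (α_ M N K).hom = L ◁ (α_ M N K).hom ≫ actR M (N ⊗ K) (actR N K c) := by
  simp [actR]
lemma br1 {L M N : C} (a : L ⊗ M ⟶ M) :
   actL M N a ≫ (β_ M N).hom = L ◁ (β_ M N).hom ≫ actR N M a := by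
  simp only [Category.assoc, actL, actR, braiding_naturality_left]
  rw [braiding_tensor_left_hom]
  simp
lemma br2 {L M N : C} (b : L ⊗ N ⟶ N) :
   actR M N b ≫ (β_ M N).hom = L ◁ (β_ M N).hom ≫ actL N M b := by
  rw [← cancel_mono (β_ N M).hom, Category.assoc, Category.assoc, br1 (N := M) b,
    ← MonoidalCategory.whiskerLeft_comp_assoc]
  simp
lemma un1 {L M : C} (a : L ⊗ M ⟶ M) :
   actR (𝟙_ C) M a ≫ (λ_ M).hom = L ◁ (λ_ M).hom ≫ a := by
  simp [actR]
lemma un2 {L M : C} (a : L ⊗ M ⟶ M) :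
   actL M (𝟙_ C) a ≫ (ρ_ M).hom = L ◁ (ρ_ M).hom ≫ a := by
  simp [actL]

lemma actL_tensorHom {L M N X Y Z : C} {a : L ⊗ M ⟶ M} {f : M ⟶ X} (g : N ⟶ Z) {s : M ⟶ Y}
    {t : L ⊗ Y ⟶ X} (h : a ≫ f = L ◁ s ≫ t) :
    actL M N a ≫ (f ⊗ₘ g) = L ◁ (s ⊗ₘ g) ≫ (α_ _ _ _).inv ≫ t ▷ Z := by
  rw [actL, Category.assoc, MonoidalCategory.tensorHom_def, ← comp_whiskerRight_assoc, h,
    MonoidalCategory.tensorHom_def, comp_whiskerRight, Category.assoc, ← whisker_exchange]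
  simp

lemma actR_tensorHom {L M N X Y Z : C} {b : L ⊗ N ⟶ N} (f : M ⟶ Z) {g : N ⟶ X} {s : N ⟶ Y}
    {t : L ⊗ Y ⟶ X} (h : b ≫ g = L ◁ s ≫ t) :
    actR M N b ≫ (f ⊗ₘ g) = L ◁ (f ⊗ₘ s) ≫ (α_ _ _ _).inv ≫ (β_ L Z).hom ▷ Y ≫
      (α_ _ _ _).hom ≫ Z ◁ t := by
  have e : M ◁ b ≫ (f ⊗ₘ g) = (f ⊗ₘ L ◁ s) ≫ Z ◁ t := by
    rw [MonoidalCategory.tensorHom_def', ← MonoidalCategory.whiskerLeft_comp_assoc, h,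
      MonoidalCategory.tensorHom_def', MonoidalCategory.whiskerLeft_comp, Category.assoc,
      Category.assoc, whisker_exchange]
  have e2 : (α_ M L N).hom ≫ (f ⊗ₘ L ◁ s) = ((f ▷ L) ⊗ₘ s) ≫ (α_ Z L Y).hom := by
    have := associator_naturality f (𝟙 L) s
    simpa using this.symm
  have e3 : (β_ L M).hom ▷ N ≫ ((f ▷ L) ⊗ₘ s) = ((L ◁ f) ⊗ₘ s) ≫ (β_ L Z).hom ▷ Y := by
    have h1 := braiding_naturality_right L f
    rw [← tensorHom_id, ← tensorHom_id (β_ L Z).hom, tensorHom_comp_tensorHom,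
      tensorHom_comp_tensorHom, h1]
    simp
  have e4 : (α_ L M N).inv ≫ ((L ◁ f) ⊗ₘ s) = L ◁ (f ⊗ₘ s) ≫ (α_ L Z Y).inv := by
    have := associator_inv_naturality (𝟙 L) f s
    simpa using this.symm
  simp only [actR, Category.assoc]
  rw [e, reassoc_of% e2, reassoc_of% e3, reassoc_of% e4]

lemma unit_right_string {P Z : C} (e : P ⊗ Z ⟶ 𝟙_ C) :
    (α_ P Z (𝟙_ C)).inv ≫ e ▷ 𝟙_ C ≫ (λ_ (𝟙_ C)).hom = P ◁ (ρ_ Z).hom ≫ e := by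
  rw [unitors_equal]
  simp

lemma unit_left_string {P Z : C} (e : P ⊗ Z ⟶ 𝟙_ C) :
    (α_ P (𝟙_ C) Z).inv ≫ (β_ P (𝟙_ C)).hom ▷ Z ≫ (α_ _ _ _).hom ≫ 𝟙_ C ◁ e ≫
      (λ_ (𝟙_ C)).hom = P ◁ (λ_ Z).hom ≫ e := by
  simp [braiding_tensorUnit_right]

lemma whiskerRight_tensorHom {W X Y Z Z' : C} (h : W ⟶ X) (f : X ⟶ Y) (g : Z ⟶ Z') :
    h ▷ Z ≫ (f ⊗ₘ g) = (h ≫ f) ⊗ₘ g := by simp [MonoidalCategory.tensorHom_def]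

lemma whiskerLeft_tensorHom {W X Y Z Z' : C} (h : W ⟶ X) (f : X ⟶ Y) (g : Z ⟶ Z') :
    Z ◁ h ≫ (g ⊗ₘ f) = g ⊗ₘ (h ≫ f) := by simp [MonoidalCategory.tensorHom_def']

lemma comp_tensorHom_left {W X Y Z Z' : C} (h : W ⟶ X) (f : X ⟶ Y) (g : Z ⟶ Z') :
    (h ≫ f) ⊗ₘ g = (h ⊗ₘ g) ≫ f ▷ Z' := by
  rw [← tensorHom_id, tensorHom_comp_tensorHom, Category.comp_id]

lemma comp_tensorHom_right {W X Y Z Z' : C} (h : W ⟶ X) (f : X ⟶ Y) (g : Z ⟶ Z') :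
    g ⊗ₘ (h ≫ f) = (g ⊗ₘ h) ≫ Z' ◁ f := by
  rw [← id_tensorHom, tensorHom_comp_tensorHom, Category.comp_id]

end Strings

section LieTheory

variable {C : Type u} [Category.{v} C] [Preadditive C] [MonoidalCategory C]
  [SymmetricCategory C] [MonoidalPreadditive C]

variable (C) in
/-- A Lie algebra object; the Jacobi identity reads `[[x, y], z] = [x, [y, z]] - [y, [x, z]]`. -/
structure LieAlg where
  /-- The underlying object. -/
  X : C
  /-- The bracket. -/
  bracket : X ⊗ X ⟶ X
  antisymm : (β_ X X).hom ≫ bracket = -bracket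
  jacobi : bracket ▷ X ≫ bracket =
    (α_ X X X).hom ≫ X ◁ bracket ≫ bracket -
      (β_ X X).hom ▷ X ≫ (α_ X X X).hom ≫ X ◁ bracket ≫ bracket

/-- A module over a Lie algebra object: `[x, y] v = x (y v) - y (x v)`. -/
structure LieMod (L : LieAlg C) where
  /-- The underlying object. -/
  V : C
  /-- The action. -/
  act : L.X ⊗ V ⟶ V
  act_bracket : L.bracket ▷ V ≫ act =
    (α_ L.X L.X V).hom ≫ L.X ◁ act ≫ act -
      (β_ L.X L.X).hom ▷ V ≫ (α_ L.X L.X V).hom ≫ L.X ◁ act ≫ act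

lemma leibniz_comm {L X Y : C} {p q : L ⊗ X ⟶ X} {p' q' : L ⊗ Y ⟶ Y} {f : X ⟶ Y}
    (h₁ : p ≫ f = L ◁ f ≫ p') (h₂ : q ≫ f = L ◁ f ≫ q') :
    (p + q) ≫ f = L ◁ f ≫ (p' + q') := by
  rw [Preadditive.add_comp, Preadditive.comp_add, h₁, h₂]

lemma whiskerLeft_neg (X : C) {Y Z : C} (f : Y ⟶ Z) : X ◁ (-f) = -(X ◁ f) :=
  (tensorLeft X).map_neg

lemma whiskerLeft_sub (X : C) {Y Z : C} (f g : Y ⟶ Z) : X ◁ (f - g) = X ◁ f - X ◁ g :=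
  (tensorLeft X).map_sub

lemma neg_whiskerRight {Y Z : C} (f : Y ⟶ Z) (X : C) : (-f) ▷ X = -(f ▷ X) :=
  (tensorRight X).map_neg

lemma sub_whiskerRight {Y Z : C} (f g : Y ⟶ Z) (X : C) : (f - g) ▷ X = f ▷ X - g ▷ X :=
  (tensorRight X).map_sub

lemma tensorHom_comm {L M M' N N' : C} {a : L ⊗ M ⟶ M} {a' : L ⊗ M' ⟶ M'} {b : L ⊗ N ⟶ N}
    {b' : L ⊗ N' ⟶ N'} (f : M ⟶ M') (hf : a ≫ f = L ◁ f ≫ a') (g : N ⟶ N')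
    (hg : b ≫ g = L ◁ g ≫ b') :
    (actL M N a + actR M N b) ≫ (f ⊗ₘ g) =
      L ◁ (f ⊗ₘ g) ≫ (actL M' N' a' + actR M' N' b') := by
  refine leibniz_comm ?_ ?_
  · rw [MonoidalCategory.tensorHom_def, ← Category.assoc, nat1 f hf, Category.assoc,
      nat2, MonoidalCategory.whiskerLeft_comp, Category.assoc]
  · rw [MonoidalCategory.tensorHom_def, ← Category.assoc, nat3, Category.assoc,
      nat4 g hg, MonoidalCategory.whiskerLeft_comp, Category.assoc]

lemma associator_comm {L M N K : C} (a : L ⊗ M ⟶ M) (b : L ⊗ N ⟶ N) (c : L ⊗ K ⟶ K) :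
    (actL (M ⊗ N) K (actL M N a + actR M N b) + actR (M ⊗ N) K c) ≫ (α_ M N K).hom =
      L ◁ (α_ M N K).hom ≫ (actL M (N ⊗ K) a + actR M (N ⊗ K) (actL N K b + actR N K c)) := by
  have e : actL (M ⊗ N) K (actL M N a + actR M N b) =
      actL (M ⊗ N) K (actL M N a) + actL (M ⊗ N) K (actR M N b) := by simp [actL]
  have e' : actR M (N ⊗ K) (actL N K b + actR N K c) =
      actR M (N ⊗ K) (actL N K b) + actR M (N ⊗ K) (actR N K c) := by simp [actR]
  rw [e, e', add_assoc]
  exact leibniz_comm (ass1 a) (leibniz_comm (ass2 b) (ass3 c))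

lemma actL_zero {L M N : C} : actL M N (0 : L ⊗ M ⟶ M) = 0 := by simp [actL]

lemma actR_zero {L M N : C} : actR M N (0 : L ⊗ N ⟶ N) = 0 := by simp [actR]

lemma leftUnitor_comm {L M : C} (a : L ⊗ M ⟶ M) :
    (actL (𝟙_ C) M 0 + actR (𝟙_ C) M a) ≫ (λ_ M).hom = L ◁ (λ_ M).hom ≫ a := by
  rw [actL_zero, zero_add, un1]

lemma rightUnitor_comm {L M : C} (a : L ⊗ M ⟶ M) :
    (actL M (𝟙_ C) a + actR M (𝟙_ C) 0) ≫ (ρ_ M).hom = L ◁ (ρ_ M).hom ≫ a := by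
  rw [actR_zero, add_zero, un2]

lemma braiding_comm {L M N : C} (a : L ⊗ M ⟶ M) (b : L ⊗ N ⟶ N) :
    (actL M N a + actR M N b) ≫ (β_ M N).hom =
      L ◁ (β_ M N).hom ≫ (actL N M b + actR N M a) := by
  rw [add_comm (actL N M b)]
  exact leibniz_comm (br1 a) (br2 b)

lemma bracket_actL {L M N : C} {b : L ⊗ L ⟶ L} {a : L ⊗ M ⟶ M}
    (h : b ▷ M ≫ a = (α_ L L M).hom ≫ L ◁ a ≫ a -
      (β_ L L).hom ▷ M ≫ (α_ L L M).hom ≫ L ◁ a ≫ a) :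
    b ▷ (M ⊗ N) ≫ actL M N a = (α_ L L _).hom ≫ L ◁ actL M N a ≫ actL M N a -
      (β_ L L).hom ▷ _ ≫ (α_ L L _).hom ≫ L ◁ actL M N a ≫ actL M N a := by
  have h1 : b ▷ (M ⊗ N) ≫ actL M N a = (α_ (L ⊗ L) M N).inv ≫ (b ▷ M ≫ a) ▷ N := by
    simp [actL]
  rw [h1, h, actL_actL, sub_whiskerRight, Preadditive.comp_sub]
  simp

lemma bracket_actR {L N : C} (M : C) {b : L ⊗ L ⟶ L} {a : L ⊗ N ⟶ N}
    (h : b ▷ N ≫ a = (α_ L L N).hom ≫ L ◁ a ≫ a -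
      (β_ L L).hom ▷ N ≫ (α_ L L N).hom ≫ L ◁ a ≫ a) :
    b ▷ (M ⊗ N) ≫ actR M N a = (α_ L L _).hom ≫ L ◁ actR M N a ≫ actR M N a -
      (β_ L L).hom ▷ _ ≫ (α_ L L _).hom ≫ L ◁ actR M N a ≫ actR M N a := by
  have h2 : b ▷ (M ⊗ N) ≫ actR M N a = (α_ (L ⊗ L) M N).inv ≫ (β_ (L ⊗ L) M).hom ▷ N ≫
      (α_ _ _ _).hom ≫ M ◁ (b ▷ N ≫ a) := by
    simp only [actR]
    rw [associator_inv_naturality_left_assoc, ← comp_whiskerRight_assoc,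
      braiding_naturality_left]
    simp
  rw [h2, h, actR_actR, whiskerLeft_sub, Preadditive.comp_sub, Preadditive.comp_sub,
    Preadditive.comp_sub, associator_inv_naturality_left_assoc, ← comp_whiskerRight_assoc,
    braiding_naturality_left]
  simp

namespace LieMod

variable {L : LieAlg C}

/-- Morphisms of modules. -/
@[ext]
structure Hom (M N : LieMod L) where
  hom : M.V ⟶ N.V
  comm : M.act ≫ hom = L.X ◁ hom ≫ N.act

@[simps id_hom comp_hom]
instance : Category (LieMod L) where
  Hom M N := Hom M N
  id M := ⟨𝟙 _, by simp⟩
  comp f g := ⟨f.hom ≫ g.hom, by rw [← Category.assoc, f.comm, Category.assoc, g.comm]; simp⟩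

@[ext]
lemma hom_ext {M N : LieMod L} {f g : M ⟶ N} (h : f.hom = g.hom) : f = g := Hom.ext h

/-- The forgetful functor. -/
@[simps]
def forget (L : LieAlg C) : LieMod L ⥤ C where
  obj M := M.V
  map f := f.hom

instance : (forget L).Faithful where
  map_injective h := hom_ext h

/-- Isomorphisms of modules from isomorphisms of underlying objects. -/
@[simps]
def isoMk {M N : LieMod L} (e : M.V ≅ N.V) (h : M.act ≫ e.hom = L.X ◁ e.hom ≫ N.act) :
    M ≅ N where
  hom := ⟨e.hom, h⟩
  inv := ⟨e.inv, by
    rw [Iso.comp_inv_eq, Category.assoc, h]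
    simp [← MonoidalCategory.whiskerLeft_comp_assoc]⟩

/-- The tensor product, with the Leibniz action `x (m ⊗ n) = (x m) ⊗ n + m ⊗ (x n)`. -/
@[simps]
def tensorObj (M N : LieMod L) : LieMod L where
  V := M.V ⊗ N.V
  act := actL M.V N.V M.act + actR M.V N.V N.act
  act_bracket := by
    have e3 := actL_actR M.act N.act
    have e3' := (β_ L.X L.X).hom ▷ (M.V ⊗ N.V) ≫= e3
    rw [← comp_whiskerRight_assoc, SymmetricCategory.symmetry, id_whiskerRight,
      Category.id_comp] at e3'
    rw [Preadditive.comp_add, bracket_actL M.act_bracket, bracket_actR M.V N.act_bracket]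
    simp only [MonoidalPreadditive.whiskerLeft_add, Preadditive.add_comp, Preadditive.comp_add]
    rw [e3', e3]
    abel

/-- The unit, with zero action. -/
@[simps]
def unit (L : LieAlg C) : LieMod L where
  V := 𝟙_ C
  act := 0
  act_bracket := by simp

@[simps tensorObj whiskerLeft_hom whiskerRight_hom tensorHom_hom]
instance : MonoidalCategoryStruct (LieMod L) where
  tensorObj := tensorObj
  tensorUnit := unit L
  whiskerLeft M _ _ f := ⟨M.V ◁ f.hom, leibniz_comm (nat2 f.hom) (nat4 f.hom f.comm)⟩
  whiskerRight f N := ⟨f.hom ▷ N.V, leibniz_comm (nat1 f.hom f.comm) (nat3 f.hom)⟩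
  tensorHom f g := ⟨f.hom ⊗ₘ g.hom, tensorHom_comm f.hom f.comm g.hom g.comm⟩
  associator M N K := isoMk (α_ M.V N.V K.V) (associator_comm M.act N.act K.act)
  leftUnitor M := isoMk (λ_ M.V) (leftUnitor_comm M.act)
  rightUnitor M := isoMk (ρ_ M.V) (rightUnitor_comm M.act)

@[simp] lemma associator_hom_hom (M N K : LieMod L) :
    (α_ M N K).hom.hom = (α_ M.V N.V K.V).hom := rfl
@[simp] lemma associator_inv_hom (M N K : LieMod L) :
    (α_ M N K).inv.hom = (α_ M.V N.V K.V).inv := rfl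
@[simp] lemma leftUnitor_hom_hom (M : LieMod L) : (λ_ M).hom.hom = (λ_ M.V).hom := rfl
@[simp] lemma leftUnitor_inv_hom (M : LieMod L) : (λ_ M).inv.hom = (λ_ M.V).inv := rfl
@[simp] lemma rightUnitor_hom_hom (M : LieMod L) : (ρ_ M).hom.hom = (ρ_ M.V).hom := rfl
@[simp] lemma rightUnitor_inv_hom (M : LieMod L) : (ρ_ M).inv.hom = (ρ_ M.V).inv := rfl
@[simp] lemma tensorUnit_V : (𝟙_ (LieMod L)).V = 𝟙_ C := rfl
@[simp] lemma tensorUnit_act : (𝟙_ (LieMod L)).act = 0 := rfl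

instance : MonoidalCategory (LieMod L) where
  tensorHom_def _ _ := hom_ext (MonoidalCategory.tensorHom_def _ _)
  id_tensorHom_id _ _ := hom_ext (id_tensorHom_id _ _)
  tensorHom_comp_tensorHom _ _ _ _ := hom_ext (tensorHom_comp_tensorHom _ _ _ _)
  whiskerLeft_id _ _ := hom_ext (MonoidalCategory.whiskerLeft_id _ _)
  id_whiskerRight _ _ := hom_ext (id_whiskerRight _ _)
  associator_naturality _ _ _ := hom_ext (associator_naturality _ _ _)
  leftUnitor_naturality _ := hom_ext (leftUnitor_naturality _)
  rightUnitor_naturality _ := hom_ext (rightUnitor_naturality _)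
  pentagon _ _ _ _ := hom_ext (pentagon _ _ _ _)
  triangle _ _ := hom_ext (triangle _ _)

instance : BraidedCategory (LieMod L) where
  braiding M N := isoMk (β_ M.V N.V) (braiding_comm M.act N.act)
  braiding_naturality_right _ _ _ _ := hom_ext (braiding_naturality_right _ _)
  braiding_naturality_left _ _ := hom_ext (braiding_naturality_left _ _)
  hexagon_forward _ _ _ := hom_ext (hexagon_forward _ _ _)
  hexagon_reverse _ _ _ := hom_ext (hexagon_reverse _ _ _)

@[simp] lemma braiding_hom_hom (M N : LieMod L) : (β_ M N).hom.hom = (β_ M.V N.V).hom := rfl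
@[simp] lemma braiding_inv_hom (M N : LieMod L) : (β_ M N).inv.hom = (β_ M.V N.V).inv := rfl

instance : SymmetricCategory (LieMod L) where
  symmetry _ _ := hom_ext (SymmetricCategory.symmetry _ _)

section Preadditive

variable {M N : LieMod L}

instance : Zero (M ⟶ N) := ⟨⟨0, by simp⟩⟩
instance : Add (M ⟶ N) := ⟨fun f g => ⟨f.hom + g.hom, by simp [f.comm, g.comm]⟩⟩
instance : Neg (M ⟶ N) := ⟨fun f => ⟨-f.hom, by simp [f.comm, whiskerLeft_neg]⟩⟩
instance : Sub (M ⟶ N) :=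
  ⟨fun f g => ⟨f.hom - g.hom, by simp [f.comm, g.comm, whiskerLeft_sub]⟩⟩
instance : SMul ℕ (M ⟶ N) := ⟨fun n f => ⟨n • f.hom, by
  simp only [Preadditive.comp_nsmul, f.comm, ← Preadditive.nsmul_comp]
  rw [show L.X ◁ (n • f.hom) = n • (L.X ◁ f.hom) from (tensorLeft L.X).map_nsmul]⟩⟩
instance : SMul ℤ (M ⟶ N) := ⟨fun n f => ⟨n • f.hom, by
  simp only [Preadditive.comp_zsmul, f.comm, ← Preadditive.zsmul_comp]
  rw [show L.X ◁ (n • f.hom) = n • (L.X ◁ f.hom) from (tensorLeft L.X).map_zsmul]⟩⟩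

instance : AddCommGroup (M ⟶ N) :=
  Function.Injective.addCommGroup (fun f : M ⟶ N => f.hom) (fun _ _ h => hom_ext h)
    rfl (fun _ _ => rfl) (fun _ => rfl) (fun _ _ => rfl) (fun _ _ => rfl) (fun _ _ => rfl)

@[simp] lemma zero_hom : (0 : M ⟶ N).hom = 0 := rfl
@[simp] lemma add_hom (f g : M ⟶ N) : (f + g).hom = f.hom + g.hom := rfl
@[simp] lemma neg_hom (f : M ⟶ N) : (-f).hom = -f.hom := rfl
@[simp] lemma sub_hom (f g : M ⟶ N) : (f - g).hom = f.hom - g.hom := rfl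

end Preadditive

instance : Preadditive (LieMod L) where
  add_comp _ _ _ f f' g := hom_ext (Preadditive.add_comp _ _ _ f.hom f'.hom g.hom)
  comp_add _ _ _ f g g' := hom_ext (Preadditive.comp_add _ _ _ f.hom g.hom g'.hom)

instance : MonoidalPreadditive (LieMod L) where
  whiskerLeft_zero := hom_ext MonoidalPreadditive.whiskerLeft_zero
  zero_whiskerRight := hom_ext MonoidalPreadditive.zero_whiskerRight
  whiskerLeft_add _ _ := hom_ext (MonoidalPreadditive.whiskerLeft_add _ _)
  add_whiskerRight _ _ := hom_ext (MonoidalPreadditive.add_whiskerRight _ _)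

end LieMod

section TrivialExtension

/-- The trivial extension functor: every object with the zero action. -/
@[simps]
def trivialExt (L : LieAlg C) : C ⥤ LieMod L where
  obj X := ⟨X, 0, by simp⟩
  map f := ⟨f, by simp⟩

lemma zero_comm {L X Y : C} (f : X ⟶ Y) :
    (0 : L ⊗ X ⟶ X) ≫ f = L ◁ f ≫ (0 : L ⊗ Y ⟶ Y) := by simp

lemma leibniz_zero {L X Y Z : C} (f : X ⊗ Y ⟶ Z) :
    (actL X Y (0 : L ⊗ X ⟶ X) + actR X Y (0 : L ⊗ Y ⟶ Y)) ≫ f =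
      L ◁ f ≫ (0 : L ⊗ Z ⟶ Z) := by simp [actL_zero, actR_zero]

lemma triv_assoc (X Y Z : C) : 𝟙 (X ⊗ Y) ▷ Z ≫ 𝟙 ((X ⊗ Y) ⊗ Z) ≫ (α_ X Y Z).hom =
    (α_ X Y Z).hom ≫ X ◁ 𝟙 (Y ⊗ Z) ≫ 𝟙 (X ⊗ Y ⊗ Z) := by simp

lemma triv_left (X : C) : (λ_ X).hom = 𝟙 (𝟙_ C) ▷ X ≫ 𝟙 (𝟙_ C ⊗ X) ≫ (λ_ X).hom := by simp

lemma triv_right (X : C) : (ρ_ X).hom = X ◁ 𝟙 (𝟙_ C) ≫ 𝟙 (X ⊗ 𝟙_ C) ≫ (ρ_ X).hom := by simp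

/-- Trivial extension is a (strict) monoidal functor. -/
instance (L : LieAlg C) : (trivialExt L).Monoidal :=
  Functor.CoreMonoidal.toMonoidal
    { εIso := LieMod.isoMk (Iso.refl (𝟙_ C)) (zero_comm _)
      μIso := fun X Y => LieMod.isoMk (Iso.refl (X ⊗ Y)) (leibniz_zero _)
      μIso_hom_natural_left := fun f X' => LieMod.hom_ext
        ((Category.comp_id (f ▷ X')).trans (Category.id_comp (f ▷ X')).symm)
      μIso_hom_natural_right := fun X' f => LieMod.hom_ext
        ((Category.comp_id (X' ◁ f)).trans (Category.id_comp (X' ◁ f)).symm)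
      associativity := fun X Y Z => LieMod.hom_ext (triv_assoc X Y Z)
      left_unitality := fun X => LieMod.hom_ext (triv_left X)
      right_unitality := fun X => LieMod.hom_ext (triv_right X) }

/-- The invariants functor, right adjoint to the trivial extension functor. -/
noncomputable def invariants (L : LieAlg C) [(trivialExt L).IsLeftAdjoint] : LieMod L ⥤ C :=
  (trivialExt L).rightAdjoint

/-- The adjunction between trivial extension and invariants. -/
noncomputable def invariantsAdj (L : LieAlg C) [(trivialExt L).IsLeftAdjoint] :
    trivialExt L ⊣ invariants L :=
  Adjunction.ofIsLeftAdjoint _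

/-- Invariants are lax monoidal; in particular invariants of an algebra form an algebra. -/
noncomputable instance (L : LieAlg C) [(trivialExt L).IsLeftAdjoint] :
    (invariants L).LaxMonoidal :=
  (invariantsAdj L).rightAdjointLaxMonoidal

/-- For every `a : T ⊗ M ⟶ N`, the condition `a (T ⊗ f) = 0` on `f : X ⟶ M` is the vanishing of
`f` followed by some fixed morphism out of `M`. -/
def HasAnnihilators (T : C) : Prop :=
  ∀ ⦃M N : C⦄ (a : T ⊗ M ⟶ N), ∃ (Z : C) (k : M ⟶ Z), ∀ ⦃X : C⦄ (f : X ⟶ M),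
    T ◁ f ≫ a = 0 ↔ f ≫ k = 0

lemma hasAnnihilators_tensor {P P' T : C} [ExactPairing P' P] (h : HasAnnihilators T) :
    HasAnnihilators (P ⊗ T) := by
  intro M N a
  obtain ⟨Z, k, hk⟩ := h ((tensorLeftHomEquiv (T ⊗ M) P' P N) ((α_ P T M).inv ≫ a))
  refine ⟨Z, k, fun X f => ?_⟩
  rw [← hk f, ← (tensorLeftHomEquiv (T ⊗ X) P' P N).symm.injective.eq_iff,
    tensorLeftHomEquiv_symm_naturality, Equiv.symm_apply_apply]
  have : (tensorLeftHomEquiv (T ⊗ X) P' P N).symm 0 = 0 := by simp [tensorLeftHomEquiv]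
  rw [this, associator_inv_naturality_right_assoc]
  constructor
  · intro h
    rw [h, comp_zero]
  · intro h
    rw [← cancel_epi (α_ P T X).inv, h, comp_zero]

lemma hasAnnihilators_unit : HasAnnihilators (𝟙_ C) := by
  intro M N a
  refine ⟨N, (λ_ M).inv ≫ a, fun X f => ?_⟩
  rw [leftUnitor_inv_naturality_assoc, ← cancel_epi (λ_ X).inv, comp_zero]

lemma hasAnnihilators_of_iso {T T' : C} (e : T ≅ T') (h : HasAnnihilators T) :
    HasAnnihilators T' := by
  intro M N a
  obtain ⟨Z, k, hk⟩ := h (e.hom ▷ M ≫ a)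
  refine ⟨Z, k, fun X f => ?_⟩
  rw [← hk f, whisker_exchange_assoc, ← cancel_epi (e.hom ▷ X), comp_zero]

lemma hasAnnihilators_of_exactPairing {T T' : C} [ExactPairing T' T] : HasAnnihilators T :=
  hasAnnihilators_of_iso (ρ_ T) (hasAnnihilators_tensor (P' := T') hasAnnihilators_unit)

lemma hasAnnihilators_biprod [HasBinaryBiproducts C] {T₁ T₂ T : C} (h₁ : HasAnnihilators (T₁ ⊗ T))
    (h₂ : HasAnnihilators (T₂ ⊗ T)) : HasAnnihilators ((T₁ ⊞ T₂) ⊗ T) := by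
  intro M N a
  obtain ⟨Z₁, k₁, hk₁⟩ := h₁ ((biprod.inl ▷ T) ▷ M ≫ a)
  obtain ⟨Z₂, k₂, hk₂⟩ := h₂ ((biprod.inr ▷ T) ▷ M ≫ a)
  refine ⟨Z₁ ⊞ Z₂, biprod.lift k₁ k₂, fun X f => ?_⟩
  have e : f ≫ biprod.lift k₁ k₂ = 0 ↔ f ≫ k₁ = 0 ∧ f ≫ k₂ = 0 := by
    constructor
    · intro h
      exact ⟨by simpa using h =≫ biprod.fst, by simpa using h =≫ biprod.snd⟩
    · rintro ⟨h, h'⟩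
      ext <;> simp [h, h']
  rw [e, ← hk₁ f, ← hk₂ f, whisker_exchange_assoc, whisker_exchange_assoc]
  constructor
  · intro h
    exact ⟨by rw [h, comp_zero], by rw [h, comp_zero]⟩
  · rintro ⟨h, h'⟩
    have : 𝟙 (((T₁ ⊞ T₂) ⊗ T) ⊗ X) = (biprod.fst ▷ T) ▷ X ≫ (biprod.inl ▷ T) ▷ X +
        (biprod.snd ▷ T) ▷ X ≫ (biprod.inr ▷ T) ▷ X := by
      rw [← comp_whiskerRight, ← comp_whiskerRight, ← comp_whiskerRight, ← comp_whiskerRight,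
        ← MonoidalPreadditive.add_whiskerRight, ← MonoidalPreadditive.add_whiskerRight,
        biprod.total, id_whiskerRight, id_whiskerRight]
    rw [← Category.id_comp (((T₁ ⊞ T₂) ⊗ T) ◁ f ≫ a), this, Preadditive.add_comp, Category.assoc, Category.assoc, h, h',
      comp_zero, comp_zero, add_zero]

lemma isLeftAdjoint_trivialExt (L : LieAlg C)
    (h : ∀ M : LieMod L, ∃ (K : C) (i : K ⟶ M.V), Mono i ∧ L.X ◁ i ≫ M.act = 0 ∧
      ∀ ⦃X : C⦄ (f : X ⟶ M.V), L.X ◁ f ≫ M.act = 0 → ∃ g, g ≫ i = f) :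
    (trivialExt L).IsLeftAdjoint := by
  choose K i hi h0 hl using h
  have hf : ∀ {X M} (f : (trivialExt L).obj X ⟶ M), L.X ◁ f.hom ≫ M.act = 0 := by
    intro X M f
    exact f.comm.symm.trans zero_comp
  have hi0 : ∀ {X M} (g : X ⟶ K M), L.X ◁ (g ≫ i M) ≫ M.act = 0 := by
    intro X M g
    simp [h0]
  refine ⟨_, ⟨Adjunction.adjunctionOfEquivRight (F := trivialExt L) (G_obj := K)
    (fun X M =>
      { toFun := fun f => (hl M f.hom (hf f)).choose
        invFun := fun g => ⟨g ≫ i M, (zero_comp.trans (hi0 g).symm :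
          (0 : L.X ⊗ X ⟶ X) ≫ g ≫ i M = L.X ◁ (g ≫ i M) ≫ M.act)⟩
        left_inv := fun f => LieMod.hom_ext (hl M _ (hf f)).choose_spec
        right_inv := fun g => ?_ }) ?_⟩⟩
  · have := hi M
    refine (cancel_mono (i M)).1 ?_
    exact (hl M (g ≫ i M) (hi0 g)).choose_spec
  · intro X' X M f g
    have := hi M
    rw [← cancel_mono (i M), Category.assoc]
    have h1 := (hl M ((trivialExt L).map f ≫ g).hom (hf _)).choose_spec
    have h2 := (hl M g.hom (hf g)).choose_spec
    exact h1.trans (congrArg (fun t => f ≫ t) h2.symm)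

lemma isLeftAdjoint_of_hasAnnihilators [HasKernels C] (L : LieAlg C) (h : HasAnnihilators L.X) :
    (trivialExt L).IsLeftAdjoint :=
  isLeftAdjoint_trivialExt L fun M => by
    obtain ⟨Z, k, hk⟩ := h M.act
    exact ⟨kernel k, kernel.ι k, inferInstance, (hk _).2 (kernel.condition k),
      fun X f hf => ⟨kernel.lift k f ((hk f).1 hf), by simp⟩⟩

instance [HasKernels C] (L : LieAlg C) [HasRightDual L.X] : (trivialExt L).IsLeftAdjoint :=
  isLeftAdjoint_of_hasAnnihilators L
    (letI := BraidedCategory.exactPairing_swap L.X (L.Xᘁ)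
     hasAnnihilators_of_exactPairing (T' := L.Xᘁ))

lemma annihilator_stable {Q L K M : C} (q : Q ⊗ L ⟶ L) (d : Q ⊗ M ⟶ M) (a : L ⊗ M ⟶ M)
    (i : K ⟶ M) (hc : (actL L M q + actR L M d) ≫ a = Q ◁ a ≫ d) (h0 : L ◁ i ≫ a = 0) :
    L ◁ (Q ◁ i ≫ d) ≫ a = 0 := by
  have h1 := Q ◁ L ◁ i ≫= hc
  rw [Preadditive.add_comp, Preadditive.comp_add, ← MonoidalCategory.whiskerLeft_comp_assoc,
    h0, ← Category.assoc, ← nat2, Category.assoc, h0] at h1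
  simp only [comp_zero, MonoidalPreadditive.whiskerLeft_zero, zero_comp, zero_add, actR,
    Category.assoc] at h1
  rw [associator_inv_naturality_right_assoc, whisker_exchange_assoc,
    associator_naturality_right_assoc] at h1
  have h2 := ((α_ L Q K).inv ≫ (β_ Q L).inv ▷ K ≫ (α_ Q L K).hom) ≫= h1
  simpa using h2

lemma act_bracket_of_mono {L K M : C} {b : L ⊗ L ⟶ L} {dK : L ⊗ K ⟶ K} {d : L ⊗ M ⟶ M}
    {i : K ⟶ M} [Mono i] (hi : L ◁ i ≫ d = dK ≫ i)
    (h : b ▷ M ≫ d = (α_ L L M).hom ≫ L ◁ d ≫ d -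
      (β_ L L).hom ▷ M ≫ (α_ L L M).hom ≫ L ◁ d ≫ d) :
    b ▷ K ≫ dK = (α_ L L K).hom ≫ L ◁ dK ≫ dK -
      (β_ L L).hom ▷ K ≫ (α_ L L K).hom ≫ L ◁ dK ≫ dK := by
  have e : (α_ L L K).hom ≫ L ◁ dK ≫ dK ≫ i = (L ⊗ L) ◁ i ≫ (α_ L L M).hom ≫ L ◁ d ≫ d := by
    rw [← hi, ← MonoidalCategory.whiskerLeft_comp_assoc, ← hi]
    simp
  rw [← cancel_mono i]
  simp only [Preadditive.sub_comp, Category.assoc, e]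
  rw [← hi, ← whisker_exchange_assoc, h, Preadditive.comp_sub, whisker_exchange_assoc]

lemma comm_of_mono {L X K M : C} {dX : L ⊗ X ⟶ X} {dK : L ⊗ K ⟶ K} {d : L ⊗ M ⟶ M}
    {i : K ⟶ M} [Mono i] (hi : L ◁ i ≫ d = dK ≫ i) {f : X ⟶ M} {g : X ⟶ K} (hg : g ≫ i = f)
    (hf : dX ≫ f = L ◁ f ≫ d) : dX ≫ g = L ◁ g ≫ dK := by
  rw [← cancel_mono i, Category.assoc, Category.assoc, hg, hf, ← hi, ← hg]
  simp

/-- A second layer: for a Lie algebra `L` in the category of `Q`-modules, invariants of an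
`L`-module again carry an action of `Q`. -/
lemma isLeftAdjoint_trivialExt_lieMod [HasKernels C] {Q : LieAlg C} (L : LieAlg (LieMod Q))
    (h : HasAnnihilators L.X.V) : (trivialExt L).IsLeftAdjoint :=
  isLeftAdjoint_trivialExt L fun M => by
    obtain ⟨Z, k, hk⟩ := h M.act.hom
    have h0 : L.X.V ◁ kernel.ι k ≫ M.act.hom = 0 := (hk _).2 (kernel.condition k)
    have hd : (Q.X ◁ kernel.ι k ≫ M.V.act) ≫ k = 0 :=
      (hk _).1 (annihilator_stable _ _ _ (kernel.ι k) M.act.comm h0)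
    have hdl : Q.X ◁ kernel.ι k ≫ M.V.act = kernel.lift k _ hd ≫ kernel.ι k := by simp
    refine ⟨⟨kernel k, kernel.lift k _ hd, act_bracket_of_mono hdl M.V.act_bracket⟩,
      ⟨kernel.ι k, hdl.symm⟩, ?_, LieMod.hom_ext h0, ?_⟩
    · exact (LieMod.forget Q).mono_of_mono_map (inferInstanceAs (Mono (kernel.ι k)))
    · intro X f hf
      have hf' := congrArg LieMod.Hom.hom hf
      refine ⟨⟨kernel.lift k f.hom ((hk _).1 hf'), ?_⟩, LieMod.hom_ext (kernel.lift_ι _ _ _)⟩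
      exact comm_of_mono hdl (kernel.lift_ι _ _ _) f.comm

end TrivialExtension

section Doubling

lemma braiding_tensorμ (A B : C) :
    (β_ (A ⊗ B) (A ⊗ B)).hom ≫ tensorμ A B A B =
      tensorμ A B A B ≫ ((β_ A A).hom ⊗ₘ (β_ B B).hom) := by
  have h := SymmetricCategory.tensorμ_braid_swap A B
  have e : tensorδ A B A B = tensorμ A A B B := by
    simp [tensorμ, tensorδ, SymmetricCategory.braiding_swap_eq_inv_braiding B A]
  rw [← e] at h
  have h2 := tensorμ A B A B ≫= h =≫ tensorμ A B A B
  simpa using h2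

open scoped MonObj

lemma tensorHom_neg {W X Y Z : C} (f : W ⟶ X) (g : Y ⟶ Z) : f ⊗ₘ (-g) = -(f ⊗ₘ g) := by
  simp [MonoidalCategory.tensorHom_def, whiskerLeft_neg]

lemma tensorHom_sub {W X Y Z : C} (f : W ⟶ X) (g h : Y ⟶ Z) :
    f ⊗ₘ (g - h) = (f ⊗ₘ g) - (f ⊗ₘ h) := by
  simp [MonoidalCategory.tensorHom_def, whiskerLeft_sub]

/-- The Lie algebra `A ⊗ L`, for a commutative algebra `A`, with bracket
`[a ⊗ x, b ⊗ y] = ab ⊗ [x, y]`. -/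
@[simps]
def tensorLie (A : C) [MonObj A] [IsCommMonObj A] (L : LieAlg C) : LieAlg C where
  X := A ⊗ L.X
  bracket := tensorμ A L.X A L.X ≫ (μ[A] ⊗ₘ L.bracket)
  antisymm := by
    rw [← Category.assoc, braiding_tensorμ, Category.assoc, tensorHom_comp_tensorHom,
      IsCommMonObj.mul_comm, L.antisymm, tensorHom_neg, Preadditive.comp_neg]
  jacobi := by
    have h1 : (tensorμ A L.X A L.X ≫ (μ[A] ⊗ₘ L.bracket)) ▷ (A ⊗ L.X) ≫
        tensorμ A L.X A L.X ≫ (μ[A] ⊗ₘ L.bracket) =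
        (tensorμ A L.X A L.X ▷ (A ⊗ L.X) ≫ tensorμ (A ⊗ A) (L.X ⊗ L.X) A L.X) ≫
          ((μ[A] ▷ A ≫ μ[A]) ⊗ₘ (L.bracket ▷ L.X ≫ L.bracket)) := by
      rw [comp_whiskerRight, Category.assoc, tensorμ_natural_left_assoc, Category.assoc,
        tensorHom_comp_tensorHom]
    have h2 : (α_ (A ⊗ L.X) (A ⊗ L.X) (A ⊗ L.X)).hom ≫
        (A ⊗ L.X) ◁ (tensorμ A L.X A L.X ≫ (μ[A] ⊗ₘ L.bracket)) ≫
        tensorμ A L.X A L.X ≫ (μ[A] ⊗ₘ L.bracket) =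
        (tensorμ A L.X A L.X ▷ (A ⊗ L.X) ≫ tensorμ (A ⊗ A) (L.X ⊗ L.X) A L.X) ≫
          ((μ[A] ▷ A ≫ μ[A]) ⊗ₘ ((α_ _ _ _).hom ≫ L.X ◁ L.bracket ≫ L.bracket)) := by
      have := tensor_associativity A L.X A L.X A L.X
      rw [MonObj.mul_assoc, ← tensorHom_comp_tensorHom, Category.assoc, reassoc_of% this,
        MonoidalCategory.whiskerLeft_comp, Category.assoc, tensorμ_natural_right_assoc,
        tensorHom_comp_tensorHom]
    have h3 : (β_ (A ⊗ L.X) (A ⊗ L.X)).hom ▷ (A ⊗ L.X) ≫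
        (tensorμ A L.X A L.X ▷ (A ⊗ L.X) ≫ tensorμ (A ⊗ A) (L.X ⊗ L.X) A L.X) =
        (tensorμ A L.X A L.X ▷ (A ⊗ L.X) ≫ tensorμ (A ⊗ A) (L.X ⊗ L.X) A L.X) ≫
          ((β_ A A).hom ▷ A ⊗ₘ (β_ L.X L.X).hom ▷ L.X) := by
      rw [← comp_whiskerRight_assoc, braiding_tensorμ, comp_whiskerRight, Category.assoc,
        tensorμ_natural_left, Category.assoc]
    have h4 : (β_ A A).hom ▷ A ≫ μ[A] ▷ A ≫ μ[A] = μ[A] ▷ A ≫ μ[A] := by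
      rw [← comp_whiskerRight_assoc, IsCommMonObj.mul_comm]
    rw [h1, h2, ← Category.assoc ((β_ (A ⊗ L.X) (A ⊗ L.X)).hom ▷ (A ⊗ L.X)), h3]
    simp only [Category.assoc, tensorHom_comp_tensorHom, h4]
    rw [← Preadditive.comp_sub, ← Preadditive.comp_sub, ← tensorHom_sub, ← L.jacobi]

/-- The Lie algebra `L` with the zero action of `Q`. -/
@[simps]
def trivialLie (Q L : LieAlg C) : LieAlg (LieMod Q) where
  X := (trivialExt Q).obj L.X
  bracket := ⟨L.bracket, leibniz_zero L.bracket⟩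
  antisymm := LieMod.hom_ext L.antisymm
  jacobi := LieMod.hom_ext L.jacobi

/-- The abelian Lie algebra on an object. -/
@[simps]
def abelianLie (X : C) : LieAlg C := ⟨X, 0, by simp, by simp⟩

end Doubling

section Dual

/-- The action on a dual `W` of `M`, for which evaluation `W ⊗ M ⟶ 𝟙` is invariant. -/
def dualAct {L M : C} (a : L ⊗ M ⟶ M) (W : C) [ExactPairing M W] : L ⊗ W ⟶ W :=
  tensorRightHomEquiv (L ⊗ W) M W (𝟙_ C)
    (-((α_ L W M).hom ≫ actR W M a ≫ ε_ M W)) ≫ (λ_ W).hom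

lemma whiskerRight_evaluation {X M W : C} [ExactPairing M W] (f : X ⊗ M ⟶ 𝟙_ C) :
    (tensorRightHomEquiv X M W (𝟙_ C) f ≫ (λ_ W).hom) ▷ M ≫ ε_ M W = f := by
  conv_rhs => rw [← (tensorRightHomEquiv X M W (𝟙_ C)).symm_apply_apply f]
  generalize tensorRightHomEquiv X M W (𝟙_ C) f = g
  have e : (λ_ (𝟙_ C)).inv ≫ (ρ_ (𝟙_ C)).hom = 𝟙 _ := by rw [unitors_inv_equal]; simp
  simp [tensorRightHomEquiv, e]

lemma hom_dual_ext {X M W : C} [ExactPairing M W] {f g : X ⟶ W}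
    (h : f ▷ M ≫ ε_ M W = g ▷ M ≫ ε_ M W) : f = g := by
  rw [← cancel_mono (λ_ W).inv]
  apply (tensorRightHomEquiv X M W (𝟙_ C)).symm.injective
  have e : (λ_ (𝟙_ C)).inv ≫ (ρ_ (𝟙_ C)).hom = 𝟙 _ := by rw [unitors_inv_equal]; simp
  simpa [tensorRightHomEquiv, e] using h

lemma dualAct_evaluation {L M : C} (a : L ⊗ M ⟶ M) (W : C) [ExactPairing M W] :
    actL W M (dualAct a W) ≫ ε_ M W = -(actR W M a ≫ ε_ M W) := by
  rw [actL, Category.assoc, dualAct, whiskerRight_evaluation]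
  simp

/-- The dual module (contragredient action). -/
@[simps]
def LieMod.dual {L : LieAlg C} (M : LieMod L) (W : C) [ExactPairing M.V W] : LieMod L where
  V := W
  act := dualAct M.act W
  act_bracket := by
    apply hom_dual_ext (M := M.V)
    have hA := dualAct_evaluation M.act W
    have hR := bracket_actR W M.act_bracket
    have hAA := actL_actL (N := M.V) (dualAct M.act W)
    have hAR := actL_actR (dualAct M.act W) M.act
    have key : (α_ L.X L.X (W ⊗ M.V)).hom ≫ L.X ◁ actL W M.V (dualAct M.act W) ≫
        actL W M.V (dualAct M.act W) ≫ ε_ M.V W =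
        (β_ L.X L.X).hom ▷ (W ⊗ M.V) ≫ (α_ L.X L.X (W ⊗ M.V)).hom ≫
          L.X ◁ actR W M.V M.act ≫ actR W M.V M.act ≫ ε_ M.V W := by
      have e := (β_ L.X L.X).hom ▷ (W ⊗ M.V) ≫= hAR
      rw [← comp_whiskerRight_assoc, SymmetricCategory.symmetry, id_whiskerRight,
        Category.id_comp] at e
      have e' := e =≫ ε_ M.V W
      simp only [Category.assoc, hA, Preadditive.comp_neg] at e'
      rw [hA]
      simp only [Preadditive.comp_neg, ← e', neg_neg]
    have key' := (β_ L.X L.X).hom ▷ (W ⊗ M.V) ≫= key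
    rw [← comp_whiskerRight_assoc, SymmetricCategory.symmetry, id_whiskerRight,
      Category.id_comp] at key'
    rw [← cancel_epi (α_ (L.X ⊗ L.X) W M.V).inv]
    have g1 : (α_ (L.X ⊗ L.X) W M.V).inv ≫ (L.bracket ▷ W ≫ dualAct M.act W) ▷ M.V ≫ ε_ M.V W =
        L.bracket ▷ (W ⊗ M.V) ≫ actL W M.V (dualAct M.act W) ≫ ε_ M.V W := by
      simp [actL]
    have g2 : (α_ (L.X ⊗ L.X) W M.V).inv ≫
        ((α_ L.X L.X W).hom ≫ L.X ◁ dualAct M.act W ≫ dualAct M.act W) ▷ M.V ≫ ε_ M.V W =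
        (α_ L.X L.X (W ⊗ M.V)).hom ≫ L.X ◁ actL W M.V (dualAct M.act W) ≫
          actL W M.V (dualAct M.act W) ≫ ε_ M.V W := by
      rw [reassoc_of% hAA]
    have g3 : (α_ (L.X ⊗ L.X) W M.V).inv ≫ ((β_ L.X L.X).hom ▷ W ≫
        (α_ L.X L.X W).hom ≫ L.X ◁ dualAct M.act W ≫ dualAct M.act W) ▷ M.V ≫ ε_ M.V W =
        (β_ L.X L.X).hom ▷ (W ⊗ M.V) ≫ (α_ L.X L.X (W ⊗ M.V)).hom ≫
          L.X ◁ actL W M.V (dualAct M.act W) ≫ actL W M.V (dualAct M.act W) ≫ ε_ M.V W := by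
      rw [comp_whiskerRight, Category.assoc, ← associator_inv_naturality_left_assoc, g2]
    rw [sub_whiskerRight, Preadditive.sub_comp, Preadditive.comp_sub, g1, g2, g3, key', key, hA,
      Preadditive.comp_neg, reassoc_of% hR]
    simp only [Preadditive.sub_comp, Category.assoc, neg_sub]

/-- The adjoint module. -/
@[simps]
def LieAlg.adjoint (L : LieAlg C) : LieMod L := ⟨L.X, L.bracket, L.jacobi⟩

/-- The coadjoint module on the dual object. -/
def LieAlg.coadjoint (L : LieAlg C) [HasRightDual L.X] : LieMod L :=
  letI : ExactPairing L.adjoint.V (L.X)ᘁ := inferInstanceAs (ExactPairing L.X (L.X)ᘁ)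
  L.adjoint.dual (L.X)ᘁ

end Dual

section Supercategory

/-- The symmetric square: coinvariants of the symmetry on `X ⊗ X`. -/
noncomputable def symSquare [HasCokernels C] (X : C) : C := cokernel (𝟙 (X ⊗ X) - (β_ X X).hom)

/-- The exterior square: coinvariants of the symmetry twisted by the sign. -/
noncomputable def extSquare [HasCokernels C] (X : C) : C := cokernel (𝟙 (X ⊗ X) + (β_ X X).hom)

end Supercategory

end LieTheory

/-- A supercategory: a well-powered, complete, `ℚ`-linear abelian tensor category with a chosen
object `P` with `Λ² P ≅ 𝟙` and `S² P ≅ 0`. -/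
class Supercategory (S : Type u) [Category.{v} S] [Abelian S] [Linear ℚ S] [MonoidalCategory S]
    [SymmetricCategory S] [MonoidalPreadditive S] where
  /-- Well-powered. -/
  wellPowered : WellPowered.{v} S
  hasLimits : HasLimits S
  /-- The odd line. -/
  P : S
  /-- The chosen isomorphism. -/
  extP : extSquare P ≅ 𝟙_ S
  symP : IsZero (symSquare P)

section Odd

variable {S : Type u} [Category.{v} S] [Abelian S] [Linear ℚ S] [MonoidalCategory S]
  [SymmetricCategory S] [MonoidalPreadditive S] [Supercategory S]

open Supercategory (P)

lemma braiding_P : (β_ (P : S) P).hom = -𝟙 _ := by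
  have h : Epi (𝟙 ((P : S) ⊗ P) - (β_ P P).hom) :=
    Preadditive.epi_of_isZero_cokernel _ Supercategory.symP
  have h2 : (𝟙 ((P : S) ⊗ P) - (β_ P P).hom) ≫ (𝟙 (P ⊗ P) + (β_ P P).hom) = 0 := by
    simp [Preadditive.sub_comp]
  rw [← cancel_epi (𝟙 ((P : S) ⊗ P) - (β_ P P).hom),
    eq_neg_iff_add_eq_zero.2 ((add_comm _ _).trans
      ((cancel_epi (𝟙 ((P : S) ⊗ P) - (β_ P P).hom)).1 (h2.trans comp_zero.symm)))]

/-- The isomorphism `P ⊗ P ≅ 𝟙` given by the chosen isomorphism `Λ² P ≅ 𝟙`. -/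
noncomputable def oddPairing : (P : S) ⊗ P ≅ 𝟙_ S :=
  haveI : IsIso (cokernel.π (𝟙 ((P : S) ⊗ P) + (β_ P P).hom)) := by
    rw [show 𝟙 ((P : S) ⊗ P) + (β_ P P).hom = 0 by rw [braiding_P]; simp]
    infer_instance
  asIso (cokernel.π (𝟙 ((P : S) ⊗ P) + (β_ P P).hom)) ≪≫ Supercategory.extP

lemma whiskerLeft_oddPairing :
    (α_ (P : S) P P).hom ≫ P ◁ oddPairing.hom ≫ (ρ_ P).hom = oddPairing.hom ▷ P ≫ (λ_ P).hom := by
  have h1 : (β_ (P : S) (P ⊗ P)).hom = (α_ P P P).inv := by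
    rw [braiding_tensor_right_hom, braiding_P]
    simp [neg_whiskerRight, whiskerLeft_neg]
  have h2 := braiding_naturality_right (P : S) oddPairing.hom
  rw [h1, braiding_tensorUnit_right] at h2
  have h3 := (α_ (P : S) P P).hom ≫= h2 =≫ (λ_ P).hom
  simpa using h3

/-- `P` is its own dual. -/
noncomputable instance : ExactPairing (P : S) P where
  coevaluation' := oddPairing.inv
  evaluation' := oddPairing.hom
  coevaluation_evaluation' := by
    rw [← cancel_mono (λ_ _).hom, Category.assoc, Category.assoc, ← whiskerLeft_oddPairing]
    simp [← MonoidalCategory.whiskerLeft_comp_assoc]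
  evaluation_coevaluation' := by
    rw [← cancel_mono (ρ_ _).hom, Category.assoc, Category.assoc, whiskerLeft_oddPairing]
    simp [← comp_whiskerRight_assoc]

noncomputable instance : HasRightDual (P : S) := ⟨P⟩

variable (S) in
/-- The abelian Lie algebra `Q` on the object `P`; its modules are the supercomplexes. -/
noncomputable abbrev oddLie : LieAlg S := abelianLie P

variable (S) in
/-- The category of supercomplexes. -/
abbrev Supercomplex := LieMod (oddLie S)

/-- The odd endomorphism of `𝟙 ⊕ P` which is zero on `𝟙` and maps `P` to `𝟙` by the odd morphism
corresponding to the identity. -/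
noncomputable def doubleD : (P : S) ⊗ (𝟙_ S ⊞ P) ⟶ 𝟙_ S ⊞ P :=
  P ◁ biprod.snd ≫ oddPairing.hom ≫ biprod.inl

lemma doubleD_fst : (doubleD : _ ⟶ 𝟙_ S ⊞ P) ≫ biprod.fst = P ◁ biprod.snd ≫ oddPairing.hom := by
  simp [doubleD]

lemma doubleD_snd : (doubleD : _ ⟶ 𝟙_ S ⊞ P) ≫ biprod.snd =
    P ◁ biprod.snd ≫ (0 : P ⊗ P ⟶ P) := by
  simp [doubleD]

lemma doubleD_doubleD : (P : S) ◁ doubleD ≫ (doubleD : _ ⟶ 𝟙_ S ⊞ P) = 0 := by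
  have : (P : S) ◁ (doubleD : _ ⟶ 𝟙_ S ⊞ P) ≫ P ◁ biprod.snd = 0 := by
    rw [← MonoidalCategory.whiskerLeft_comp, doubleD_snd]
    simp
  have e : (doubleD : _ ⟶ 𝟙_ S ⊞ P) = P ◁ biprod.snd ≫ oddPairing.hom ≫ biprod.inl := rfl
  nth_rewrite 2 [e]
  rw [reassoc_of% this, zero_comp]

variable (S) in
/-- The supercomplex `D = S(P) = 𝟙 ⊕ P`. -/
@[simps]
noncomputable def double : Supercomplex S where
  V := 𝟙_ S ⊞ P
  act := doubleD
  act_bracket := by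
    have h : ∀ f : (P : S) ⊗ P ⊗ (𝟙_ S ⊞ P) ⟶ 𝟙_ S ⊞ P, f = 0 →
        (0 : (P : S) ⊗ P ⟶ P) ▷ (𝟙_ S ⊞ P) ≫ doubleD = (α_ _ _ _).hom ≫ f -
          (β_ P P).hom ▷ (𝟙_ S ⊞ P) ≫ (α_ _ _ _).hom ≫ f := by
      rintro f rfl
      simp
    exact h _ doubleD_doubleD

/-- The multiplication on `D`: `P` is a square-zero ideal. -/
noncomputable def doubleMul : (𝟙_ S ⊞ (P : S)) ⊗ (𝟙_ S ⊞ P) ⟶ 𝟙_ S ⊞ P :=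
  biprod.lift ((biprod.fst ⊗ₘ biprod.fst) ≫ (λ_ _).hom)
    ((biprod.fst ⊗ₘ biprod.snd) ≫ (λ_ _).hom + (biprod.snd ⊗ₘ biprod.fst) ≫ (ρ_ _).hom)

@[simp]
lemma doubleMul_fst : (doubleMul : _ ⟶ 𝟙_ S ⊞ P) ≫ biprod.fst =
    (biprod.fst ⊗ₘ biprod.fst) ≫ (λ_ _).hom := by simp [doubleMul]

@[simp]
lemma doubleMul_snd : (doubleMul : _ ⟶ 𝟙_ S ⊞ P) ≫ biprod.snd =
    (biprod.fst ⊗ₘ biprod.snd) ≫ (λ_ _).hom + (biprod.snd ⊗ₘ biprod.fst) ≫ (ρ_ _).hom := by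
  simp [doubleMul]

lemma doubleMul_comm : (actL _ _ doubleD + actR _ _ doubleD) ≫ doubleMul =
    P ◁ doubleMul ≫ (doubleD : _ ⟶ 𝟙_ S ⊞ P) := by
  apply biprod.hom_ext
  · have r : (P ◁ doubleMul ≫ (doubleD : _ ⟶ 𝟙_ S ⊞ P)) ≫ biprod.fst =
        P ◁ (doubleMul ≫ biprod.snd) ≫ oddPairing.hom := by
      rw [Category.assoc, doubleD_fst, MonoidalCategory.whiskerLeft_comp, Category.assoc]
    have z1 := actL_tensorHom (biprod.fst : 𝟙_ S ⊞ P ⟶ _) doubleD_fst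
    have z2 := actR_tensorHom (biprod.fst : 𝟙_ S ⊞ P ⟶ _) doubleD_fst
    rw [r, doubleMul_snd, Category.assoc, doubleMul_fst, Preadditive.add_comp,
      reassoc_of% z1, reassoc_of% z2, unit_right_string, unit_left_string]
    simp only [MonoidalPreadditive.whiskerLeft_add, Preadditive.add_comp,
      MonoidalCategory.whiskerLeft_comp, Category.assoc]
    rw [add_comm]
  · have r : (P ◁ doubleMul ≫ (doubleD : _ ⟶ 𝟙_ S ⊞ P)) ≫ biprod.snd = 0 := by
      rw [Category.assoc, doubleD_snd, comp_zero, comp_zero]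
    have z1 := actL_tensorHom (biprod.fst : 𝟙_ S ⊞ P ⟶ _) doubleD_snd
    have z2 := actR_tensorHom (biprod.fst : 𝟙_ S ⊞ P ⟶ _) doubleD_snd
    have z3 := actL_tensorHom (biprod.snd : 𝟙_ S ⊞ P ⟶ _) doubleD_fst
    have z4 := actR_tensorHom (biprod.snd : 𝟙_ S ⊞ P ⟶ _) doubleD_fst
    rw [r, Category.assoc, doubleMul_snd, Preadditive.add_comp, Preadditive.comp_add,
      Preadditive.comp_add, reassoc_of% z1, reassoc_of% z2, reassoc_of% z3, reassoc_of% z4,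
      braiding_P, ← whiskerLeft_oddPairing]
    simp [neg_whiskerRight]

lemma doubleMul_assoc : (doubleMul (S := S)) ▷ _ ≫ doubleMul =
    (α_ _ _ _).hom ≫ _ ◁ doubleMul ≫ doubleMul := by
  have assoc : ∀ {X Y Z : S} (f : 𝟙_ S ⊞ P ⟶ X) (g : 𝟙_ S ⊞ P ⟶ Y) (h : 𝟙_ S ⊞ P ⟶ Z),
      (α_ _ _ _).hom ≫ (f ⊗ₘ (g ⊗ₘ h)) = ((f ⊗ₘ g) ⊗ₘ h) ≫ (α_ _ _ _).hom :=
    fun f g h => (associator_naturality f g h).symm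
  apply biprod.hom_ext
  · rw [Category.assoc, doubleMul_fst, ← Category.assoc, whiskerRight_tensorHom, doubleMul_fst,
      Category.assoc, Category.assoc, doubleMul_fst, ← Category.assoc (_ ◁ doubleMul),
      whiskerLeft_tensorHom, doubleMul_fst, comp_tensorHom_left, comp_tensorHom_right,
      Category.assoc, Category.assoc, reassoc_of% assoc]
    congr 1
    monoidal
  · rw [Category.assoc, doubleMul_snd, Preadditive.comp_add, ← Category.assoc,
      whiskerRight_tensorHom, ← Category.assoc, whiskerRight_tensorHom, doubleMul_fst,
      doubleMul_snd, Category.assoc, Category.assoc, doubleMul_snd, Preadditive.comp_add,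
      ← Category.assoc (_ ◁ doubleMul), whiskerLeft_tensorHom,
      ← Category.assoc (_ ◁ doubleMul), whiskerLeft_tensorHom, doubleMul_fst, doubleMul_snd,
      MonoidalPreadditive.add_tensor, MonoidalPreadditive.tensor_add]
    simp only [comp_tensorHom_left, comp_tensorHom_right, Preadditive.add_comp,
      Preadditive.comp_add, Category.assoc, reassoc_of% assoc]
    rw [add_assoc]
    congr 1
    · congr 1
      monoidal
    · congr 1
      · congr 1
        monoidal
      · congr 1
        monoidal

lemma double_one_mul : biprod.inl ▷ _ ≫ doubleMul = (λ_ (𝟙_ S ⊞ (P : S))).hom := by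
  apply biprod.hom_ext
  · rw [Category.assoc, doubleMul_fst, ← Category.assoc, whiskerRight_tensorHom, biprod.inl_fst]
    simp
  · rw [Category.assoc, doubleMul_snd, Preadditive.comp_add, ← Category.assoc,
      whiskerRight_tensorHom, ← Category.assoc, whiskerRight_tensorHom, biprod.inl_fst,
      biprod.inl_snd]
    simp

lemma doubleMul_braiding : (β_ _ _).hom ≫ doubleMul (S := S) = doubleMul := by
  apply biprod.hom_ext
  · rw [Category.assoc, doubleMul_fst, ← braiding_naturality_assoc, braiding_tensorUnit_left]
    simp [unitors_equal]
  · rw [Category.assoc, doubleMul_snd, Preadditive.comp_add, ← braiding_naturality_assoc,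
      ← braiding_naturality_assoc]
    simp [add_comm]

lemma double_mul_one : _ ◁ biprod.inl ≫ doubleMul = (ρ_ (𝟙_ S ⊞ (P : S))).hom := by
  rw [← doubleMul_braiding, braiding_naturality_right_assoc, double_one_mul]
  simp

lemma inl_doubleD : (0 : (P : S) ⊗ 𝟙_ S ⟶ 𝟙_ S) ≫ biprod.inl =
    P ◁ biprod.inl ≫ (doubleD : _ ⟶ 𝟙_ S ⊞ P) := by
  rw [doubleD, ← MonoidalCategory.whiskerLeft_comp_assoc, biprod.inl_snd]
  simp

noncomputable instance : MonObj (double S) where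
  one := ⟨biprod.inl, inl_doubleD⟩
  mul := ⟨doubleMul, doubleMul_comm⟩
  one_mul := LieMod.hom_ext double_one_mul
  mul_one := LieMod.hom_ext double_mul_one
  mul_assoc := LieMod.hom_ext doubleMul_assoc

instance : IsCommMonObj (double S) where
  mul_comm := LieMod.hom_ext doubleMul_braiding

end Odd

section Cohomology

variable {S : Type u} [Category.{v} S] [Abelian S] [Linear ℚ S] [MonoidalCategory S]
  [SymmetricCategory S] [MonoidalPreadditive S] [Supercategory S]

open Supercategory (P)

open scoped MonObj

lemma odd_sq_zero {X : S} (d : P ⊗ X ⟶ X) (h : (0 : (P : S) ⊗ P ⟶ P) ▷ X ≫ d =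
    (α_ _ _ _).hom ≫ P ◁ d ≫ d - (β_ P P).hom ▷ X ≫ (α_ _ _ _).hom ≫ P ◁ d ≫ d) :
    P ◁ d ≫ d = 0 := by
  generalize P ◁ d ≫ d = f at h
  rw [braiding_P, neg_whiskerRight, id_whiskerRight, Preadditive.neg_comp, Category.id_comp,
    sub_neg_eq_add, ← Preadditive.comp_add, MonoidalPreadditive.zero_whiskerRight,
    zero_comp] at h
  have h2 : f + f = 0 := by simpa using ((α_ _ _ _).inv ≫= h).symm
  have h3 : (2 : ℚ) • f = 0 := by rw [two_smul, h2]
  exact (smul_eq_zero.1 h3).resolve_left (by norm_num)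

/-- The differential of a supercomplex squares to zero. -/
lemma act_act_eq_zero (X : Supercomplex S) : (P : S) ◁ X.act ≫ X.act = 0 :=
  odd_sq_zero X.act X.act_bracket

instance : (trivialExt (oddLie S)).IsLeftAdjoint :=
  isLeftAdjoint_of_hasAnnihilators (oddLie S) (hasAnnihilators_of_exactPairing (T := P) (T' := P))

/-- The cocycles `ker d`: the largest subobject with zero differential. -/
noncomputable abbrev cocycles : Supercomplex S ⥤ S := invariants (oddLie S)

/-- The differential, as a morphism `P ⊗ X ⟶ ker d`. -/
noncomputable def boundary (X : Supercomplex S) : P ⊗ X.V ⟶ cocycles.obj X :=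
  (invariantsAdj (oddLie S)).homEquiv (P ⊗ X.V) X
    ⟨X.act, (zero_comp (f := X.act)).trans (act_act_eq_zero X).symm⟩

lemma boundary_naturality {X Y : Supercomplex S} (f : X ⟶ Y) :
    boundary X ≫ cocycles.map f = P ◁ f.hom ≫ boundary Y := by
  rw [boundary, boundary, ← Adjunction.homEquiv_naturality_right,
    ← Adjunction.homEquiv_naturality_left]
  congr 1
  exact LieMod.hom_ext f.comm

/-- The cohomology functor `(ker d) / (im d)` on supercomplexes. -/
@[simps]
noncomputable def complexCohomology : Supercomplex S ⥤ S where
  obj X := cokernel (boundary X)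
  map f := cokernel.map _ _ (P ◁ f.hom) (cocycles.map f) (boundary_naturality f)

variable (L₀ : LieAlg S)

/-- The Lie algebra `L = D L₀` in supercomplexes. -/
noncomputable def doubleLie : LieAlg (Supercomplex S) :=
  tensorLie (double S) (trivialLie (oddLie S) L₀)

/-- The category of `L`-modules in supercomplexes. -/
abbrev DoubleMod := LieMod (doubleLie L₀)

instance [HasRightDual L₀.X] : (trivialExt (doubleLie L₀)).IsLeftAdjoint := by
  let := BraidedCategory.exactPairing_swap L₀.X (L₀.X)ᘁ
  have h : HasAnnihilators L₀.X := hasAnnihilators_of_exactPairing (T' := (L₀.X)ᘁ)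
  exact isLeftAdjoint_trivialExt_lieMod (doubleLie L₀)
    (hasAnnihilators_biprod (hasAnnihilators_tensor (P' := 𝟙_ S) h)
      (hasAnnihilators_tensor (P' := P) h))

/-- The action of `L₀ ⊆ D L₀`, on underlying objects. -/
noncomputable def evenAct (X : DoubleMod L₀) : L₀.X ⊗ X.V.V ⟶ X.V.V :=
  ((λ_ L₀.X).inv ≫ biprod.inl ▷ L₀.X) ▷ X.V.V ≫ X.act.hom

/-- The action of `P L₀ ⊆ D L₀`, on underlying objects. -/
noncomputable def oddAct (X : DoubleMod L₀) : (P ⊗ L₀.X) ⊗ X.V.V ⟶ X.V.V :=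
  (biprod.inr ▷ L₀.X) ▷ X.V.V ≫ X.act.hom

variable [HasRightDual L₀.X]

/-- The evaluation `P L₀ ⊗ P L₀* ⟶ 𝟙`. -/
noncomputable def oddEvaluation : (P ⊗ L₀.X) ⊗ (P ⊗ (L₀.X)ᘁ) ⟶ 𝟙_ S :=
  tensorμ P L₀.X P (L₀.X)ᘁ ≫
    (oddPairing.hom ⊗ₘ ((β_ L₀.X (L₀.X)ᘁ).hom ≫ ε_ L₀.X (L₀.X)ᘁ)) ≫ (λ_ (𝟙_ S)).hom

/-- A connection on an `L`-module `X` with distinguished morphism `u : 𝟙 ⟶ X`: an odd morphism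
`θ` from `L₀*` to `X`, equivariant for `L₀`, whose contraction with `P L₀` is evaluation. -/
structure IsConnection {X : DoubleMod L₀} (u : 𝟙_ (DoubleMod L₀) ⟶ X)
    (θ : P ⊗ (L₀.X)ᘁ ⟶ X.V.V) : Prop where
  equivariant : L₀.X ◁ θ ≫ evenAct L₀ X = actR P (L₀.X)ᘁ L₀.coadjoint.act ≫ θ
  contraction : (P ⊗ L₀.X) ◁ θ ≫ oddAct L₀ X = oddEvaluation L₀ ≫ u.hom.hom

lemma restrict_comm {T T' X Y : S} (j : T ⟶ T') {a : T' ⊗ X ⟶ X} {b : T' ⊗ Y ⟶ Y} {f : X ⟶ Y}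
    (hf : a ≫ f = T' ◁ f ≫ b) : (j ▷ X ≫ a) ≫ f = T ◁ f ≫ j ▷ Y ≫ b := by
  rw [Category.assoc, hf, whisker_exchange_assoc]

variable {L₀} in
lemma IsConnection.comp {X Y : DoubleMod L₀} {u : 𝟙_ (DoubleMod L₀) ⟶ X}
    {θ : P ⊗ (L₀.X)ᘁ ⟶ X.V.V} (h : IsConnection L₀ u θ) (f : X ⟶ Y) :
    IsConnection L₀ (u ≫ f) (θ ≫ f.hom.hom) := by
  have hf : X.act.hom ≫ f.hom.hom = (doubleLie L₀).X.V ◁ f.hom.hom ≫ Y.act.hom :=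
    congrArg LieMod.Hom.hom f.comm
  have h0 : evenAct L₀ X ≫ f.hom.hom = L₀.X ◁ f.hom.hom ≫ evenAct L₀ Y :=
    restrict_comm _ hf
  have h1 : oddAct L₀ X ≫ f.hom.hom = (P ⊗ L₀.X) ◁ f.hom.hom ≫ oddAct L₀ Y :=
    restrict_comm _ hf
  constructor
  · rw [MonoidalCategory.whiskerLeft_comp, Category.assoc, ← h0, ← Category.assoc, h.equivariant,
      Category.assoc]
  · rw [MonoidalCategory.whiskerLeft_comp, Category.assoc, ← h1, ← Category.assoc, h.contraction]
    exact Category.assoc _ _ _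

/-- The functor of connections on commutative algebras in `L`-modules. -/
def connections : CommMon (DoubleMod L₀) ⥤ Type v where
  obj A := { θ : (P ⊗ (L₀.X)ᘁ : S) ⟶ A.X.V.V // IsConnection L₀ η[A.X] θ }
  map {A B} f := ↾fun θ => ⟨θ.1 ≫ f.hom.hom.hom.hom, by
    have h := θ.2.comp f.hom.hom
    have e : η[A.X] ≫ f.hom.hom = η[B.X] := IsMonHom.one_hom f.hom.hom
    exact e ▸ h⟩
  map_id A := by
    ext θ
    exact Category.comp_id _
  map_comp f g := by
    ext θ
    exact (Category.assoc _ _ _).symm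

/-- `W` is the commutative Weil object `C_L`: it represents the functor of connections. -/
abbrev CommutativeWeilObject (W : CommMon (DoubleMod L₀)) := (connections L₀).CorepresentableBy W

/-- The cohomology functor on `L`-modules: cohomology of the supercomplex of `L`-invariants. -/
noncomputable def cohomology : DoubleMod L₀ ⥤ S :=
  invariants (doubleLie L₀) ⋙ complexCohomology

/-- Twisted cohomology `H_Z(X) = H(Z ⊗ X)`. -/
noncomputable def twistedCohomology (Z : DoubleMod L₀) : DoubleMod L₀ ⥤ S :=
  tensorLeft Z ⋙ cohomology L₀

/-- The cocycles of the `L`-invariants; a lax monoidal functor. -/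
noncomputable abbrev basicCocycles : DoubleMod L₀ ⥤ S :=
  invariants (doubleLie L₀) ⋙ cocycles

variable {L₀} in
/-- Equivariant cohomology: the cohomology twisted by the commutative Weil object `W = C_L`. -/
noncomputable abbrev equivariantCohomology (W : CommMon (DoubleMod L₀)) : DoubleMod L₀ ⥤ S :=
  twistedCohomology L₀ W.X

/-- The projection from cocycles to cohomology. -/
noncomputable def cohomologyπ (X : DoubleMod L₀) :
    (basicCocycles L₀).obj X ⟶ (cohomology L₀).obj X :=
  cokernel.π (boundary ((invariants (doubleLie L₀)).obj X))

/-- `m` is the algebra structure on `H(A)` induced by the algebra `A`: the projection from the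
algebra of cocycles is a morphism of algebras. -/
def IsInducedAlgebra (A : DoubleMod L₀) [MonObj A] (m : MonObj ((cohomology L₀).obj A)) : Prop :=
  letI : MonObj ((basicCocycles L₀).obj A) := (basicCocycles L₀).monObjObj A
  IsMonHom (cohomologyπ L₀ A)

end Cohomology

/-- The functor sending a commutative algebra `B` to the set of morphisms `V ⟶ B`. -/
abbrev morphismsFrom {T : Type*} [Category.{v} T] [MonoidalCategory T] [BraidedCategory T]
    (V : T) : CommMon T ⥤ Type v :=
  CommMon.forget T ⋙ coyoneda.obj (Opposite.op V)

/-- `A` is the symmetric algebra of `V`, the free commutative algebra on `V`. -/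
abbrev SymmetricAlgebraObject {T : Type*} [Category.{v} T] [MonoidalCategory T]
    [BraidedCategory T] (V : T) (A : CommMon T) :=
  (morphismsFrom V).CorepresentableBy A

end SuperTensor

/-! The Weil object is constructed by generators. Let W be the symmetric algebra on P L₀* ⊕ L₀*,
with odd generators θ and even generators dθ. The differential sends θ to dθ and dθ to 0, L₀ acts by
the coadjoint action on both, and the contractions send θ to its evaluation and dθ to the coadjoint
action applied to θ. All three operators are derivations. A graded commutator of derivations is a
derivation, and a derivation is determined on generators, so the Cartan relations that make W a
module over D ⊗ L₀ in supercomplexes need only be checked on θ and dθ. A connection on a commutative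
algebra B gives an algebra morphism W ⟶ B sending θ to the connection and dθ to its differential;
compatibility with the three operators is again tested on generators, and compatibility with d
forces the value on dθ. So W represents connections (`exists_weil_lift`, `weil_hom_ext`,
`weilObject`).

Symmetric algebras exist because the symmetrizers form an idempotent on the coproduct of all tensor
powers, which splits. Since ⊗ preserves this coproduct, the universal property holds in the presence
of a parameter object (`exists_symData`), and this is what makes products and parametrized
derivations definable on generators.

The core is the determination of the basic elements of W. Let q be the quadratic morphism dual to
the bracket. Contracting q(θ, θ) gives twice the contraction of dθ (`quad_weilI`), so the curvature
Ω = dθ − ½ q(θ, θ) is horizontal, that is, killed by all contractions. Conversely, contraction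
followed by multiplication by θ, summed over dual bases, is a derivation with θ ↦ θ and dθ ↦ q(θ,
θ). The substitution dθ ↦ dθ + ½ q(θ, θ) turns it into the derivation counting the θ's. On products
of n generators the latter has eigenvalues among 0, …, n, so over ℚ its kernel consists of
polynomials in the second generators alone (`SymData.eq_comp_projR`). Hence horizontal elements are
exactly polynomials in Ω (`eq_of_weilI_eq_zero`), with inverse given by setting θ = 0. This
identification respects L₀, so basic elements form S(L₀*)^{L₀} (`exists_basicIso`).

Finally d vanishes on basic elements (`weilD_of_basic`). If f is basic, then df is horizontal by the
Cartan relation between d and the contractions, so df is determined by its reduction at θ = 0; but f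
is a polynomial in Ω, and dΩ = −½ d q(θ, θ) vanishes at θ = 0. There are thus no boundaries, the
projection from cocycles to cohomology is an isomorphism, the induced algebra structures exist and
are unique by transport, and all choices of C_L and S(L₀*) are compared through representability. -/

namespace SuperTensor

/-! ### Moving one factor past another in a nested tensor product. -/

section Swap

variable {C : Type u} [Category.{v} C] [MonoidalCategory C] [SymmetricCategory C]

/-- The symmetry of the first two factors of a right-nested triple tensor product. -/
def sw (X Y Z : C) : X ⊗ (Y ⊗ Z) ⟶ Y ⊗ (X ⊗ Z) :=
  (α_ X Y Z).inv ≫ (β_ X Y).hom ▷ Z ≫ (α_ Y X Z).hom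

/-- Puts the second term of the Leibniz rule in terms of `sw`, so that the naturality and hexagon
rules below handle all signs. -/
lemma actR_eq {L M N : C} (b : L ⊗ N ⟶ N) : actR M N b = sw L M N ≫ M ◁ b := by
  simp [sw, actR]

@[simp]
lemma sw_sw (X Y Z : C) : sw X Y Z ≫ sw Y X Z = 𝟙 _ := by
  simp [sw, ← comp_whiskerRight_assoc]

@[simp]
lemma sw_sw_assoc {X Y Z W : C} (f : X ⊗ (Y ⊗ Z) ⟶ W) : sw X Y Z ≫ sw Y X Z ≫ f = f := by
  rw [reassoc_of% sw_sw]

instance (X Y Z : C) : IsIso (sw X Y Z) := ⟨sw Y X Z, sw_sw X Y Z, sw_sw Y X Z⟩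

lemma sw_nat₁ {X X' : C} (f : X ⟶ X') (Y Z : C) :
    f ▷ (Y ⊗ Z) ≫ sw X' Y Z = sw X Y Z ≫ Y ◁ f ▷ Z := by
  simp only [sw, Category.assoc]
  rw [associator_inv_naturality_left_assoc, ← comp_whiskerRight_assoc,
    braiding_naturality_left]
  simp

lemma sw_nat₂ (X : C) {Y Y' : C} (f : Y ⟶ Y') (Z : C) :
    X ◁ f ▷ Z ≫ sw X Y' Z = sw X Y Z ≫ f ▷ (X ⊗ Z) := by
  simp only [sw, Category.assoc]
  rw [associator_inv_naturality_middle_assoc, ← comp_whiskerRight_assoc,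
    braiding_naturality_right]
  simp

lemma sw_nat₃ (X Y : C) {Z Z' : C} (f : Z ⟶ Z') :
    X ◁ Y ◁ f ≫ sw X Y Z' = sw X Y Z ≫ Y ◁ X ◁ f := by
  simp only [sw, Category.assoc]
  rw [associator_inv_naturality_right_assoc, whisker_exchange_assoc]
  simp

lemma sw_nat₂₃ (X : C) {Y Y' Z Z' : C} (f : Y ⟶ Y') (g : Z ⟶ Z') :
    X ◁ (f ⊗ₘ g) ≫ sw X Y' Z' = sw X Y Z ≫ (f ⊗ₘ X ◁ g) := by
  rw [MonoidalCategory.tensorHom_def, MonoidalCategory.whiskerLeft_comp, Category.assoc, sw_nat₃,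
    reassoc_of% sw_nat₂, MonoidalCategory.tensorHom_def]

lemma sw_tensor_left (X Y Z W : C) : sw (X ⊗ Y) Z W =
    (α_ _ _ _).hom ≫ X ◁ sw Y Z W ≫ sw X Z (Y ⊗ W) ≫ Z ◁ (α_ _ _ _).inv := by
  simp only [sw, braiding_tensor_left_hom]
  monoidal

lemma sw_tensor_mid (X Y Z W : C) : sw X (Y ⊗ Z) W =
    X ◁ (α_ _ _ _).hom ≫ sw X Y (Z ⊗ W) ≫ Y ◁ sw X Z W ≫ (α_ _ _ _).inv := by
  simp only [sw, braiding_tensor_right_hom]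
  monoidal

lemma sw_tensor_right (X Y Z W : C) : sw X Y (Z ⊗ W) =
    X ◁ (α_ _ _ _).inv ≫ (α_ _ _ _).inv ≫ sw X Y Z ▷ W ≫ (α_ _ _ _).hom ≫
      Y ◁ (α_ _ _ _).hom := by
  simp only [sw]
  monoidal

lemma sw_whiskerRight (X Y Z W : C) : sw X Y Z ▷ W ≫ (α_ _ _ _).hom ≫ Y ◁ (α_ _ _ _).hom =
    (α_ _ _ _).hom ≫ X ◁ (α_ _ _ _).hom ≫ sw X Y (Z ⊗ W) := by
  simp only [sw]
  monoidal

/-- The braid relation: naturality of moving `Z` to the front, applied to the braiding of `X` and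
`Y`, with the move past `X ⊗ Y` split by the hexagon. -/
lemma sw_yang_baxter (X Y Z W : C) :
    sw X Y (Z ⊗ W) ≫ Y ◁ sw X Z W ≫ sw Y Z (X ⊗ W) =
      X ◁ sw Y Z W ≫ sw X Z (Y ⊗ W) ≫ Z ◁ sw X Y W := by
  have h := sw_nat₁ (β_ X Y).hom Z W
  rw [sw_tensor_left, sw_tensor_left] at h
  have h2 := (α_ X Y (Z ⊗ W)).inv ≫= h =≫ (Z ◁ (α_ Y X W).hom)
  simp only [Category.assoc, Iso.inv_hom_id_assoc] at h2
  simp only [← MonoidalCategory.whiskerLeft_comp, Iso.inv_hom_id, MonoidalCategory.whiskerLeft_id,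
    Category.comp_id] at h2
  exact (by simpa [sw] using h2)

@[simp]
lemma sw_unit_left (Y Z : C) : sw (𝟙_ C) Y Z = (λ_ _).hom ≫ Y ◁ (λ_ _).inv := by
  simp only [sw, braiding_tensorUnit_left]
  monoidal

@[simp]
lemma sw_unit_mid (X Z : C) : sw X (𝟙_ C) Z = X ◁ (λ_ _).hom ≫ (λ_ _).inv := by
  simp only [sw, braiding_tensorUnit_right]
  monoidal

end Swap

end SuperTensor

namespace SuperTensor

/-! ### Tensor powers and adjacent transpositions. -/

section Powers

variable {C : Type u} [Category.{v} C] [MonoidalCategory C] [SymmetricCategory C]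

/-- Right-nested tensor powers. -/
@[reducible]
def pow (V : C) : ℕ → C
  | 0 => 𝟙_ C
  | n + 1 => V ⊗ pow V n

/-- The transposition of the first two factors of a tensor power. -/
def trFirst (V : C) : (n : ℕ) → (V ⊗ pow V n ⟶ V ⊗ pow V n)
  | 0 => 𝟙 _
  | n + 1 => sw V V (pow V n)

/-- The transposition of the factors `i` and `i + 1` of a tensor power. -/
def tr (V : C) : (n i : ℕ) → (pow V n ⟶ pow V n)
  | 0, _ => 𝟙 _
  | n + 1, 0 => trFirst V n
  | n + 1, i + 1 => V ◁ tr V n i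

lemma tr_zero (V : C) (n : ℕ) : tr V (n + 2) 0 = sw V V (pow V n) := rfl

lemma tr_succ (V : C) (n i : ℕ) : tr V (n + 1) (i + 1) = V ◁ tr V n i := rfl

lemma tr_zero_left (V : C) (i : ℕ) : tr V 0 i = 𝟙 _ := rfl

lemma tr_one_zero (V : C) : tr V 1 0 = 𝟙 _ := rfl

/-- A morphism out of `X ⊗ V^n` which is invariant under the symmetries of `V^n`. -/
def IsSymm {V X Y : C} {n : ℕ} (f : X ⊗ pow V n ⟶ Y) : Prop :=
  ∀ i, X ◁ tr V n i ≫ f = f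

lemma IsSymm.assoc {V X X' Y : C} {n : ℕ} {f : X ⊗ (X' ⊗ pow V n) ⟶ Y}
    (hf : ∀ i, X ◁ X' ◁ tr V n i ≫ f = f) : IsSymm ((α_ X X' (pow V n)).hom ≫ f) := fun i => by
  rw [associator_naturality_right_assoc, hf i]

/-- The first factor of `V^(n+1)` is absorbed into the parameter object. This is why symmetry is
stated with a parameter: it lets inductions on `n` run with `X` varying. -/
lemma isSymm_succ {V X Y : C} {n : ℕ} {f : X ⊗ pow V (n + 1) ⟶ Y} (hf : IsSymm f) :
    IsSymm ((α_ X V (pow V n)).hom ≫ f) :=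
  IsSymm.assoc fun i => hf (i + 1)

end Powers

/-! ### The symmetrizer and its idempotence. -/

section Symmetrizer

variable {C : Type u} [Category.{v} C] [Preadditive C] [Linear ℚ C] [MonoidalCategory C]
  [SymmetricCategory C] [MonoidalPreadditive C]

lemma whiskerLeft_ratsmul (X : C) {Y Z : C} (q : ℚ) (f : Y ⟶ Z) : X ◁ (q • f) = q • (X ◁ f) :=
  map_rat_smul (tensorLeft X).mapAddHom q f

/-- The sum over all ways to insert the first factor into a tensor power. -/
def ins (V : C) : (n : ℕ) → (V ⊗ pow V n ⟶ V ⊗ pow V n)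
  | 0 => 𝟙 _
  | n + 1 => 𝟙 _ + sw V V (pow V n) ≫ V ◁ ins V n

/-- The symmetrizer, an idempotent endomorphism of a tensor power. -/
noncomputable def symmetrizer (V : C) : (n : ℕ) → (pow V n ⟶ pow V n)
  | 0 => 𝟙 _
  | n + 1 => ((n + 1 : ℚ)⁻¹) • (V ◁ symmetrizer V n ≫ ins V n)

/-- Inserting two vectors in all possible ways gives a sum in which the order of the two vectors
does not matter. Only the braid relation and the involutivity of the transposition are used. -/
lemma ins_ins (V : C) (n : ℕ) : sw V V (pow V n) ≫ V ◁ ins V n ≫ ins V (n + 1) =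
    V ◁ ins V n ≫ ins V (n + 1) := by
  induction n with
  | zero =>
    simp only [ins, MonoidalCategory.whiskerLeft_id, Category.comp_id, Category.id_comp,
      Preadditive.comp_add, sw_sw]
    exact add_comm _ _
  | succ n ih =>
    let s₀ : V ⊗ (V ⊗ (V ⊗ pow V n)) ⟶ V ⊗ (V ⊗ (V ⊗ pow V n)) := sw V V (V ⊗ pow V n)
    let s₁ : V ⊗ (V ⊗ (V ⊗ pow V n)) ⟶ V ⊗ (V ⊗ (V ⊗ pow V n)) := V ◁ sw V V (pow V n)
    let c : V ⊗ (V ⊗ (V ⊗ pow V n)) ⟶ V ⊗ (V ⊗ (V ⊗ pow V n)) := V ◁ V ◁ ins V n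
    have h0 : s₀ ≫ s₀ = 𝟙 _ := sw_sw V V _
    have yb : s₀ ≫ s₁ ≫ s₀ = s₁ ≫ s₀ ≫ s₁ := sw_yang_baxter V V V (pow V n)
    have hc : c ≫ s₀ = s₀ ≫ c := sw_nat₃ V V (ins V n)
    have e : V ◁ ins V (n + 1) = 𝟙 _ + s₁ ≫ c := by
      simp only [ins, MonoidalPreadditive.whiskerLeft_add, MonoidalCategory.whiskerLeft_comp,
        MonoidalCategory.whiskerLeft_id, s₁, c]
    have e' : ins V (n + 2) = 𝟙 _ + s₀ ≫ (𝟙 _ + s₁ ≫ c) := by rw [← e]; rfl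
    have ih' : s₁ ≫ c ≫ (𝟙 _ + s₁ ≫ c) = c ≫ (𝟙 _ + s₁ ≫ c) := by
      have := congrArg (fun f => V ◁ f) ih
      simp only [MonoidalCategory.whiskerLeft_comp] at this
      rw [← e]
      exact this
    rw [e, e']
    change s₀ ≫ _ = _
    -- After expansion and the braid relation four terms agree on both sides. The two remaining
    -- terms on each side are matched by the induction hypothesis preceded by s₁ s₀.
    have k1 := s₁ ≫= s₀ ≫= ih'
    simp only [Preadditive.add_comp, Preadditive.comp_add, Category.comp_id, Category.id_comp,
      Category.assoc] at k1 ⊢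
    have a1 : s₀ ≫ s₁ ≫ c ≫ s₀ = s₁ ≫ s₀ ≫ s₁ ≫ c := by
      rw [hc, reassoc_of% yb]
    have a2 : s₁ ≫ c ≫ s₀ = s₁ ≫ s₀ ≫ c := by rw [hc]
    have a3 : s₀ ≫ s₁ ≫ c ≫ s₀ ≫ s₁ ≫ c = s₁ ≫ s₀ ≫ s₁ ≫ c ≫ s₁ ≫ c := by
      rw [reassoc_of% hc, reassoc_of% yb]
    have a4 : s₁ ≫ c ≫ s₀ ≫ s₁ ≫ c = s₁ ≫ s₀ ≫ c ≫ s₁ ≫ c := by rw [reassoc_of% hc]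
    rw [a1, a2, a3, a4, reassoc_of% h0, h0]
    calc _ = s₀ + 𝟙 _ + s₀ ≫ s₁ ≫ c + s₁ ≫ c + (s₁ ≫ s₀ ≫ s₁ ≫ c + s₁ ≫ s₀ ≫ s₁ ≫ c ≫ s₁ ≫ c) := by
            abel
      _ = _ := by rw [k1]; abel

/-- Later transpositions are absorbed by the inner symmetrizer. The first one slides past the
symmetrizer of the remaining factors and is absorbed by the last two insertions (`ins_ins`). -/
lemma tr_symmetrizer (V : C) (n i : ℕ) : tr V n i ≫ symmetrizer V n = symmetrizer V n := by
  induction n generalizing i with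
  | zero => rw [tr_zero_left, Category.id_comp]
  | succ n ih =>
    cases i with
    | succ i =>
      rw [symmetrizer, Linear.comp_smul, tr_succ]
      erw [← MonoidalCategory.whiskerLeft_comp_assoc]
      rw [ih]
    | zero =>
      cases n with
      | zero => rw [tr_one_zero, Category.id_comp]
      | succ n =>
        have h : sw V V (pow V n) ≫ V ◁ V ◁ symmetrizer V n ≫ V ◁ ins V n ≫ ins V (n + 1) =
            V ◁ V ◁ symmetrizer V n ≫ V ◁ ins V n ≫ ins V (n + 1) := by
          rw [← reassoc_of% (sw_nat₃ V V (symmetrizer V n)), ins_ins]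
        rw [tr_zero, symmetrizer, symmetrizer, whiskerLeft_ratsmul, Linear.smul_comp,
          Linear.comp_smul, Linear.comp_smul, MonoidalCategory.whiskerLeft_comp, Category.assoc]
        erw [h]

/-- Each of the `n + 1` insertions is a product of transpositions, hence invisible to a symmetric
morphism. -/
lemma ins_symm {V X Y : C} (n : ℕ) {f : X ⊗ pow V (n + 1) ⟶ Y} (hf : IsSymm f) :
    X ◁ ins V n ≫ f = (n + 1 : ℚ) • f := by
  induction n generalizing X with
  | zero => simp [ins]
  | succ n ih =>
    have h1 := ih (isSymm_succ hf)
    have h2 : X ◁ V ◁ ins V n ≫ f = (n + 1 : ℚ) • f := by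
      have := (α_ X V _).inv ≫= h1
      simpa using this
    have h3 : X ◁ sw V V (pow V n) ≫ f = f := hf 0
    rw [ins, MonoidalPreadditive.whiskerLeft_add, Preadditive.add_comp,
      MonoidalCategory.whiskerLeft_id, MonoidalCategory.whiskerLeft_comp, Category.assoc]
    erw [h2, Linear.comp_smul, h3, Category.id_comp]
    push_cast
    rw [add_smul ((n : ℚ) + 1) 1, one_smul]
    exact add_comm _ _

/-- The normalization 1/(n+1) cancels the count of insertions. With `tr_symmetrizer` this identifies
the image of the symmetrizer with the coinvariants, also after tensoring with `X`. -/
lemma symmetrizer_symm {V X Y : C} {n : ℕ} {f : X ⊗ pow V n ⟶ Y} (hf : IsSymm f) :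
    X ◁ symmetrizer V n ≫ f = f := by
  induction n generalizing X with
  | zero => simp [symmetrizer]
  | succ n ih =>
    have h1 := ih (isSymm_succ hf)
    have h2 : X ◁ V ◁ symmetrizer V n ≫ f = f := by
      have := (α_ X V _).inv ≫= h1
      simpa using this
    have h3 := ins_symm n hf
    rw [symmetrizer, whiskerLeft_ratsmul, Linear.smul_comp, MonoidalCategory.whiskerLeft_comp,
      Category.assoc]
    erw [h3, Linear.comp_smul, h2]
    rw [smul_smul, inv_mul_cancel₀ (by positivity), one_smul]

end Symmetrizer

end SuperTensor

namespace SuperTensor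

/-! ### The symmetric algebra: product, associativity, commutativity. -/

section SymData

variable {C : Type u} [Category.{v} C] [MonoidalCategory C] [SymmetricCategory C]

/-- An object `A` with a symmetric family `m n : V^n ⟶ A` which is universal after tensoring
with any object: the underlying object of the symmetric algebra. -/
structure SymData (V : C) where
  /-- The underlying object of the symmetric algebra. -/
  A : C
  /-- The products of generators. -/
  m (n : ℕ) : pow V n ⟶ A
  tr_m (n i : ℕ) : tr V n i ≫ m n = m n
  exists_desc {X Y : C} (f : ∀ n, X ⊗ pow V n ⟶ Y) (hf : ∀ n, IsSymm (f n)) :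
    ∃ g : X ⊗ A ⟶ Y, ∀ n, X ◁ m n ≫ g = f n
  hom_ext {X Y : C} {f g : X ⊗ A ⟶ Y} (h : ∀ n, X ◁ m n ≫ f = X ◁ m n ≫ g) : f = g

namespace SymData

variable {V : C} (D : SymData V)

lemma hom_ext₂ {X X' Y : C} {f g : X ⊗ (X' ⊗ D.A) ⟶ Y}
    (h : ∀ n, X ◁ X' ◁ D.m n ≫ f = X ◁ X' ◁ D.m n ≫ g) : f = g := by
  rw [← cancel_epi (α_ X X' D.A).hom]
  refine D.hom_ext fun n => ?_
  rw [associator_naturality_right_assoc, associator_naturality_right_assoc, h]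

lemma hom_ext_right {X Y : C} {f g : D.A ⊗ X ⟶ Y} (h : ∀ n, D.m n ▷ X ≫ f = D.m n ▷ X ≫ g) :
    f = g := by
  rw [← cancel_epi (β_ X D.A).hom]
  refine D.hom_ext fun n => ?_
  rw [braiding_naturality_right_assoc, braiding_naturality_right_assoc, h]

lemma hom_ext_mid {T X Y : C} {f g : T ⊗ (D.A ⊗ X) ⟶ Y}
    (h : ∀ n, T ◁ D.m n ▷ X ≫ f = T ◁ D.m n ▷ X ≫ g) : f = g := by
  rw [← cancel_epi (sw D.A T X)]
  refine D.hom_ext_right fun n => ?_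
  rw [reassoc_of% sw_nat₁, reassoc_of% sw_nat₁, h]

lemma hom_ext_right₂ {X X' Y : C} {f g : (X ⊗ D.A) ⊗ X' ⟶ Y}
    (h : ∀ n, (X ◁ D.m n) ▷ X' ≫ f = (X ◁ D.m n) ▷ X' ≫ g) : f = g := by
  rw [← cancel_epi (α_ X D.A X').inv]
  refine D.hom_ext_mid fun n => ?_
  rw [associator_inv_naturality_middle_assoc, associator_inv_naturality_middle_assoc, h]

lemma hom_ext_unit {Y : C} {f g : D.A ⟶ Y} (h : ∀ n, D.m n ≫ f = D.m n ≫ g) : f = g := by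
  rw [← cancel_epi (λ_ D.A).hom]
  refine D.hom_ext fun n => ?_
  rw [leftUnitor_naturality_assoc, leftUnitor_naturality_assoc, h]

/-- The morphism out of `X ⊗ A` given by a symmetric family. -/
noncomputable def desc {X Y : C} (f : ∀ n, X ⊗ pow V n ⟶ Y) (hf : ∀ n, IsSymm (f n)) :
    X ⊗ D.A ⟶ Y := (D.exists_desc f hf).choose

@[simp]
lemma m_desc {X Y : C} (f : ∀ n, X ⊗ pow V n ⟶ Y) (hf : ∀ n, IsSymm (f n)) (n : ℕ) :
    X ◁ D.m n ≫ D.desc f hf = f n := (D.exists_desc f hf).choose_spec n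

/-- The morphism out of `A ⊗ X` given by a symmetric family. -/
noncomputable def descRight {X Y : C} (f : ∀ n, pow V n ⊗ X ⟶ Y)
    (hf : ∀ n i, tr V n i ▷ X ≫ f n = f n) : D.A ⊗ X ⟶ Y :=
  (β_ D.A X).hom ≫ D.desc (fun n => (β_ X (pow V n)).hom ≫ f n)
    fun n => (fun i => by rw [braiding_naturality_right_assoc, hf] : IsSymm _)

@[simp]
lemma m_descRight {X Y : C} (f : ∀ n, pow V n ⊗ X ⟶ Y)
    (hf : ∀ n i, tr V n i ▷ X ≫ f n = f n) (n : ℕ) : D.m n ▷ X ≫ D.descRight f hf = f n := by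
  rw [descRight, braiding_naturality_left_assoc]
  exact ((β_ (pow V n) X).hom ≫= D.m_desc _ _ n).trans (SymmetricCategory.symmetry_assoc _ _ _)

lemma exists_desc_unit {Y : C} (f : ∀ n, pow V n ⟶ Y) (hf : ∀ n i, tr V n i ≫ f n = f n) :
    ∃ g : D.A ⟶ Y, ∀ n, D.m n ≫ g = f n := by
  refine ⟨(ρ_ D.A).inv ≫ D.descRight (fun n => (ρ_ (pow V n)).hom ≫ f n) (fun n i => ?_),
    fun n => ?_⟩
  · rw [rightUnitor_naturality_assoc, hf]
  · rw [rightUnitor_inv_naturality_assoc, m_descRight, Iso.inv_hom_id_assoc]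

/-- Multiplication by a generator. -/
noncomputable def cons : V ⊗ D.A ⟶ D.A :=
  D.desc (X := V) (fun n => D.m (n + 1)) fun n i => D.tr_m (n + 1) (i + 1)

@[simp]
lemma m_cons (n : ℕ) : V ◁ D.m n ≫ D.cons = D.m (n + 1) := D.m_desc _ _ n

/-- Generators commute. Commutativity of the whole algebra and the consistency of derivations rest
on this one relation. -/
lemma sw_cons_cons : sw V V D.A ≫ V ◁ D.cons ≫ D.cons = V ◁ D.cons ≫ D.cons := by
  refine D.hom_ext₂ fun n => ?_
  rw [reassoc_of% sw_nat₃]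
  have h : V ◁ V ◁ D.m n ≫ V ◁ D.cons ≫ D.cons = D.m (n + 2) := by
    rw [← MonoidalCategory.whiskerLeft_comp_assoc, m_cons, m_cons]
  rw [h]
  exact D.tr_m (n + 2) 0

/-- The action of a tensor power of `V` by iterated multiplication with generators. -/
noncomputable def act : (n : ℕ) → (pow V n ⊗ D.A ⟶ D.A)
  | 0 => (λ_ _).hom
  | n + 1 => (α_ V (pow V n) D.A).hom ≫ V ◁ act n ≫ D.cons

/-- The symmetry needed for the iterated multiplications to descend to a product `A ⊗ A ⟶ A`. -/
lemma tr_act (n i : ℕ) : tr V n i ▷ D.A ≫ D.act n = D.act n := by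
  induction n generalizing i with
  | zero => rw [tr_zero_left, id_whiskerRight, Category.id_comp]
  | succ n ih =>
    cases i with
    | succ i =>
      rw [tr_succ, act, associator_naturality_middle_assoc,
        ← MonoidalCategory.whiskerLeft_comp_assoc, ih]
    | zero =>
      cases n with
      | zero => exact (congrArg (· ≫ D.act 1) (id_whiskerRight _ _)).trans (Category.id_comp _)
      | succ n =>
        rw [tr_zero, act, act]
        simp only [MonoidalCategory.whiskerLeft_comp, Category.assoc]
        rw [reassoc_of% sw_whiskerRight, ← reassoc_of% sw_nat₃, sw_cons_cons]

/-- The multiplication of the symmetric algebra. -/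
noncomputable def mul : D.A ⊗ D.A ⟶ D.A := D.descRight D.act D.tr_act

lemma m_mul (n : ℕ) : D.m n ▷ D.A ≫ D.mul = D.act n := D.m_descRight _ _ n

lemma m_zero_mul : D.m 0 ▷ D.A ≫ D.mul = (λ_ _).hom := D.m_mul 0

/-- (va)b = v(ab), by the recursion defining the action. It is the induction step in the proofs of
the algebra laws below. -/
lemma cons_mul : D.cons ▷ D.A ≫ D.mul = (α_ _ _ _).hom ≫ V ◁ D.mul ≫ D.cons := by
  refine D.hom_ext_right₂ fun n => ?_
  rw [← comp_whiskerRight_assoc, m_cons, m_mul, act, associator_naturality_middle_assoc,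
    ← MonoidalCategory.whiskerLeft_comp_assoc, m_mul]

/-- Induction on the first factor: morphisms out of `A ⊗ X` agree if they agree on the unit and
multiplication by generators preserves agreement. -/
lemma hom_ext_induction {X Y : C} {f g : D.A ⊗ X ⟶ Y} (h0 : D.m 0 ▷ X ≫ f = D.m 0 ▷ X ≫ g)
    (hc : ∀ {W : C} (s : W ⟶ D.A), s ▷ X ≫ f = s ▷ X ≫ g →
      (V ◁ s ≫ D.cons) ▷ X ≫ f = (V ◁ s ≫ D.cons) ▷ X ≫ g) : f = g := by
  refine D.hom_ext_right fun n => ?_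
  induction n with
  | zero => exact h0
  | succ n ih => simpa using hc (D.m n) ih

/-- Induction on the first factor, in presence of a further factor on the left. -/
lemma hom_ext_induction_mid {T X Y : C} {f g : T ⊗ (D.A ⊗ X) ⟶ Y}
    (h0 : T ◁ D.m 0 ▷ X ≫ f = T ◁ D.m 0 ▷ X ≫ g)
    (hc : ∀ {W : C} (s : W ⟶ D.A), T ◁ s ▷ X ≫ f = T ◁ s ▷ X ≫ g →
      T ◁ (V ◁ s ≫ D.cons) ▷ X ≫ f = T ◁ (V ◁ s ≫ D.cons) ▷ X ≫ g) : f = g := by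
  refine D.hom_ext_mid fun n => ?_
  induction n with
  | zero => exact h0
  | succ n ih => simpa using hc (D.m n) ih

lemma cons_mul' {W : C} (s : W ⟶ D.A) : (V ◁ s ≫ D.cons) ▷ D.A ≫ D.mul =
    (α_ _ _ _).hom ≫ V ◁ (s ▷ D.A ≫ D.mul) ≫ D.cons := by
  rw [comp_whiskerRight_assoc, cons_mul, associator_naturality_middle_assoc]
  simp

lemma mul_m_zero : D.A ◁ D.m 0 ≫ D.mul = (ρ_ _).hom := by
  refine D.hom_ext_induction ?_ fun s h => ?_
  · rw [← whisker_exchange_assoc, m_zero_mul, leftUnitor_naturality]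
    have := rightUnitor_naturality (D.m 0)
    rw [this, unitors_equal]
  · rw [← whisker_exchange_assoc] at h ⊢
    rw [cons_mul', associator_naturality_right_assoc, ← MonoidalCategory.whiskerLeft_comp_assoc,
      h]
    simp

lemma mul_mul : D.mul ▷ D.A ≫ D.mul = (α_ _ _ _).hom ≫ D.A ◁ D.mul ≫ D.mul := by
  rw [← cancel_epi (α_ _ _ _).inv, Iso.inv_hom_id_assoc]
  refine D.hom_ext_induction ?_ fun {W} s h => ?_
  · rw [associator_inv_naturality_left_assoc, ← comp_whiskerRight_assoc, m_zero_mul,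
      ← whisker_exchange_assoc, m_zero_mul]
    simp
  · rw [associator_inv_naturality_left_assoc, ← comp_whiskerRight_assoc] at h ⊢
    rw [← whisker_exchange_assoc] at h ⊢
    rw [cons_mul', associator_naturality_right_assoc,
      ← MonoidalCategory.whiskerLeft_comp_assoc, ← h]
    simp only [comp_whiskerRight, Category.assoc]
    rw [cons_mul]
    simp

/-- a(vb) = ± v(ab): by induction on `a`, the generator `v` is moved past the generators of `a` one
at a time. Commutativity of the product follows by another such induction. -/
lemma mul_cons : D.A ◁ D.cons ≫ D.mul = sw _ _ _ ≫ V ◁ D.mul ≫ D.cons := by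
  refine D.hom_ext_induction ?_ fun s h => ?_
  · rw [← whisker_exchange_assoc, m_zero_mul, reassoc_of% sw_nat₁,
      ← MonoidalCategory.whiskerLeft_comp_assoc, m_zero_mul, leftUnitor_naturality, sw_unit_left]
    simp
  · rw [← whisker_exchange_assoc] at h ⊢
    rw [reassoc_of% sw_nat₁, ← MonoidalCategory.whiskerLeft_comp_assoc] at h ⊢
    rw [cons_mul', associator_naturality_right_assoc,
      ← MonoidalCategory.whiskerLeft_comp_assoc, h]
    simp only [MonoidalCategory.whiskerLeft_comp, Category.assoc]
    rw [sw_tensor_left]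
    simp only [Category.assoc, ← MonoidalCategory.whiskerLeft_comp_assoc V (α_ V _ D.A).inv,
      Iso.inv_hom_id, MonoidalCategory.whiskerLeft_id, Category.id_comp]
    rw [← reassoc_of% (sw_nat₃ V V (s ▷ D.A)), ← reassoc_of% (sw_nat₃ V V D.mul), sw_cons_cons]

lemma braiding_mul : (β_ D.A D.A).hom ≫ D.mul = D.mul := by
  refine D.hom_ext_induction ?_ fun s h => ?_
  · rw [braiding_naturality_left_assoc, mul_m_zero, m_zero_mul]
    simp
  · rw [braiding_naturality_left_assoc] at h ⊢
    rw [cons_mul', ← h, MonoidalCategory.whiskerLeft_comp, Category.assoc, mul_cons,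
      reassoc_of% sw_nat₃]
    simp only [sw, braiding_tensor_left_hom, Category.assoc, MonoidalCategory.whiskerLeft_comp,
      Iso.hom_inv_id_assoc]
    rw [← comp_whiskerRight_assoc, SymmetricCategory.symmetry]
    simp

noncomputable instance : MonObj D.A where
  one := D.m 0
  mul := D.mul
  one_mul := D.m_zero_mul
  mul_one := D.mul_m_zero
  mul_assoc := D.mul_mul

instance : IsCommMonObj D.A where
  mul_comm := D.braiding_mul

open scoped MonObj

lemma one_eq : η[D.A] = D.m 0 := rfl

lemma mul_eq : μ[D.A] = D.mul := rfl

/-- The inclusion of the generators. -/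
noncomputable def gen : V ⟶ D.A := (ρ_ V).inv ≫ D.m 1

lemma gen_eq : D.gen = (ρ_ V).inv ≫ V ◁ D.m 0 ≫ D.cons := by rw [m_cons]; rfl

lemma cons_eq : D.cons = D.gen ▷ D.A ≫ μ[D.A] := by
  rw [gen_eq, mul_eq, comp_whiskerRight_assoc, cons_mul', m_zero_mul]
  simp

end SymData

end SymData

end SuperTensor

namespace SuperTensor

/-! ### Existence of symmetric algebras. -/

section Existence

variable {C : Type u} [Category.{v} C] [Preadditive C] [Linear ℚ C] [MonoidalCategory C]
  [SymmetricCategory C] [MonoidalPreadditive C]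

/-- The symmetric algebra is the image of the symmetrizers on ∐ Vⁿ. Universality with a parameter
`X` holds because `X ⊗ -` preserves the coproduct and every functor preserves split idempotents. -/
lemma exists_symData [HasCountableCoproducts C] [IsIdempotentComplete C]
    [∀ X : C, PreservesColimitsOfShape (Discrete ℕ) (tensorLeft X)] (V : C) :
    Nonempty (SymData V) := by
  have : HasCoproduct (pow V) := inferInstance
  let j (n : ℕ) : pow V n ⟶ ∐ pow V := Sigma.ι (pow V) n
  let e : ∐ pow V ⟶ ∐ pow V := Limits.Sigma.map fun n => symmetrizer V n
  have je (n : ℕ) : j n ≫ e = symmetrizer V n ≫ j n := by simp [j, e]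
  have ext {X Y : C} {f g : X ⊗ ∐ pow V ⟶ Y} (h : ∀ n, X ◁ j n ≫ f = X ◁ j n ≫ g) : f = g := by
    rw [← cancel_epi (sigmaComparison (tensorLeft X) (pow V))]
    refine Sigma.hom_ext _ _ fun n => ?_
    rw [← Category.assoc, ← Category.assoc, ι_comp_sigmaComparison]
    exact h n
  have he : e ≫ e = e := by
    refine Sigma.hom_ext _ _ fun n => ?_
    change j n ≫ e ≫ e = j n ≫ e
    have h : symmetrizer V n ≫ symmetrizer V n = symmetrizer V n := by
      -- The symmetrizer is itself a symmetric morphism, so symmetrizing it again changes nothing.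
      -- The unit object serves as trivial parameter.
      have h := symmetrizer_symm (X := 𝟙_ C) (f := (λ_ _).hom ≫ symmetrizer V n) (n := n)
        fun i => by rw [leftUnitor_naturality_assoc, tr_symmetrizer]
      rw [leftUnitor_naturality_assoc, cancel_epi] at h
      exact h
    rw [← Category.assoc, je, Category.assoc, je, reassoc_of% h]
  obtain ⟨A, i, q, hiq, hqi⟩ := IsIdempotentComplete.idempotents_split _ e he
  refine ⟨⟨A, fun n => j n ≫ q, fun n k => ?_, fun {X Y} f hf => ?_, fun {X Y f g} h => ?_⟩⟩
  · have h : tr V n k ≫ j n ≫ e = j n ≫ e := by rw [je, ← Category.assoc, tr_symmetrizer]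
    rw [← hqi] at h
    have := h =≫ q
    simpa [hiq] using this
  · obtain ⟨F, hF⟩ : ∃ F : X ⊗ ∐ pow V ⟶ Y, ∀ n, X ◁ j n ≫ F = f n := by
      refine ⟨inv (sigmaComparison (tensorLeft X) (pow V)) ≫ Sigma.desc f, fun n => ?_⟩
      have : X ◁ j n = Sigma.ι (fun n => X ⊗ pow V n) n ≫
        sigmaComparison (tensorLeft X) (pow V) :=
        (ι_comp_sigmaComparison (tensorLeft X) (pow V) n).symm
      rw [this]
      simp
    refine ⟨X ◁ i ≫ F, fun n => ?_⟩
    rw [← MonoidalCategory.whiskerLeft_comp_assoc, Category.assoc, hqi, je,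
      MonoidalCategory.whiskerLeft_comp_assoc, hF, symmetrizer_symm (hf n)]
  · have h1 : X ◁ q ≫ f = X ◁ q ≫ g := ext fun n => by
      simpa using h n
    have h2 := X ◁ i ≫= h1
    rw [← MonoidalCategory.whiskerLeft_comp_assoc, ← MonoidalCategory.whiskerLeft_comp_assoc,
      hiq] at h2
    simpa using h2

end Existence

/-! ### The universal property among commutative algebras. -/

section Universal

variable {C : Type u} [Category.{v} C] [MonoidalCategory C] [SymmetricCategory C]

open scoped MonObj

variable {V : C} (D : SymData V) {B : C} [MonObj B]

namespace SymData

/-- Products of images of generators. -/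
def powMap (g : V ⟶ B) : (n : ℕ) → (pow V n ⟶ B)
  | 0 => η[B]
  | n + 1 => (g ⊗ₘ powMap g n) ≫ μ[B]

lemma cons_comp (f : D.A ⟶ B) [IsMonHom f] : D.cons ≫ f = ((D.gen ≫ f) ⊗ₘ f) ≫ μ[B] := by
  rw [cons_eq, Category.assoc, IsMonHom.mul_hom, ← Category.assoc, whiskerRight_tensorHom]

variable [IsCommMonObj B]

lemma mul_left_comm (B : C) [MonObj B] [IsCommMonObj B] :
    sw B B B ≫ B ◁ μ[B] ≫ μ[B] = B ◁ μ[B] ≫ μ[B] := by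
  have h : B ◁ μ[B] ≫ μ[B] = (α_ _ _ _).inv ≫ μ[B] ▷ B ≫ μ[B] := by simp
  rw [h, sw, Category.assoc, Category.assoc, Iso.hom_inv_id_assoc, ← comp_whiskerRight_assoc,
    IsCommMonObj.mul_comm]

lemma tr_powMap (g : V ⟶ B) (n i : ℕ) : tr V n i ≫ powMap g n = powMap g n := by
  induction n generalizing i with
  | zero => rw [tr_zero_left, Category.id_comp]
  | succ n ih =>
    cases i with
    | succ i => rw [tr_succ, powMap, ← Category.assoc, whiskerLeft_tensorHom, ih]
    | zero =>
      cases n with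
      | zero => exact Category.id_comp _
      | succ n =>
        rw [tr_zero, powMap, powMap, comp_tensorHom_right, Category.assoc]
        have h : sw V V (pow V n) ≫ (g ⊗ₘ (g ⊗ₘ powMap g n)) =
            (g ⊗ₘ (g ⊗ₘ powMap g n)) ≫ sw B B B := by
          simp only [sw, Category.assoc]
          rw [associator_inv_naturality_assoc, ← associator_naturality,
            ← tensorHom_id (β_ B B).hom, tensorHom_comp_tensorHom_assoc, braiding_naturality,
            ← tensorHom_id, tensorHom_comp_tensorHom_assoc]
          simp
        rw [reassoc_of% h, mul_left_comm]

/-- On `Vⁿ` the lift is the product of the images of the generators, symmetric because `B` is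
commutative. It is multiplicative by induction on the first factor. -/
lemma exists_lift (g : V ⟶ B) : ∃ f : D.A ⟶ B, D.gen ≫ f = g ∧ IsMonHom f := by
  obtain ⟨f, hf⟩ := D.exists_desc_unit (powMap g) (tr_powMap g)
  have hc {W : C} (s : W ⟶ D.A) : (V ◁ s ≫ D.cons) ≫ f = (g ⊗ₘ (s ≫ f)) ≫ μ[B] := by
    have h : D.cons ≫ f = (g ⊗ₘ f) ≫ μ[B] := by
      refine D.hom_ext fun n => ?_
      rw [← Category.assoc, m_cons, hf, ← Category.assoc, whiskerLeft_tensorHom, hf]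
      rfl
    rw [Category.assoc, h, ← Category.assoc, whiskerLeft_tensorHom]
  have h1 : D.m 0 ≫ f = η[B] := hf 0
  refine ⟨f, ?_, ⟨h1, ?_⟩⟩
  · rw [gen_eq, Category.assoc, hc, h1, MonoidalCategory.tensorHom_def]
    simp
  · rw [mul_eq]
    refine D.hom_ext_induction ?_ fun s h => ?_
    · rw [← Category.assoc, m_zero_mul, ← Category.assoc, whiskerRight_tensorHom, h1,
        MonoidalCategory.tensorHom_def']
      simp
    · rw [← Category.assoc] at h ⊢
      rw [cons_mul', Category.assoc, hc, h, ← Category.assoc (_ ▷ _), ← Category.assoc (_ ▷ _),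
        whiskerRight_tensorHom, whiskerRight_tensorHom, hc]
      rw [comp_tensorHom_right, comp_tensorHom_left _ μ[B], Category.assoc, Category.assoc,
        MonObj.mul_assoc, ← reassoc_of% associator_naturality]

/-- The algebra morphism extending a morphism on generators. -/
noncomputable def lift (g : V ⟶ B) : D.A ⟶ B := (D.exists_lift g).choose

@[simp]
lemma gen_lift (g : V ⟶ B) : D.gen ≫ D.lift g = g := (D.exists_lift g).choose_spec.1

instance (g : V ⟶ B) : IsMonHom (D.lift g) := (D.exists_lift g).choose_spec.2

lemma algHom_ext {B : C} [MonObj B] {f f' : D.A ⟶ B} [IsMonHom f] [IsMonHom f']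
    (h : D.gen ≫ f = D.gen ≫ f') : f = f' := by
  refine D.hom_ext_unit fun n => ?_
  induction n with
  | zero =>
    have h1 : η[D.A] ≫ f = η[D.A] ≫ f' := by rw [IsMonHom.one_hom, IsMonHom.one_hom]
    exact h1
  | succ n ih =>
    rw [← m_cons, Category.assoc, Category.assoc, cons_comp, cons_comp, ← Category.assoc,
      ← Category.assoc, whiskerLeft_tensorHom, whiskerLeft_tensorHom, ih, h]

end SymData

end Universal

end SuperTensor

namespace SuperTensor

/-! ### Composition of operators with parameters. -/

section Operators

variable {C : Type u} [Category.{v} C] [MonoidalCategory C] [SymmetricCategory C]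

/-- The composite of two operators with parameters. -/
def opComp {L L' M : C} (a : L ⊗ M ⟶ M) (a' : L' ⊗ M ⟶ M) : (L ⊗ L') ⊗ M ⟶ M :=
  (α_ L L' M).hom ≫ L ◁ a' ≫ a

lemma opComp_actL {L L' M N : C} (a : L ⊗ M ⟶ M) (a' : L' ⊗ M ⟶ M) :
    opComp (actL M N a) (actL M N a') = actL M N (opComp a a') := by
  simp [actL, opComp]

lemma opComp_actR {L L' M N : C} (b : L ⊗ N ⟶ N) (b' : L' ⊗ N ⟶ N) :
    opComp (actR M N b) (actR M N b') = actR M N (opComp b b') := by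
  simp only [actR_eq, opComp, MonoidalCategory.whiskerLeft_comp, Category.assoc]
  rw [reassoc_of% sw_nat₃, sw_tensor_left]
  simp only [Category.assoc, ← MonoidalCategory.whiskerLeft_comp_assoc M (α_ L _ _).inv,
    Iso.inv_hom_id, MonoidalCategory.whiskerLeft_id, Category.id_comp]

/-- Operators on different tensor factors commute up to the braiding of their parameters. These are
the cross terms that cancel in a commutator of derivations. -/
lemma opComp_actL_actR {L L' M N : C} (a : L ⊗ M ⟶ M) (b : L' ⊗ N ⟶ N) :
    opComp (actL M N a) (actR M N b) =
      (β_ L L').hom ▷ (M ⊗ N) ≫ opComp (actR M N b) (actL M N a) := by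
  simp only [actL, actR_eq, opComp, MonoidalCategory.whiskerLeft_comp, Category.assoc]
  have h : (β_ L L').hom ▷ (M ⊗ N) ≫ (α_ L' L (M ⊗ N)).hom ≫ sw L' L (M ⊗ N) =
      (α_ _ _ _).hom := by
    simp only [sw, Iso.hom_inv_id_assoc, ← comp_whiskerRight_assoc, SymmetricCategory.symmetry,
      id_whiskerRight, Category.id_comp]
  rw [reassoc_of% sw_nat₂, sw_tensor_mid]
  simp only [Category.assoc, ← MonoidalCategory.whiskerLeft_comp_assoc L' (α_ _ _ _).inv,
    Iso.inv_hom_id, MonoidalCategory.whiskerLeft_id, Category.id_comp]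
  rw [reassoc_of% h, ← whisker_exchange]
  simp

end Operators

/-! ### Parametrized derivations and their values on generators. -/

section Derivations

variable {C : Type u} [Category.{v} C] [Preadditive C] [MonoidalCategory C]
  [SymmetricCategory C] [MonoidalPreadditive C]

open scoped MonObj

/-- A `T`-parametrized family of derivations along the algebra morphism `f`. -/
def IsDer {A B T : C} [MonObj A] [MonObj B] (f : A ⟶ B) (δ : T ⊗ A ⟶ B) : Prop :=
  T ◁ μ[A] ≫ δ = ((α_ T A A).inv ≫ (δ ⊗ₘ f) + sw T A A ≫ (f ⊗ₘ δ)) ≫ μ[B]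

section

variable {A A' B B' T T' : C} [MonObj A] [MonObj A'] [MonObj B] [MonObj B']

lemma isDer_id_iff {δ : T ⊗ A ⟶ A} :
    IsDer (𝟙 A) δ ↔ T ◁ μ[A] ≫ δ = (actL A A δ + actR A A δ) ≫ μ[A] := by
  rw [IsDer, actL, actR_eq, tensorHom_id, id_tensorHom]

lemma IsDer.param {f : A ⟶ B} {δ : T ⊗ A ⟶ B} (h : IsDer f δ) (j : T' ⟶ T) :
    IsDer f (j ▷ A ≫ δ) := by
  rw [IsDer, whisker_exchange_assoc, h, ← Category.assoc, ← whiskerRight_tensorHom,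
    Preadditive.comp_add, reassoc_of% sw_nat₁, ← associator_inv_naturality_left_assoc,
    ← whiskerLeft_tensorHom]

lemma IsDer.comp {f : A ⟶ B} {δ : T ⊗ A ⟶ B} (h : IsDer f δ) (g : B ⟶ B') [IsMonHom g] :
    IsDer (f ≫ g) (δ ≫ g) := by
  rw [IsDer, reassoc_of% h, IsMonHom.mul_hom]
  simp only [Preadditive.add_comp, Category.assoc, tensorHom_comp_tensorHom_assoc]

lemma IsDer.precomp {f : A ⟶ B} {δ : T ⊗ A ⟶ B} (h : IsDer f δ) (g : A' ⟶ A) [IsMonHom g] :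
    IsDer (g ≫ f) (T ◁ g ≫ δ) := by
  rw [IsDer, ← MonoidalCategory.whiskerLeft_comp_assoc, IsMonHom.mul_hom,
    MonoidalCategory.whiskerLeft_comp_assoc, h, ← Category.assoc, Preadditive.comp_add]
  congr 2
  · have := associator_inv_naturality (𝟙 T) g g
    simp only [id_tensorHom] at this
    rw [reassoc_of% this, tensorHom_comp_tensorHom]
  · rw [reassoc_of% sw_nat₂₃, tensorHom_comp_tensorHom]

lemma IsDer.of_id {g : A' ⟶ A} [IsMonHom g] {δ : T ⊗ A ⟶ A} (h : IsDer (𝟙 A) δ) :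
    IsDer g (T ◁ g ≫ δ) := by
  simpa using h.precomp g

lemma IsDer.id_comp {δ : T ⊗ A ⟶ A} (h : IsDer (𝟙 A) δ) (g : A ⟶ B) [IsMonHom g] :
    IsDer g (δ ≫ g) := by
  simpa using h.comp g

lemma IsDer.zero (f : A ⟶ B) : IsDer f (0 : T ⊗ A ⟶ B) := by
  simp [IsDer]

/-- The usual argument: the Leibniz rule on 1 · 1 gives δ(1) = δ(1) + δ(1). -/
lemma IsDer.one {f : A ⟶ B} [IsMonHom f] {δ : T ⊗ A ⟶ B} (h : IsDer f δ) : T ◁ η[A] ≫ δ = 0 := by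
  have h1 := T ◁ (η[A] ⊗ₘ η[A]) ≫= h
  have a1 : (η[A] ⊗ₘ η[A]) ≫ μ[A] = (λ_ _).hom ≫ η[A] := by
    rw [MonoidalCategory.tensorHom_def', Category.assoc, MonObj.one_mul, leftUnitor_naturality]
  have a2 : T ◁ (η[A] ⊗ₘ η[A]) ≫ (α_ T A A).inv ≫ (δ ⊗ₘ f) =
      (α_ _ _ _).inv ≫ ((T ◁ η[A] ≫ δ) ⊗ₘ η[B]) := by
    have := associator_inv_naturality (𝟙 T) η[A] η[A]
    simp only [id_tensorHom] at this
    rw [reassoc_of% this, tensorHom_comp_tensorHom, IsMonHom.one_hom]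
  have a3 : T ◁ (η[A] ⊗ₘ η[A]) ≫ sw T A A ≫ (f ⊗ₘ δ) =
      sw _ _ _ ≫ (η[B] ⊗ₘ (T ◁ η[A] ≫ δ)) := by
    rw [reassoc_of% sw_nat₂₃, tensorHom_comp_tensorHom, IsMonHom.one_hom]
  rw [← MonoidalCategory.whiskerLeft_comp_assoc, a1, MonoidalCategory.whiskerLeft_comp_assoc,
    Preadditive.add_comp, Preadditive.comp_add, ← Category.assoc _ _ μ[B], a2,
    ← Category.assoc _ _ μ[B], a3] at h1
  generalize T ◁ η[A] ≫ δ = z at h1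
  have b1 : (z ⊗ₘ η[B]) ≫ μ[B] = (ρ_ _).hom ≫ z := by
    rw [MonoidalCategory.tensorHom_def, Category.assoc, MonObj.mul_one, rightUnitor_naturality]
  have b2 : (η[B] ⊗ₘ z) ≫ μ[B] = (λ_ _).hom ≫ z := by
    rw [MonoidalCategory.tensorHom_def', Category.assoc, MonObj.one_mul, leftUnitor_naturality]
  rw [Category.assoc, Category.assoc, b1, b2] at h1
  have h2 := T ◁ (λ_ _).inv ≫= h1
  have c1 : T ◁ (λ_ (𝟙_ C)).inv ≫ (α_ T (𝟙_ C) (𝟙_ C)).inv ≫ (ρ_ (T ⊗ 𝟙_ C)).hom = 𝟙 _ := by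
    rw [rightUnitor_tensor_hom, Iso.inv_hom_id_assoc, ← unitors_equal,
      ← MonoidalCategory.whiskerLeft_comp, Iso.inv_hom_id, MonoidalCategory.whiskerLeft_id]
  rw [Preadditive.comp_add, reassoc_of% c1] at h2
  simpa using h2

/-- The commutator of two operators with parameters. -/
def opComm {L L' M : C} (a : L ⊗ M ⟶ M) (a' : L' ⊗ M ⟶ M) : (L ⊗ L') ⊗ M ⟶ M :=
  opComp a a' - (β_ L L').hom ▷ M ≫ opComp a' a

lemma IsDer.whiskerLeft_mul_opComp {δ : T ⊗ A ⟶ A} {δ' : T' ⊗ A ⟶ A} (h : IsDer (𝟙 A) δ)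
    (h' : IsDer (𝟙 A) δ') : (T ⊗ T') ◁ μ[A] ≫ opComp δ δ' =
      opComp (actL A A δ + actR A A δ) (actL A A δ' + actR A A δ') ≫ μ[A] := by
  rw [isDer_id_iff] at h h'
  rw [opComp, opComp, associator_naturality_right_assoc, ← MonoidalCategory.whiskerLeft_comp_assoc,
    h', MonoidalCategory.whiskerLeft_comp_assoc, h]
  simp only [Category.assoc]

lemma opComp_add {L L' M : C} (a b : L ⊗ M ⟶ M) (a' b' : L' ⊗ M ⟶ M) :
    opComp (a + b) (a' + b') = opComp a a' + opComp a b' + opComp b a' + opComp b b' := by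
  simp only [opComp, MonoidalPreadditive.whiskerLeft_add, Preadditive.add_comp,
    Preadditive.comp_add]
  abel

/-- In δδ'(ab) the terms where the two derivations hit different factors also occur in the opposite
composite, with the sign of the braiding, and cancel. Thus relations between commutators can be
checked on generators. -/
lemma IsDer.opComm {δ : T ⊗ A ⟶ A} {δ' : T' ⊗ A ⟶ A} (h : IsDer (𝟙 A) δ)
    (h' : IsDer (𝟙 A) δ') : IsDer (𝟙 A) (opComm δ δ') := by
  have e1 := opComp_actL_actR (M := A) (N := A) δ δ'
  have e2 := (β_ T T').hom ▷ (A ⊗ A) ≫= opComp_actL_actR (M := A) (N := A) δ' δ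
  rw [← comp_whiskerRight_assoc, SymmetricCategory.symmetry, id_whiskerRight,
    Category.id_comp] at e2
  have b1 : actL A A ((β_ T T').hom ▷ A ≫ opComp δ' δ) =
      (β_ T T').hom ▷ (A ⊗ A) ≫ opComp (actL A A δ') (actL A A δ) := by
    rw [opComp_actL]
    simp [actL]
  have b2 : actR A A ((β_ T T').hom ▷ A ≫ opComp δ' δ) =
      (β_ T T').hom ▷ (A ⊗ A) ≫ opComp (actR A A δ') (actR A A δ) := by
    rw [opComp_actR, actR_eq, actR_eq, reassoc_of% sw_nat₁]
    simp
  have b3 (x y : (T ⊗ T') ⊗ A ⟶ A) : actL A A (x - y) = actL A A x - actL A A y := by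
    simp [actL, sub_whiskerRight]
  have b4 (x y : (T ⊗ T') ⊗ A ⟶ A) : actR A A (x - y) = actR A A x - actR A A y := by
    simp [actR_eq, whiskerLeft_sub]
  rw [isDer_id_iff, SuperTensor.opComm, Preadditive.comp_sub, whisker_exchange_assoc,
    h.whiskerLeft_mul_opComp h', h'.whiskerLeft_mul_opComp h, b3, b4, b1, b2, ← opComp_actL,
    ← opComp_actR, ← Category.assoc, ← Preadditive.sub_comp, opComp_add, opComp_add]
  congr 1
  simp only [Preadditive.comp_add]
  rw [e1, ← e2]
  abel

end

section SymData

variable {V B T : C} (D : SymData V) [MonObj B]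

namespace SymData

/-- A product of n + 1 generators is a generator times a product of n, so the Leibniz rule
determines δ by induction. Derivations along a morphism `f` are allowed because intertwining
relations δf = fδ' compare two such derivations. -/
lemma der_ext {f : D.A ⟶ B} [IsMonHom f] {δ δ' : T ⊗ D.A ⟶ B} (h : IsDer f δ) (h' : IsDer f δ')
    (hg : T ◁ D.gen ≫ δ = T ◁ D.gen ≫ δ') : δ = δ' := by
  have hc {δ : T ⊗ D.A ⟶ B} (h : IsDer f δ) (n : ℕ) : T ◁ D.m (n + 1) ≫ δ =
      ((α_ T V (pow V n)).inv ≫ ((T ◁ D.gen ≫ δ) ⊗ₘ (D.m n ≫ f)) +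
        sw T V (pow V n) ≫ ((D.gen ≫ f) ⊗ₘ (T ◁ D.m n ≫ δ))) ≫ μ[B] := by
    have e : D.m (n + 1) = (D.gen ⊗ₘ D.m n) ≫ μ[D.A] := by
      rw [← m_cons, cons_eq, ← Category.assoc, ← MonoidalCategory.tensorHom_def']
    have := associator_inv_naturality (𝟙 T) D.gen (D.m n)
    simp only [id_tensorHom] at this
    rw [e, MonoidalCategory.whiskerLeft_comp_assoc, h, ← Category.assoc, Preadditive.comp_add,
      reassoc_of% this, reassoc_of% sw_nat₂₃, tensorHom_comp_tensorHom, tensorHom_comp_tensorHom]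
  refine D.hom_ext fun n => ?_
  induction n with
  | zero =>
    have h1 : T ◁ η[D.A] ≫ δ = T ◁ η[D.A] ≫ δ' := by rw [h.one, h'.one]
    exact h1
  | succ n ih => rw [hc h, hc h', ih, hg]

/-- The derivation with given values on generators, on tensor powers. -/
noncomputable def derPow (g : T ⊗ V ⟶ D.A) : (n : ℕ) → (T ⊗ pow V n ⟶ D.A)
  | 0 => 0
  | n + 1 => (α_ T V (pow V n)).inv ≫ (g ⊗ₘ D.m n) ≫ μ[D.A] +
      sw T V (pow V n) ≫ V ◁ derPow g n ≫ D.cons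

/-- The Leibniz sum is symmetric: transposing the first two generators exchanges the terms where the
derivation hits them and fixes the rest. -/
lemma isSymm_derPow (g : T ⊗ V ⟶ D.A) (n : ℕ) : IsSymm (D.derPow g n) := by
  intro i
  induction n generalizing i with
  | zero => rw [tr_zero_left, MonoidalCategory.whiskerLeft_id, Category.id_comp]
  | succ n ih =>
    cases i with
    | succ i =>
      rw [tr_succ, derPow, Preadditive.comp_add, associator_inv_naturality_right_assoc,
        ← Category.assoc (_ ◁ _), whiskerLeft_tensorHom, D.tr_m, reassoc_of% sw_nat₃,
        ← MonoidalCategory.whiskerLeft_comp_assoc, ih]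
    | zero =>
      cases n with
      | zero =>
        rw [tr]
        exact (congrArg (· ≫ D.derPow g 1) (MonoidalCategory.whiskerLeft_id _ _)).trans
          (Category.id_comp _)
      | succ n =>
        rw [tr_zero, derPow, derPow]
        simp only [Preadditive.comp_add, Preadditive.add_comp, MonoidalPreadditive.whiskerLeft_add,
          MonoidalCategory.whiskerLeft_comp, Category.assoc]
        -- The term hitting the first generator equals the transposed term hitting the second, since
        -- g(v) can be moved past the other generator by `mul_cons`.
        have h1 : (α_ T V (pow V (n + 1))).inv ≫ (g ⊗ₘ D.m (n + 1)) ≫ μ[D.A] =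
            T ◁ sw V V (pow V n) ≫ sw T V (V ⊗ pow V n) ≫ V ◁ (α_ T V (pow V n)).inv ≫
              V ◁ (g ⊗ₘ D.m n) ≫ V ◁ μ[D.A] ≫ D.cons := by
          have e1 : (g ⊗ₘ D.m (n + 1)) ≫ μ[D.A] =
              (T ⊗ V) ◁ V ◁ D.m n ≫ g ▷ (V ⊗ D.A) ≫ D.A ◁ D.cons ≫ D.mul := by
            rw [MonoidalCategory.tensorHom_def', ← m_cons, MonoidalCategory.whiskerLeft_comp,
              Category.assoc, Category.assoc, whisker_exchange_assoc]
            rfl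
          rw [e1, mul_cons, reassoc_of% sw_nat₁, reassoc_of% sw_nat₃, sw_tensor_left,
            ← MonoidalCategory.whiskerLeft_comp_assoc V (_ ◁ _),
            ← MonoidalCategory.tensorHom_def']
          simp only [Category.assoc, Iso.inv_hom_id_assoc]
          rfl
        -- The terms hitting later generators are invariant: the braid relation moves the
        -- transposition to the left of both generators, which commute.
        have h3 : T ◁ sw V V (pow V n) ≫ sw T V (V ⊗ pow V n) ≫ V ◁ sw T V (pow V n) ≫
            V ◁ V ◁ D.derPow g n ≫ V ◁ D.cons ≫ D.cons =
            sw T V (V ⊗ pow V n) ≫ V ◁ sw T V (pow V n) ≫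
              V ◁ V ◁ D.derPow g n ≫ V ◁ D.cons ≫ D.cons := by
          rw [← reassoc_of% sw_yang_baxter, ← reassoc_of% (sw_nat₃ V V (D.derPow g n)),
            sw_cons_cons]
        have h2 := T ◁ sw V V (pow V n) ≫= h1
        rw [← MonoidalCategory.whiskerLeft_comp_assoc, sw_sw, MonoidalCategory.whiskerLeft_id,
          Category.id_comp] at h2
        erw [h3, h2]
        rw [← h1]
        abel

/-- The derivation with given values on generators. -/
noncomputable def der (g : T ⊗ V ⟶ D.A) : T ⊗ D.A ⟶ D.A :=
  D.desc (D.derPow g) (D.isSymm_derPow g)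

lemma m_der (g : T ⊗ V ⟶ D.A) (n : ℕ) : T ◁ D.m n ≫ D.der g = D.derPow g n := D.m_desc _ _ n

lemma m_zero_der (g : T ⊗ V ⟶ D.A) : T ◁ D.m 0 ≫ D.der g = 0 := D.m_der g 0

lemma cons_der (g : T ⊗ V ⟶ D.A) : T ◁ D.cons ≫ D.der g =
    (α_ T V D.A).inv ≫ g ▷ D.A ≫ μ[D.A] + sw T V D.A ≫ V ◁ D.der g ≫ D.cons := by
  refine D.hom_ext₂ fun n => ?_
  rw [← MonoidalCategory.whiskerLeft_comp_assoc, m_cons, m_der, derPow, Preadditive.comp_add,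
    associator_inv_naturality_right_assoc, reassoc_of% sw_nat₃,
    ← MonoidalCategory.whiskerLeft_comp_assoc, m_der, MonoidalCategory.tensorHom_def',
    Category.assoc]

lemma gen_der (g : T ⊗ V ⟶ D.A) : T ◁ D.gen ≫ D.der g = g := by
  rw [gen_eq]
  simp only [MonoidalCategory.whiskerLeft_comp, Category.assoc]
  rw [cons_der, Preadditive.comp_add, associator_inv_naturality_right_assoc,
    whisker_exchange_assoc, reassoc_of% sw_nat₃, ← MonoidalCategory.whiskerLeft_comp_assoc V,
    m_zero_der, mul_eq, mul_m_zero]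
  simp

/-- Induction on the first factor, the rule for a single generator being `cons_der`. -/
lemma isDer_der (g : T ⊗ V ⟶ D.A) : IsDer (𝟙 D.A) (D.der g) := by
  rw [isDer_id_iff, mul_eq, actL, actR_eq]
  refine D.hom_ext_induction_mid ?_ fun {W} s h => ?_
  · rw [← MonoidalCategory.whiskerLeft_comp_assoc, m_zero_mul, Preadditive.add_comp,
      Preadditive.comp_add]
    simp only [Category.assoc]
    rw [reassoc_of% sw_nat₂, associator_inv_naturality_middle_assoc, ← comp_whiskerRight_assoc,
      m_zero_der, ← whisker_exchange_assoc, m_zero_mul, leftUnitor_naturality]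
    simp
  · simp only [Preadditive.add_comp, Preadditive.comp_add, Category.assoc] at h ⊢
    rw [← MonoidalCategory.whiskerLeft_comp_assoc, associator_inv_naturality_middle_assoc,
      ← comp_whiskerRight_assoc, reassoc_of% sw_nat₂, ← whisker_exchange_assoc] at h ⊢
    -- With δ the derivation and s ranging over the first factor: `k1` expands δ(vs), `k2` and `k3`
    -- multiply its two terms by b, `k4` rewrites (vs)δ(b) and `k5` expands δ(v(sb)). In all but the
    -- g(v) terms the generator v comes out in front, and the hypothesis on s applies behind it.
    have k1 : T ◁ (V ◁ s ≫ D.cons) ≫ D.der g =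
        (α_ T V W).inv ≫ (g ⊗ₘ s) ≫ D.mul + sw T V W ≫ V ◁ (T ◁ s ≫ D.der g) ≫ D.cons := by
      rw [MonoidalCategory.whiskerLeft_comp_assoc, cons_der, Preadditive.comp_add,
        associator_inv_naturality_right_assoc, reassoc_of% sw_nat₃,
        ← MonoidalCategory.whiskerLeft_comp_assoc V, ← Category.assoc (_ ◁ s),
        ← MonoidalCategory.tensorHom_def', mul_eq]
    have k2 : (α_ T (V ⊗ W) D.A).inv ≫ ((α_ T V W).inv ≫ (g ⊗ₘ s) ≫ D.mul) ▷ D.A ≫ D.mul =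
        T ◁ (α_ V W D.A).hom ≫ (α_ _ _ _).inv ≫ (g ⊗ₘ (s ▷ D.A ≫ D.mul)) ≫ D.mul := by
      have := associator_naturality g s (𝟙 D.A)
      simp only [tensorHom_id] at this
      simp only [comp_whiskerRight, Category.assoc]
      rw [mul_mul, reassoc_of% this, comp_tensorHom_right, Category.assoc]
      simp
    have k3 : (α_ T (V ⊗ W) D.A).inv ≫
        (sw T V W ≫ V ◁ (T ◁ s ≫ D.der g) ≫ D.cons) ▷ D.A ≫ D.mul =
        T ◁ (α_ V W D.A).hom ≫ sw _ _ _ ≫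
          V ◁ ((α_ T W D.A).inv ≫ (T ◁ s ≫ D.der g) ▷ D.A ≫ D.mul) ≫ D.cons := by
      rw [comp_whiskerRight_assoc, cons_mul', sw_tensor_right]
      simp
    have k4 : sw T (V ⊗ W) D.A ≫ (V ⊗ W) ◁ D.der g ≫ (V ◁ s ≫ D.cons) ▷ D.A ≫ D.mul =
        T ◁ (α_ V W D.A).hom ≫ sw _ _ _ ≫
          V ◁ (sw T W D.A ≫ W ◁ D.der g ≫ s ▷ D.A ≫ D.mul) ≫ D.cons := by
      rw [cons_mul', sw_tensor_mid]
      simp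
    have k5 : T ◁ (V ◁ (s ▷ D.A ≫ D.mul) ≫ D.cons) ≫ D.der g =
        (α_ _ _ _).inv ≫ (g ⊗ₘ (s ▷ D.A ≫ D.mul)) ≫ D.mul +
          sw _ _ _ ≫ V ◁ (T ◁ (s ▷ D.A ≫ D.mul) ≫ D.der g) ≫ D.cons := by
      rw [MonoidalCategory.whiskerLeft_comp_assoc, cons_der, Preadditive.comp_add,
        associator_inv_naturality_right_assoc, reassoc_of% sw_nat₃,
        ← MonoidalCategory.whiskerLeft_comp_assoc V, ← Category.assoc (_ ◁ (s ▷ _ ≫ _)),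
        ← MonoidalCategory.tensorHom_def', mul_eq]
    rw [k1, MonoidalPreadditive.add_whiskerRight, Preadditive.add_comp, Preadditive.comp_add, k2,
      k3, k4, cons_mul', MonoidalCategory.whiskerLeft_comp_assoc, k5, h,
      MonoidalPreadditive.whiskerLeft_add]
    simp only [Preadditive.add_comp, Preadditive.comp_add]
    rw [add_assoc]

end SymData

end SymData

end Derivations

end SuperTensor

namespace SuperTensor

open scoped MonObj

/-- The morphism of commutative algebras given by a morphism of algebras. -/
def commMonHom {T : Type*} [Category T] [MonoidalCategory T] [BraidedCategory T] {A B : CommMon T}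
    (f : A.X ⟶ B.X) (hf : IsMonHom f) : A ⟶ B :=
  CommMon.homMk { hom := f, isMonHom_hom := hf }

/-! ### Algebras in modules, and the symmetric algebra of a module. -/

section LieModAlgebra

variable {C : Type u} [Category.{v} C] [Preadditive C] [MonoidalCategory C]
  [SymmetricCategory C] [MonoidalPreadditive C] {L : LieAlg C}

namespace LieMod

/-- The underlying algebra of an algebra in `L`-modules. -/
@[reducible]
def underlyingMonObj (X : LieMod L) [MonObj X] : MonObj X.V where
  one := η[X].hom
  mul := μ[X].hom
  one_mul := congrArg Hom.hom (MonObj.one_mul X)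
  mul_one := congrArg Hom.hom (MonObj.mul_one X)
  mul_assoc := congrArg Hom.hom (MonObj.mul_assoc X)

lemma underlying_isCommMonObj (X : LieMod L) [MonObj X] [IsCommMonObj X] :
    letI := X.underlyingMonObj
    IsCommMonObj X.V :=
  letI := X.underlyingMonObj
  ⟨congrArg Hom.hom (IsCommMonObj.mul_comm X)⟩

lemma underlying_isDer (X : LieMod L) [MonObj X] :
    letI := X.underlyingMonObj
    IsDer (𝟙 X.V) X.act :=
  letI := X.underlyingMonObj
  isDer_id_iff.2 μ[X].comm.symm

lemma underlying_isMonHom {X Y : LieMod L} [MonObj X] [MonObj Y] (f : X ⟶ Y) [IsMonHom f] :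
    letI := X.underlyingMonObj
    letI := Y.underlyingMonObj
    IsMonHom f.hom :=
  letI := X.underlyingMonObj
  letI := Y.underlyingMonObj
  ⟨congrArg Hom.hom (IsMonHom.one_hom f), congrArg Hom.hom (IsMonHom.mul_hom f)⟩

/-- An algebra on which a Lie algebra acts by derivations. -/
@[reducible]
def monObjOfIsDer (X : LieMod L) [MonObj X.V] (h : IsDer (𝟙 X.V) X.act) : MonObj X where
  one := ⟨η[X.V], (zero_comp (f := η[X.V])).trans h.one.symm⟩
  mul := ⟨μ[X.V], (isDer_id_iff.1 h).symm⟩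
  one_mul := hom_ext (MonObj.one_mul X.V)
  mul_one := hom_ext (MonObj.mul_one X.V)
  mul_assoc := hom_ext (MonObj.mul_assoc X.V)

end LieMod

section SymMod

lemma opComp_gen {T T' V A : C} {i : V ⟶ A} {δ : T ⊗ A ⟶ A} {δ' : T' ⊗ A ⟶ A}
    {W : C} {a' : T' ⊗ V ⟶ W} {j : W ⟶ A} (h' : T' ◁ i ≫ δ' = a' ≫ j) :
    (T ⊗ T') ◁ i ≫ opComp δ δ' = (α_ T T' V).hom ≫ T ◁ a' ≫ T ◁ j ≫ δ := by
  rw [opComp, associator_naturality_right_assoc, ← MonoidalCategory.whiskerLeft_comp_assoc, h',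
    MonoidalCategory.whiskerLeft_comp_assoc]

variable (M : LieMod L) (D : SymData M.V)

/-- Both sides are derivations, and on generators the identity is the module axiom of `M`. -/
lemma symAct_bracket : L.bracket ▷ D.A ≫ D.der (M.act ≫ D.gen) =
    opComm (D.der (M.act ≫ D.gen)) (D.der (M.act ≫ D.gen)) := by
  have h := D.isDer_der (M.act ≫ D.gen)
  refine D.der_ext (h.param _) (h.opComm h) ?_
  have e := opComp_gen (δ := D.der (M.act ≫ D.gen)) (D.gen_der (M.act ≫ D.gen))
  rw [whisker_exchange_assoc, D.gen_der, opComm, Preadditive.comp_sub, e, whisker_exchange_assoc,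
    e, D.gen_der, reassoc_of% M.act_bracket]
  simp only [Preadditive.sub_comp, Category.assoc]

/-- The symmetric algebra of a module, with the action by derivations. -/
noncomputable def symMod : LieMod L where
  V := D.A
  act := D.der (M.act ≫ D.gen)
  act_bracket := symAct_bracket M D

noncomputable instance : MonObj (symMod M D).V := inferInstanceAs (MonObj D.A)

noncomputable instance : MonObj (symMod M D) :=
  (symMod M D).monObjOfIsDer (D.isDer_der (M.act ≫ D.gen))

instance : IsCommMonObj (symMod M D) :=
  ⟨LieMod.hom_ext D.braiding_mul⟩

/-- The inclusion of the generators into the symmetric algebra of a module. -/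
noncomputable def symModGen : M ⟶ symMod M D := ⟨D.gen, (D.gen_der (M.act ≫ D.gen)).symm⟩

/-- The lift of underlying algebras is automatically equivariant: acting before or after it gives
two derivations along it, equal on generators because `g` is equivariant. -/
lemma exists_symMod_lift {B : LieMod L} [MonObj B] [IsCommMonObj B] (g : M ⟶ B) :
    ∃ f : symMod M D ⟶ B, symModGen M D ≫ f = g ∧ IsMonHom f := by
  let := B.underlyingMonObj
  have := B.underlying_isCommMonObj
  have hB := B.underlying_isDer
  let f := D.lift g.hom
  have hf : D.gen ≫ f = g.hom := D.gen_lift g.hom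
  have h := D.isDer_der (M.act ≫ D.gen)
  have hc : D.der (M.act ≫ D.gen) ≫ f = L.X ◁ f ≫ B.act := by
    refine D.der_ext (h.id_comp f) (hB.of_id) ?_
    rw [← Category.assoc, D.gen_der, Category.assoc, hf, ← MonoidalCategory.whiskerLeft_comp_assoc,
      hf, g.comm]
  have h1 : η[D.A] ≫ f = η[B.V] := IsMonHom.one_hom f
  have h2 : μ[D.A] ≫ f = (f ⊗ₘ f) ≫ μ[B.V] := IsMonHom.mul_hom f
  exact ⟨⟨f, hc⟩, LieMod.hom_ext hf, ⟨LieMod.hom_ext h1, LieMod.hom_ext h2⟩⟩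

lemma symMod_hom_ext {B : LieMod L} [MonObj B] {f f' : symMod M D ⟶ B} [hf : IsMonHom f]
    [hf' : IsMonHom f'] (h : symModGen M D ≫ f = symModGen M D ≫ f') : f = f' := by
  let := B.underlyingMonObj
  have a1 : IsMonHom (M := D.A) (N := B.V) f.hom := LieMod.underlying_isMonHom f
  have a2 : IsMonHom (M := D.A) (N := B.V) f'.hom := LieMod.underlying_isMonHom f'
  exact LieMod.hom_ext (D.algHom_ext (f := f.hom) (f' := f'.hom) (congrArg LieMod.Hom.hom h))

/-- The symmetric algebra of a module is the free commutative algebra. -/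
noncomputable def symModSymmetric : SymmetricAlgebraObject M (CommMon.mk (symMod M D)) where
  homEquiv {B} :=
    { toFun := fun f => symModGen M D ≫ f.hom.hom
      invFun := fun g =>
        commMonHom (exists_symMod_lift M D (B := B.X) g).choose
          (exists_symMod_lift M D (B := B.X) g).choose_spec.2
      left_inv := fun f => by
        apply CommMon.hom_ext
        have h := (exists_symMod_lift M D (B := B.X) (symModGen M D ≫ f.hom.hom)).choose_spec
        exact symMod_hom_ext M D (hf := h.2) (hf' := f.hom.isMonHom_hom) h.1
      right_inv := fun g => (exists_symMod_lift M D (B := B.X) g).choose_spec.1 }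
  homEquiv_comp g f := (Category.assoc (symModGen M D) f.hom.hom g.hom.hom).symm

end SymMod

end LieModAlgebra

end SuperTensor

namespace SuperTensor

open scoped MonObj

/-! ### Commutators of operators under change of parameters. -/

section OperatorLemmas

variable {C : Type u} [Category.{v} C] [Preadditive C] [MonoidalCategory C]
  [SymmetricCategory C] [MonoidalPreadditive C]

lemma opComp_param {T T' U U' M : C} (j : T ⟶ U) (j' : T' ⟶ U') (a : U ⊗ M ⟶ M)
    (a' : U' ⊗ M ⟶ M) : (j ⊗ₘ j') ▷ M ≫ opComp a a' = opComp (j ▷ M ≫ a) (j' ▷ M ≫ a') := by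
  rw [opComp, opComp, MonoidalCategory.whiskerLeft_comp, Category.assoc, whisker_exchange_assoc,
    MonoidalCategory.tensorHom_def, comp_whiskerRight, Category.assoc,
    associator_naturality_middle_assoc, associator_naturality_left_assoc, whisker_exchange_assoc]

lemma opComm_param {T T' U U' M : C} (j : T ⟶ U) (j' : T' ⟶ U') (a : U ⊗ M ⟶ M)
    (a' : U' ⊗ M ⟶ M) : (j ⊗ₘ j') ▷ M ≫ opComm a a' = opComm (j ▷ M ≫ a) (j' ▷ M ≫ a') := by
  rw [opComm, opComm, Preadditive.comp_sub, opComp_param, ← comp_whiskerRight_assoc,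
    braiding_naturality, comp_whiskerRight_assoc, opComp_param]

lemma opComm_swap {T T' M : C} (a : T ⊗ M ⟶ M) (a' : T' ⊗ M ⟶ M) :
    opComm a a' = -((β_ T T').hom ▷ M ≫ opComm a' a) := by
  rw [opComm, opComm, Preadditive.comp_sub, ← comp_whiskerRight_assoc, SymmetricCategory.symmetry]
  simp

lemma IsDer.add {A B T : C} [MonObj A] [MonObj B] {f : A ⟶ B} {δ δ' : T ⊗ A ⟶ B}
    (h : IsDer f δ) (h' : IsDer f δ') : IsDer f (δ + δ') := by
  rw [IsDer] at h h' ⊢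
  rw [Preadditive.comp_add, h, h', MonoidalPreadditive.add_tensor, MonoidalPreadditive.tensor_add]
  simp only [Preadditive.add_comp, Preadditive.comp_add]
  abel

end OperatorLemmas

/-! ### The Lie algebra D ⊗ L₀ in even and odd components. -/

section Cartan

variable {S : Type u} [Category.{v} S] [Abelian S] [Linear ℚ S] [MonoidalCategory S]
  [SymmetricCategory S] [MonoidalPreadditive S] [Supercategory S]

open Supercategory (P)

/-- The contraction `P ⊗ (P ⊗ X) ⟶ X`. -/
noncomputable def oddContr (X : S) : P ⊗ (P ⊗ X) ⟶ X :=
  (α_ P P X).inv ≫ oddPairing.hom ▷ X ≫ (λ_ X).hom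

/-- The inverse of the contraction `P ⊗ (P ⊗ X) ⟶ X`. -/
noncomputable def oddExp (X : S) : X ⟶ P ⊗ (P ⊗ X) :=
  (λ_ X).inv ≫ oddPairing.inv ▷ X ≫ (α_ P P X).hom

@[simp]
lemma oddContr_oddExp (X : S) : oddContr X ≫ oddExp X = 𝟙 _ := by
  simp [oddContr, oddExp, ← comp_whiskerRight_assoc]

@[simp]
lemma oddExp_oddContr (X : S) : oddExp X ≫ oddContr X = 𝟙 _ := by
  simp [oddContr, oddExp, ← comp_whiskerRight_assoc]

instance (X : S) : IsIso (oddContr X) := ⟨oddExp X, oddContr_oddExp X, oddExp_oddContr X⟩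

lemma oddContr_naturality {X Y : S} (f : X ⟶ Y) : P ◁ P ◁ f ≫ oddContr Y = oddContr X ≫ f := by
  rw [oddContr, oddContr, associator_inv_naturality_right_assoc, whisker_exchange_assoc,
    Category.assoc, Category.assoc, leftUnitor_naturality]

variable (L₀ : LieAlg S)

/-- The inclusion of `L₀` into `D ⊗ L₀`. -/
noncomputable def evenIncl : L₀.X ⟶ (𝟙_ S ⊞ P) ⊗ L₀.X := (λ_ L₀.X).inv ≫ biprod.inl ▷ L₀.X

/-- The inclusion of `P ⊗ L₀` into `D ⊗ L₀`. -/
noncomputable def oddIncl : P ⊗ L₀.X ⟶ (𝟙_ S ⊞ P) ⊗ L₀.X := biprod.inr ▷ L₀.X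

/-- The projection of `D ⊗ L₀` to `L₀`. -/
noncomputable def evenProj : (𝟙_ S ⊞ P) ⊗ L₀.X ⟶ L₀.X := biprod.fst ▷ L₀.X ≫ (λ_ L₀.X).hom

/-- The projection of `D ⊗ L₀` to `P ⊗ L₀`. -/
noncomputable def oddProj : (𝟙_ S ⊞ P) ⊗ L₀.X ⟶ P ⊗ L₀.X := biprod.snd ▷ L₀.X

@[simp]
lemma evenIncl_evenProj : evenIncl L₀ ≫ evenProj L₀ = 𝟙 _ := by
  simp [evenIncl, evenProj, ← comp_whiskerRight_assoc]

@[simp]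
lemma evenIncl_oddProj : evenIncl L₀ ≫ oddProj L₀ = 0 := by
  simp [evenIncl, oddProj, ← comp_whiskerRight]

@[simp]
lemma oddIncl_evenProj : oddIncl L₀ ≫ evenProj L₀ = 0 := by
  simp [oddIncl, evenProj, ← comp_whiskerRight_assoc]

@[simp]
lemma oddIncl_oddProj : oddIncl L₀ ≫ oddProj L₀ = 𝟙 _ := by
  simp [oddIncl, oddProj, ← comp_whiskerRight]

lemma evenProj_add_oddProj : evenProj L₀ ≫ evenIncl L₀ + oddProj L₀ ≫ oddIncl L₀ = 𝟙 _ := by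
  have : evenProj L₀ ≫ evenIncl L₀ = (biprod.fst ≫ biprod.inl) ▷ L₀.X := by
    simp [evenIncl, evenProj]
  rw [this, oddProj, oddIncl, ← comp_whiskerRight, ← MonoidalPreadditive.add_whiskerRight,
    biprod.total, id_whiskerRight]

variable {L₀}

/-- D ⊗ L₀ is the direct sum of L₀ and P L₀. This and its variants split identities over D ⊗ L₀ into
Cartan relations. -/
lemma double_hom_ext {X Y : S} {f g : ((𝟙_ S ⊞ P) ⊗ L₀.X) ⊗ X ⟶ Y}
    (h0 : evenIncl L₀ ▷ X ≫ f = evenIncl L₀ ▷ X ≫ g)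
    (h1 : oddIncl L₀ ▷ X ≫ f = oddIncl L₀ ▷ X ≫ g) : f = g := by
  have e (f : ((𝟙_ S ⊞ P) ⊗ L₀.X) ⊗ X ⟶ Y) : f =
      evenProj L₀ ▷ X ≫ evenIncl L₀ ▷ X ≫ f + oddProj L₀ ▷ X ≫ oddIncl L₀ ▷ X ≫ f := by
    conv_lhs => rw [← Category.id_comp f, ← id_whiskerRight, ← evenProj_add_oddProj L₀,
      MonoidalPreadditive.add_whiskerRight, Preadditive.add_comp]
    simp
  rw [e f, e g, h0, h1]

lemma double_hom_ext_right {Z X Y : S} {f g : Z ⊗ (((𝟙_ S ⊞ P) ⊗ L₀.X) ⊗ X) ⟶ Y}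
    (h0 : Z ◁ evenIncl L₀ ▷ X ≫ f = Z ◁ evenIncl L₀ ▷ X ≫ g)
    (h1 : Z ◁ oddIncl L₀ ▷ X ≫ f = Z ◁ oddIncl L₀ ▷ X ≫ g) : f = g := by
  rw [← cancel_epi (sw _ _ _)]
  refine double_hom_ext ?_ ?_
  · rw [reassoc_of% sw_nat₁, reassoc_of% sw_nat₁, h0]
  · rw [reassoc_of% sw_nat₁, reassoc_of% sw_nat₁, h1]

lemma double_hom_ext₂ {X Y : S}
    {f g : (((𝟙_ S ⊞ P) ⊗ L₀.X) ⊗ ((𝟙_ S ⊞ P) ⊗ L₀.X)) ⊗ X ⟶ Y}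
    (h00 : (evenIncl L₀ ⊗ₘ evenIncl L₀) ▷ X ≫ f = (evenIncl L₀ ⊗ₘ evenIncl L₀) ▷ X ≫ g)
    (h01 : (evenIncl L₀ ⊗ₘ oddIncl L₀) ▷ X ≫ f = (evenIncl L₀ ⊗ₘ oddIncl L₀) ▷ X ≫ g)
    (h10 : (oddIncl L₀ ⊗ₘ evenIncl L₀) ▷ X ≫ f = (oddIncl L₀ ⊗ₘ evenIncl L₀) ▷ X ≫ g)
    (h11 : (oddIncl L₀ ⊗ₘ oddIncl L₀) ▷ X ≫ f = (oddIncl L₀ ⊗ₘ oddIncl L₀) ▷ X ≫ g) :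
    f = g := by
  have e {Z Z' : S} (j : Z ⟶ (𝟙_ S ⊞ P) ⊗ L₀.X) (j' : Z' ⟶ (𝟙_ S ⊞ P) ⊗ L₀.X)
      (f : (((𝟙_ S ⊞ P) ⊗ L₀.X) ⊗ ((𝟙_ S ⊞ P) ⊗ L₀.X)) ⊗ X ⟶ Y) :
      Z ◁ j' ▷ X ≫ j ▷ _ ≫ (α_ _ _ _).inv ≫ f = (α_ _ _ _).inv ≫ (j ⊗ₘ j') ▷ X ≫ f := by
    rw [MonoidalCategory.tensorHom_def']
    simp
  rw [← cancel_epi (α_ _ _ _).inv]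
  refine double_hom_ext (double_hom_ext_right ?_ ?_) (double_hom_ext_right ?_ ?_) <;>
  simp only [e, h00, h01, h10, h11]

variable (L₀)

/-- The bracket on `D ⊗ L₀`. -/
noncomputable def doubleBracket :
    ((𝟙_ S ⊞ P) ⊗ L₀.X) ⊗ ((𝟙_ S ⊞ P) ⊗ L₀.X) ⟶ (𝟙_ S ⊞ P) ⊗ L₀.X :=
  tensorμ _ _ _ _ ≫ (doubleMul ⊗ₘ L₀.bracket)

lemma doubleBracket_antisymm : (β_ _ _).hom ≫ doubleBracket L₀ = - doubleBracket L₀ :=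
  congrArg LieMod.Hom.hom (doubleLie L₀).antisymm

/-- The differential on `D ⊗ L₀`. -/
noncomputable def doubleDiff : P ⊗ ((𝟙_ S ⊞ P) ⊗ L₀.X) ⟶ (𝟙_ S ⊞ P) ⊗ L₀.X :=
  actL _ _ doubleD + actR _ _ 0

lemma evenIncl_doubleDiff : P ◁ evenIncl L₀ ≫ doubleDiff L₀ = 0 := by
  rw [doubleDiff, actR_zero, add_zero, evenIncl, actL, MonoidalCategory.whiskerLeft_comp,
    Category.assoc, associator_inv_naturality_middle_assoc, ← comp_whiskerRight, ← inl_doubleD]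
  simp

lemma oddIncl_doubleDiff : P ◁ oddIncl L₀ ≫ doubleDiff L₀ = oddContr L₀.X ≫ evenIncl L₀ := by
  rw [doubleDiff, actR_zero, add_zero, oddIncl, actL,
    associator_inv_naturality_middle_assoc, ← comp_whiskerRight, doubleD,
    ← MonoidalCategory.whiskerLeft_comp_assoc, biprod.inr_snd]
  simp [oddContr, evenIncl]

lemma tensorμ_eq (X Y Z W : S) : tensorμ X Y Z W =
    (α_ _ _ _).hom ≫ X ◁ sw Y Z W ≫ (α_ _ _ _).inv := by
  simp [tensorμ, sw]

/-- The components of the bracket on D ⊗ L₀ are read off from those of the multiplication of D. In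
particular P L₀ is abelian because P squares to zero in D. -/
lemma whiskerRight_doubleBracket {X Y Z : S} (a : X ⟶ 𝟙_ S ⊞ P) (b : Y ⟶ 𝟙_ S ⊞ P)
    (c : X ⊗ Y ⟶ Z) (j : Z ⟶ 𝟙_ S ⊞ P) (h : (a ⊗ₘ b) ≫ doubleMul = c ≫ j) :
    (a ▷ L₀.X ⊗ₘ b ▷ L₀.X) ≫ doubleBracket L₀ =
      tensorμ X L₀.X Y L₀.X ≫ (c ⊗ₘ L₀.bracket) ≫ j ▷ L₀.X := by
  have := tensorμ_natural a (𝟙 L₀.X) b (𝟙 L₀.X)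
  simp only [tensorHom_id, id_whiskerRight] at this
  rw [doubleBracket, reassoc_of% this, whiskerRight_tensorHom, h, comp_tensorHom_left]

lemma inl_inl_doubleMul : (biprod.inl ⊗ₘ biprod.inl) ≫ doubleMul (S := S) =
    (λ_ _).hom ≫ biprod.inl := by
  rw [MonoidalCategory.tensorHom_def', Category.assoc, double_one_mul, leftUnitor_naturality]

lemma inl_inr_doubleMul : (biprod.inl ⊗ₘ biprod.inr) ≫ doubleMul (S := S) =
    (λ_ _).hom ≫ biprod.inr := by
  rw [MonoidalCategory.tensorHom_def', Category.assoc, double_one_mul, leftUnitor_naturality]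

lemma inr_inr_doubleMul : (biprod.inr ⊗ₘ biprod.inr) ≫ doubleMul (S := S) = 0 := by
  apply biprod.hom_ext <;> simp

lemma evenIncl_evenIncl_bracket : (evenIncl L₀ ⊗ₘ evenIncl L₀) ≫ doubleBracket L₀ =
    L₀.bracket ≫ evenIncl L₀ := by
  rw [evenIncl, ← tensorHom_comp_tensorHom, Category.assoc,
    whiskerRight_doubleBracket L₀ _ _ _ _ inl_inl_doubleMul, tensorμ_eq,
    MonoidalCategory.tensorHom_def, MonoidalCategory.tensorHom_def' _ L₀.bracket]
  simp

lemma evenIncl_oddIncl_bracket : (evenIncl L₀ ⊗ₘ oddIncl L₀) ≫ doubleBracket L₀ =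
    actR P L₀.X L₀.bracket ≫ oddIncl L₀ := by
  rw [evenIncl, ← whiskerRight_tensorHom, Category.assoc, oddIncl,
    whiskerRight_doubleBracket L₀ _ _ _ _ inl_inr_doubleMul, tensorμ_eq, actR_eq,
    MonoidalCategory.tensorHom_def' _ L₀.bracket]
  simp

lemma oddIncl_evenIncl_bracket : (oddIncl L₀ ⊗ₘ evenIncl L₀) ≫ doubleBracket L₀ =
    -((β_ _ _).hom ≫ actR P L₀.X L₀.bracket ≫ oddIncl L₀) := by
  rw [← evenIncl_oddIncl_bracket, ← reassoc_of% braiding_naturality, doubleBracket_antisymm]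
  simp

lemma oddIncl_oddIncl_bracket : (oddIncl L₀ ⊗ₘ oddIncl L₀) ≫ doubleBracket L₀ = 0 := by
  rw [oddIncl, whiskerRight_doubleBracket L₀ _ _ (0 : _ ⟶ 𝟙_ S) 0
    (by rw [inr_inr_doubleMul, comp_zero])]
  simp

end Cartan

end SuperTensor

namespace SuperTensor

open scoped MonObj

/-! ### Modules over D ⊗ L₀ as Cartan data. -/

section Cartan

variable {S : Type u} [Category.{v} S] [Abelian S] [Linear ℚ S] [MonoidalCategory S]
  [SymmetricCategory S] [MonoidalPreadditive S] [Supercategory S]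

open Supercategory (P)

variable {L₀ : LieAlg S}

/-- The differential of a module over `D ⊗ L₀`, on underlying objects. -/
def diffAct (X : DoubleMod L₀) : P ⊗ X.V.V ⟶ X.V.V := X.V.act

/-- The action of `D ⊗ L₀`, on underlying objects. -/
def totalAct (X : DoubleMod L₀) : ((𝟙_ S ⊞ P) ⊗ L₀.X) ⊗ X.V.V ⟶ X.V.V := X.act.hom

lemma evenAct_eq (X : DoubleMod L₀) : evenAct L₀ X = evenIncl L₀ ▷ X.V.V ≫ totalAct X := rfl

lemma oddAct_eq (X : DoubleMod L₀) : oddAct L₀ X = oddIncl L₀ ▷ X.V.V ≫ totalAct X := rfl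

lemma totalAct_comm (X : DoubleMod L₀) :
    (actL _ _ (doubleDiff L₀) + actR _ _ (diffAct X)) ≫ totalAct X =
      P ◁ totalAct X ≫ diffAct X :=
  X.act.comm

lemma diffAct_diffAct (X : DoubleMod L₀) : P ◁ diffAct X ≫ diffAct X = 0 := act_act_eq_zero X.V

/-- Restricts the compatibility of an action with the differential to a component `T` of the Lie
algebra. The first term is the differential of that component, which is zero on L₀ and the
contraction to L₀ on P L₀. -/
lemma whiskerLeft_restrict {T L X : S} (j : T ⟶ L) (a : L ⊗ X ⟶ X) (d : P ⊗ X ⟶ X)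
    (q : P ⊗ L ⟶ L) :
    P ◁ j ▷ X ≫ (actL _ _ q + actR _ _ d) ≫ a =
      (α_ P T X).inv ≫ (P ◁ j ≫ q) ▷ X ≫ a + actR T X d ≫ j ▷ X ≫ a := by
  rw [Preadditive.add_comp, Preadditive.comp_add, ← reassoc_of% nat3 (b := d) j, actL,
    Category.assoc, associator_inv_naturality_middle_assoc, comp_whiskerRight_assoc]

/-- The even action commutes with the differential. -/
lemma evenAct_diff (X : DoubleMod L₀) :
    P ◁ evenAct L₀ X ≫ diffAct X = actR L₀.X X.V.V (diffAct X) ≫ evenAct L₀ X := by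
  rw [evenAct_eq, MonoidalCategory.whiskerLeft_comp_assoc, ← totalAct_comm,
    whiskerLeft_restrict, evenIncl_doubleDiff]
  simp

/-- The graded commutator of the differential and the odd action is the even action. -/
lemma oddAct_diff (X : DoubleMod L₀) :
    P ◁ oddAct L₀ X ≫ diffAct X = actR (P ⊗ L₀.X) X.V.V (diffAct X) ≫ oddAct L₀ X +
      (α_ _ _ _).inv ≫ oddContr L₀.X ▷ X.V.V ≫ evenAct L₀ X := by
  rw [oddAct_eq, MonoidalCategory.whiskerLeft_comp_assoc, ← totalAct_comm,
    whiskerLeft_restrict, oddIncl_doubleDiff, evenAct_eq, comp_whiskerRight_assoc, add_comm]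

variable (L₀) in
/-- The data of a module over `D ⊗ L₀` in supercomplexes: a differential, an action of `L₀` and
contractions, subject to the Cartan relations. -/
structure CartanData where
  /-- The underlying object. -/
  X : S
  /-- The differential. -/
  d : P ⊗ X ⟶ X
  /-- The action of `L₀`. -/
  e : L₀.X ⊗ X ⟶ X
  /-- The contractions. -/
  i : (P ⊗ L₀.X) ⊗ X ⟶ X
  d_d : P ◁ d ≫ d = 0
  d_e : P ◁ e ≫ d = actR L₀.X X d ≫ e
  d_i : P ◁ i ≫ d = actR (P ⊗ L₀.X) X d ≫ i + (α_ _ _ _).inv ≫ oddContr L₀.X ▷ X ≫ e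
  e_e : opComm e e = L₀.bracket ▷ X ≫ e
  e_i : opComm e i = actR P L₀.X L₀.bracket ▷ X ≫ i
  i_i : opComm i i = 0

namespace CartanData

variable (K : CartanData L₀)

/-- The underlying supercomplex. -/
noncomputable def complex : Supercomplex S where
  V := K.X
  act := K.d
  act_bracket := by
    have h : ∀ f : (P : S) ⊗ P ⊗ K.X ⟶ K.X, f = 0 →
        (0 : (P : S) ⊗ P ⟶ P) ▷ K.X ≫ K.d = (α_ _ _ _).hom ≫ f -
          (β_ P P).hom ▷ K.X ≫ (α_ _ _ _).hom ≫ f := by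
      rintro f rfl
      simp
    exact h _ K.d_d

/-- The action of `D ⊗ L₀`. -/
noncomputable def act : ((𝟙_ S ⊞ P) ⊗ L₀.X) ⊗ K.X ⟶ K.X :=
  evenProj L₀ ▷ K.X ≫ K.e + oddProj L₀ ▷ K.X ≫ K.i

@[simp]
lemma evenIncl_act : evenIncl L₀ ▷ K.X ≫ K.act = K.e := by
  simp [act, ← comp_whiskerRight_assoc]

@[simp]
lemma oddIncl_act : oddIncl L₀ ▷ K.X ≫ K.act = K.i := by
  simp [act, ← comp_whiskerRight_assoc]

lemma act_comm : (actL _ _ (doubleDiff L₀) + actR _ _ K.d) ≫ K.act = P ◁ K.act ≫ K.d := by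
  refine double_hom_ext_right ?_ ?_
  · rw [whiskerLeft_restrict, evenIncl_doubleDiff, ← MonoidalCategory.whiskerLeft_comp_assoc,
      evenIncl_act, K.d_e]
    simp
  · rw [whiskerLeft_restrict, oddIncl_doubleDiff, ← MonoidalCategory.whiskerLeft_comp_assoc,
      oddIncl_act, K.d_i, comp_whiskerRight_assoc, evenIncl_act, add_comm]

/-- The four components are `e_e`, `e_i`, its mirror image and `i_i`. -/
lemma act_bracket : doubleBracket L₀ ▷ K.X ≫ K.act = opComm K.act K.act := by
  -- The odd-even component follows from the even-odd one because both the bracket and the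
  -- commutator are antisymmetric.
  have h10 : (oddIncl L₀ ⊗ₘ evenIncl L₀) ▷ K.X ≫ doubleBracket L₀ ▷ K.X ≫ K.act =
      opComm K.i K.e := by
    rw [← comp_whiskerRight_assoc, oddIncl_evenIncl_bracket, opComm_swap, K.e_i,
      neg_whiskerRight, Preadditive.neg_comp]
    simp
  refine double_hom_ext₂ ?_ ?_ ?_ ?_
  · rw [← comp_whiskerRight_assoc, evenIncl_evenIncl_bracket, opComm_param, evenIncl_act, K.e_e]
    simp
  · rw [← comp_whiskerRight_assoc, evenIncl_oddIncl_bracket, opComm_param, evenIncl_act,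
      oddIncl_act, K.e_i]
    simp
  · rw [h10, opComm_param, evenIncl_act, oddIncl_act]
  · rw [← comp_whiskerRight_assoc, oddIncl_oddIncl_bracket, opComm_param, oddIncl_act, K.i_i]
    simp

/-- The module over `D ⊗ L₀` given by Cartan data. -/
noncomputable def toDoubleMod : DoubleMod L₀ where
  V := K.complex
  act := ⟨K.act, K.act_comm⟩
  act_bracket := LieMod.hom_ext K.act_bracket

@[simp]
lemma toDoubleMod_V : K.toDoubleMod.V = K.complex := rfl

@[simp]
lemma evenAct_toDoubleMod : evenAct L₀ K.toDoubleMod = K.e := K.evenIncl_act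

@[simp]
lemma oddAct_toDoubleMod : oddAct L₀ K.toDoubleMod = K.i := K.oddIncl_act

end CartanData

/-- Morphisms of modules over `D ⊗ L₀` from morphisms commuting with all operators. -/
noncomputable def doubleModHom {X Y : DoubleMod L₀} (f : X.V.V ⟶ Y.V.V)
    (hd : diffAct X ≫ f = P ◁ f ≫ diffAct Y) (he : evenAct L₀ X ≫ f = L₀.X ◁ f ≫ evenAct L₀ Y)
    (hi : oddAct L₀ X ≫ f = (P ⊗ L₀.X) ◁ f ≫ oddAct L₀ Y) : X ⟶ Y where
  hom := ⟨f, hd⟩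
  comm := LieMod.hom_ext (by
    have h : totalAct X ≫ f = _ ◁ f ≫ totalAct Y := by
      refine double_hom_ext ?_ ?_
      · rw [← whisker_exchange_assoc]
        simpa only [evenAct_eq, Category.assoc] using he
      · rw [← whisker_exchange_assoc]
        simpa only [oddAct_eq, Category.assoc] using hi
    exact h)

lemma hom_diffAct {X Y : DoubleMod L₀} (f : X ⟶ Y) :
    diffAct X ≫ f.hom.hom = P ◁ f.hom.hom ≫ diffAct Y :=
  f.hom.comm

section Algebra

variable (X : DoubleMod L₀)

/-- The underlying algebra of an algebra in modules over `D ⊗ L₀`. -/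
@[reducible]
noncomputable def baseMonObj [MonObj X] : MonObj X.V.V :=
  letI := X.underlyingMonObj
  X.V.underlyingMonObj

lemma base_isCommMonObj [MonObj X] [IsCommMonObj X] :
    letI := baseMonObj X
    IsCommMonObj X.V.V :=
  letI := X.underlyingMonObj
  haveI := X.underlying_isCommMonObj
  X.V.underlying_isCommMonObj

lemma isDer_diff [MonObj X] :
    letI := baseMonObj X
    IsDer (𝟙 X.V.V) (diffAct X) :=
  letI := X.underlyingMonObj
  X.V.underlying_isDer

lemma isDer_act [MonObj X] :
    letI := baseMonObj X
    IsDer (𝟙 X.V.V) (totalAct X) :=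
  letI := X.underlyingMonObj
  congrArg LieMod.Hom.hom X.underlying_isDer

lemma isDer_evenAct [MonObj X] :
    letI := baseMonObj X
    IsDer (𝟙 X.V.V) (evenAct L₀ X) :=
  letI := baseMonObj X
  (isDer_act X).param _

lemma isDer_oddAct [MonObj X] :
    letI := baseMonObj X
    IsDer (𝟙 X.V.V) (oddAct L₀ X) :=
  letI := baseMonObj X
  (isDer_act X).param _

lemma base_isMonHom {X Y : DoubleMod L₀} [MonObj X] [MonObj Y] (f : X ⟶ Y) [IsMonHom f] :
    letI := baseMonObj X
    letI := baseMonObj Y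
    IsMonHom f.hom.hom :=
  letI := X.underlyingMonObj
  letI := Y.underlyingMonObj
  haveI := LieMod.underlying_isMonHom f
  LieMod.underlying_isMonHom f.hom

/-- Morphisms of modules which are morphisms of the underlying algebras. -/
lemma isMonHom_of_base {X Y : DoubleMod L₀} [MonObj X] [MonObj Y] (f : X ⟶ Y)
    (h : letI := baseMonObj X
      letI := baseMonObj Y
      IsMonHom f.hom.hom) : IsMonHom f :=
  letI := baseMonObj X
  letI := baseMonObj Y
  ⟨LieMod.hom_ext (LieMod.hom_ext h.one_hom), LieMod.hom_ext (LieMod.hom_ext h.mul_hom)⟩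

namespace CartanData

variable (K : CartanData L₀) [MonObj K.X] (hd : IsDer (𝟙 K.X) K.d) (he : IsDer (𝟙 K.X) K.e)
  (hi : IsDer (𝟙 K.X) K.i)

lemma isDer_act' (he : IsDer (𝟙 K.X) K.e) (hi : IsDer (𝟙 K.X) K.i) : IsDer (𝟙 K.X) K.act :=
  (he.param _).add (hi.param _)

/-- Cartan data on an algebra, acting by derivations, give an algebra in modules over
`D ⊗ L₀`. -/
@[reducible]
noncomputable def monObj : MonObj K.toDoubleMod :=
  letI : MonObj K.complex.V := inferInstanceAs (MonObj K.X)
  letI : MonObj K.toDoubleMod.V := K.complex.monObjOfIsDer hd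
  K.toDoubleMod.monObjOfIsDer (LieMod.hom_ext (K.isDer_act' he hi))

lemma isCommMonObj [IsCommMonObj K.X] :
    letI := K.monObj hd he hi
    IsCommMonObj K.toDoubleMod :=
  letI := K.monObj hd he hi
  ⟨LieMod.hom_ext (LieMod.hom_ext (IsCommMonObj.mul_comm K.X))⟩

end CartanData

end Algebra

end Cartan

end SuperTensor

namespace SuperTensor

open scoped MonObj

/-! ### Testing commutators on generators. -/

section OperatorLemmas

variable {C : Type u} [Category.{v} C] [Preadditive C] [MonoidalCategory C]
  [SymmetricCategory C] [MonoidalPreadditive C]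

lemma opComm_eq {T T' M : C} (a : T ⊗ M ⟶ M) (a' : T' ⊗ M ⟶ M) :
    opComm a a' = (α_ _ _ _).hom ≫ (T ◁ a' ≫ a - actR T' M a ≫ a') := by
  simp [opComm, opComp, actR_eq, sw, Preadditive.comp_sub]

lemma opComm_eq_iff {T T' M : C} {a : T ⊗ M ⟶ M} {a' : T' ⊗ M ⟶ M} {c : (T ⊗ T') ⊗ M ⟶ M} :
    opComm a a' = c ↔ T ◁ a' ≫ a - actR T' M a ≫ a' = (α_ _ _ _).inv ≫ c := by
  rw [opComm_eq, Iso.eq_inv_comp]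

/-- The hypothesis involves the operators restricted to `V` only through their values, so known
values on generators can be substituted before composing. -/
lemma whiskerLeft_opComm {T T' M V : C} (j : V ⟶ M) {a : T ⊗ M ⟶ M} {a' : T' ⊗ M ⟶ M}
    {c : (T ⊗ T') ⊗ M ⟶ M}
    (h : T ◁ (T' ◁ j ≫ a') ≫ a - sw T T' V ≫ T' ◁ (T ◁ j ≫ a) ≫ a' =
      (α_ _ _ _).inv ≫ (T ⊗ T') ◁ j ≫ c) : (T ⊗ T') ◁ j ≫ opComm a a' = (T ⊗ T') ◁ j ≫ c := by
  rw [opComm_eq, associator_naturality_right_assoc, ← cancel_epi (α_ _ _ _).inv, ← h, actR_eq,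
    Preadditive.comp_sub]
  simp only [MonoidalCategory.whiskerLeft_comp, Category.assoc, Iso.inv_hom_id_assoc]
  rw [reassoc_of% sw_nat₃]

lemma biprod_hom_ext_right [HasBinaryBiproducts C] {T U V Y : C} {f g : T ⊗ (U ⊞ V) ⟶ Y}
    (h₁ : T ◁ biprod.inl ≫ f = T ◁ biprod.inl ≫ g)
    (h₂ : T ◁ biprod.inr ≫ f = T ◁ biprod.inr ≫ g) : f = g := by
  have e (f : T ⊗ (U ⊞ V) ⟶ Y) : f = T ◁ biprod.fst ≫ T ◁ biprod.inl ≫ f +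
      T ◁ biprod.snd ≫ T ◁ biprod.inr ≫ f := by
    conv_lhs => rw [← Category.id_comp f, ← MonoidalCategory.whiskerLeft_id, ← biprod.total,
      MonoidalPreadditive.whiskerLeft_add, Preadditive.add_comp]
    simp
  rw [e f, e g, h₁, h₂]

/-- The action on a module, as a morphism of modules. -/
def LieMod.actHom {L : LieAlg C} (M : LieMod L) : L.adjoint ⊗ M ⟶ M where
  hom := M.act
  comm := by
    have h : (actL L.X M.V L.bracket + actR L.X M.V M.act) ≫ M.act = L.X ◁ M.act ≫ M.act := by
      rw [Preadditive.add_comp, actL, Category.assoc, M.act_bracket, Preadditive.comp_sub, actR_eq]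
      simp [sw]
    exact h

end OperatorLemmas

/-! ### The odd line and the coadjoint action. -/

section Coadjoint

variable {S : Type u} [Category.{v} S] [Abelian S] [Linear ℚ S] [MonoidalCategory S]
  [SymmetricCategory S] [MonoidalPreadditive S] [Supercategory S]

open Supercategory (P)

lemma sw_P_P (X : S) : sw P P X = -𝟙 _ := by
  simp [sw, braiding_P, neg_whiskerRight]

/-- In P ⊗ P ⊗ P ⊗ X it does not matter which adjacent pair of P's is contracted: this is the
triangle identity `whiskerLeft_oddPairing`. -/
lemma whiskerLeft_oddContr (X : S) : P ◁ oddContr X = oddContr (P ⊗ X) := by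
  have h := (α_ _ _ _).inv ≫= whiskerLeft_oddPairing (S := S)
  rw [Iso.inv_hom_id_assoc] at h
  have h2 := (P ◁ (α_ P P X).inv ≫ (α_ P (P ⊗ P) X).inv) ≫= congrArg (· ▷ X) h
  simp only [comp_whiskerRight, Category.assoc] at h2
  calc _ = P ◁ (α_ P P X).inv ≫ (α_ P (P ⊗ P) X).inv ≫ (P ◁ oddPairing.hom) ▷ X ≫
      (ρ_ P).hom ▷ X := by simp [oddContr]
    _ = _ := by rw [h2]; simp [oddContr]

lemma sw_oddContr (X Y : S) : sw P X (P ⊗ Y) ≫ X ◁ oddContr Y =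
    P ◁ sw X P Y ≫ oddContr (X ⊗ Y) := by
  have h := sw_nat₁ (oddPairing (S := S)).hom X Y
  rw [sw_tensor_left, sw_unit_left] at h
  have h2 := (P ◁ sw X P Y ≫ (α_ _ _ _).inv) ≫= (h =≫ X ◁ (λ_ Y).hom)
  simp only [Category.assoc, Iso.inv_hom_id_assoc] at h2
  rw [← MonoidalCategory.whiskerLeft_comp_assoc P (sw X P Y), sw_sw,
    MonoidalCategory.whiskerLeft_id, Category.id_comp] at h2
  simp only [oddContr, MonoidalCategory.whiskerLeft_comp]
  rw [← h2, ← MonoidalCategory.whiskerLeft_comp]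
  simp

lemma oddContr_tensor (X Y : S) : P ◁ (α_ P X Y).hom ≫ oddContr (X ⊗ Y) =
    (α_ _ _ _).inv ≫ oddContr X ▷ Y := by
  simp [oddContr]

/-- The sign comes from exchanging two copies of P. It is what turns the minus sign of the graded
commutator of d and a contraction into the action of L₀. -/
lemma sw_oddContr_odd (X Y : S) : sw P (P ⊗ X) (P ⊗ Y) ≫ (P ⊗ X) ◁ oddContr Y ≫ (α_ P X Y).hom =
    -((α_ _ _ _).inv ≫ oddContr X ▷ (P ⊗ Y) ≫ sw X P Y) := by
  have h : (P ⊗ X) ◁ oddContr Y ≫ (α_ P X Y).hom = (α_ _ _ _).hom ≫ P ◁ X ◁ oddContr Y := by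
    simp
  have h2 : P ◁ (α_ P X (P ⊗ Y)).hom ≫ P ◁ P ◁ sw X P Y ≫ P ◁ oddContr (X ⊗ Y) =
      (α_ _ _ _).inv ≫ oddContr X ▷ (P ⊗ Y) ≫ sw X P Y := by
    rw [whiskerLeft_oddContr, oddContr_naturality, reassoc_of% oddContr_tensor]
  rw [h, sw_tensor_mid, sw_P_P, ← h2, ← MonoidalCategory.whiskerLeft_comp P (P ◁ _),
    ← sw_oddContr]
  simp

variable (L₀ : LieAlg S) [HasRightDual L₀.X]

/-- The coadjoint action on the dual object. -/
noncomputable def coad : L₀.X ⊗ (L₀.X)ᘁ ⟶ (L₀.X)ᘁ := L₀.coadjoint.act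

/-- The evaluation pairing. -/
noncomputable def coadEv : L₀.X ⊗ (L₀.X)ᘁ ⟶ 𝟙_ S := (β_ _ _).hom ≫ ε_ L₀.X (L₀.X)ᘁ

lemma oddEvaluation_eq : oddEvaluation L₀ = (α_ _ _ _).hom ≫ P ◁ sw L₀.X P (L₀.X)ᘁ ≫
    oddContr _ ≫ coadEv L₀ := by
  rw [oddEvaluation, tensorμ_eq, MonoidalCategory.tensorHom_def]
  simp [oddContr, coadEv]

lemma coadEv_invariant : (actL _ _ L₀.bracket + actR _ _ (coad L₀)) ≫ coadEv L₀ = 0 := by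
  have h := dualAct_evaluation L₀.bracket (L₀.X)ᘁ
  rw [coadEv, ← Category.assoc, braiding_comm, Category.assoc, Preadditive.add_comp]
  exact (congrArg (L₀.X ◁ _ ≫ ·) (add_eq_zero_iff_eq_neg.2 h)).trans comp_zero

/-- The evaluation pairing as a morphism of modules. -/
noncomputable def coadEvHom : L₀.adjoint ⊗ L₀.coadjoint ⟶ 𝟙_ (LieMod L₀) :=
  ⟨coadEv L₀, (coadEv_invariant L₀).trans comp_zero.symm⟩

/-- The contraction `P L₀ ⊗ L₀* ⟶ P L₀*`. -/
noncomputable def oddCoad : (P ⊗ L₀.X) ⊗ (L₀.X)ᘁ ⟶ P ⊗ (L₀.X)ᘁ :=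
  (α_ _ _ _).hom ≫ P ◁ coad L₀

/-- The action of `L₀` on `P L₀*`. -/
noncomputable def coadOdd : L₀.X ⊗ (P ⊗ (L₀.X)ᘁ) ⟶ P ⊗ (L₀.X)ᘁ := actR P _ (coad L₀)

lemma coad_bracket : L₀.bracket ▷ _ ≫ coad L₀ =
    (α_ _ _ _).hom ≫ L₀.X ◁ coad L₀ ≫ coad L₀ -
      (β_ _ _).hom ▷ _ ≫ (α_ _ _ _).hom ≫ L₀.X ◁ coad L₀ ≫ coad L₀ :=
  L₀.coadjoint.act_bracket

lemma coadOdd_bracket : L₀.bracket ▷ _ ≫ coadOdd L₀ =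
    (α_ _ _ _).hom ≫ L₀.X ◁ coadOdd L₀ ≫ coadOdd L₀ -
      (β_ _ _).hom ▷ _ ≫ (α_ _ _ _).hom ≫ L₀.X ◁ coadOdd L₀ ≫ coadOdd L₀ :=
  bracket_actR P (coad_bracket L₀)

lemma oddEvaluation_invariant :
    (actL _ _ (actR P L₀.X L₀.bracket) + actR _ _ (coadOdd L₀)) ≫ oddEvaluation L₀ = 0 := by
  let Q := (trivialExt L₀).obj (P : S)
  have h0 : (actL P P (0 : L₀.X ⊗ P ⟶ P) + actR P P 0) ≫ oddPairing.hom =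
    -- With P regarded as a trivial L₀-module, the odd evaluation is a composite of module
    -- morphisms, and its invariance is the compatibility of that composite with the actions.
    L₀.X ◁ oddPairing.hom ≫ 0 := leibniz_zero _
  let p : Q ⊗ Q ⟶ 𝟙_ _ := ⟨oddPairing.hom, h0⟩
  have h := (tensorμ Q L₀.adjoint Q L₀.coadjoint ≫ (p ⊗ₘ coadEvHom L₀) ≫ (λ_ _).hom).comm
  have e1 : (Q ⊗ L₀.adjoint).act = actR P L₀.X L₀.bracket := by
    have : actL P L₀.X (0 : L₀.X ⊗ P ⟶ P) + actR P L₀.X L₀.bracket = actR P L₀.X L₀.bracket := by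
      rw [actL_zero, zero_add]
    exact this
  have e2 : (Q ⊗ L₀.coadjoint).act = coadOdd L₀ := by
    have : actL P (L₀.X)ᘁ (0 : L₀.X ⊗ P ⟶ P) + actR P (L₀.X)ᘁ (coad L₀) = coadOdd L₀ := by
      rw [actL_zero, zero_add, coadOdd]
    exact this
  have h' : (actL (Q ⊗ L₀.adjoint).V (Q ⊗ L₀.coadjoint).V (Q ⊗ L₀.adjoint).act +
    actR (Q ⊗ L₀.adjoint).V (Q ⊗ L₀.coadjoint).V (Q ⊗ L₀.coadjoint).act) ≫ _ = _ := h
  rw [e1, e2] at h'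
  exact h'.trans comp_zero

lemma oddCoad_equivariant :
    (actL _ _ (actR P L₀.X L₀.bracket) + actR _ _ (coad L₀)) ≫ oddCoad L₀ =
      L₀.X ◁ oddCoad L₀ ≫ coadOdd L₀ := by
  let Q := (trivialExt L₀).obj (P : S)
  have h := ((α_ Q L₀.adjoint L₀.coadjoint).hom ≫ Q ◁ L₀.coadjoint.actHom).comm
  have e1 : (Q ⊗ L₀.adjoint).act = actR P L₀.X L₀.bracket := by
    have : actL P L₀.X (0 : L₀.X ⊗ P ⟶ P) + actR P L₀.X L₀.bracket = actR P L₀.X L₀.bracket := by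
      rw [actL_zero, zero_add]
    exact this
  have e2 : (Q ⊗ L₀.coadjoint).act = coadOdd L₀ := by
    have : actL P (L₀.X)ᘁ (0 : L₀.X ⊗ P ⟶ P) + actR P (L₀.X)ᘁ (coad L₀) = coadOdd L₀ := by
      rw [actL_zero, zero_add, coadOdd]
    exact this
  rw [e2] at h
  have h' : (actL (Q ⊗ L₀.adjoint).V L₀.coadjoint.V (Q ⊗ L₀.adjoint).act +
    actR (Q ⊗ L₀.adjoint).V L₀.coadjoint.V L₀.coadjoint.act) ≫ _ = _ := h
  rw [e1] at h'
  exact h'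

/-- ⟨x, y·φ⟩ = ⟨[x, y], φ⟩: invariance of the pairing together with antisymmetry of the bracket. -/
lemma coad_coadEv : L₀.X ◁ coad L₀ ≫ coadEv L₀ = (α_ _ _ _).inv ≫ L₀.bracket ▷ _ ≫ coadEv L₀ := by
  have h := coadEv_invariant L₀
  rw [Preadditive.add_comp, actL, actR_eq, Category.assoc, Category.assoc,
    add_eq_zero_iff_neg_eq] at h
  have h2 := sw _ _ _ ≫= h
  rw [sw_sw_assoc] at h2
  rw [← h2, sw]
  simp only [Preadditive.comp_neg, Category.assoc, Iso.hom_inv_id_assoc]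
  rw [← comp_whiskerRight_assoc, L₀.antisymm]
  simp [neg_whiskerRight]

lemma oddCoad_oddEvaluation : (α_ _ _ _).hom ≫ (P ⊗ L₀.X) ◁ oddCoad L₀ ≫ oddEvaluation L₀ =
    (tensorμ P L₀.X P L₀.X ≫ (oddPairing.hom ⊗ₘ L₀.bracket) ≫ (λ_ _).hom) ▷ _ ≫ coadEv L₀ := by
  have h : (α_ _ _ _).hom ≫ (P ⊗ L₀.X) ◁ oddCoad L₀ ≫ oddEvaluation L₀ =
    (tensorμ P L₀.X P L₀.X ≫ (oddPairing.hom ⊗ₘ 𝟙 _) ≫ (λ_ _).hom) ▷ _ ≫ (α_ _ _ _).hom ≫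
      L₀.X ◁ coad L₀ ≫ coadEv L₀ := by
    have e : (α_ (P ⊗ L₀.X) (P ⊗ L₀.X) (L₀.X)ᘁ).hom ≫ (P ⊗ L₀.X) ◁ (α_ _ _ _).hom ≫
        (α_ _ _ _).hom ≫ P ◁ sw L₀.X P (L₀.X ⊗ (L₀.X)ᘁ) ≫ oddContr _ =
        (tensorμ P L₀.X P L₀.X ≫ (oddPairing.hom ⊗ₘ 𝟙 _) ≫ (λ_ _).hom) ▷ _ ≫
          (α_ _ _ _).hom := by
      rw [tensorμ_eq, sw, sw, oddContr, tensorHom_id]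
      monoidal
    have e2 : (P ⊗ L₀.X) ◁ P ◁ coad L₀ ≫ (α_ _ _ _).hom ≫ P ◁ sw L₀.X P (L₀.X)ᘁ ≫ oddContr _ =
        (α_ _ _ _).hom ≫ P ◁ sw L₀.X P _ ≫ oddContr _ ≫ L₀.X ◁ coad L₀ := by
      rw [associator_naturality_right_assoc, ← MonoidalCategory.whiskerLeft_comp_assoc P (L₀.X ◁ _),
        sw_nat₃, MonoidalCategory.whiskerLeft_comp_assoc, oddContr_naturality]
    rw [← reassoc_of% e, oddCoad, oddEvaluation_eq, MonoidalCategory.whiskerLeft_comp_assoc,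
      reassoc_of% e2]
  have h2 : (oddPairing.hom ⊗ₘ L₀.bracket) ≫ (λ_ _).hom =
      (oddPairing.hom ⊗ₘ 𝟙 _) ≫ (λ_ _).hom ≫ L₀.bracket := by
    simp [MonoidalCategory.tensorHom_def]
  rw [h, coad_coadEv, Iso.hom_inv_id_assoc, ← comp_whiskerRight_assoc, h2]
  simp only [Category.assoc]

/-- Two odd contractions applied to dθ give the bracket of the L₀ parts; the sign of the bracket and
the sign of P ⊗ P cancel. This yields both the commutation of contractions on dθ and the symmetry of
the quadratic form q. -/
lemma sw_oddCoad_oddEvaluation : sw _ _ _ ≫ (P ⊗ L₀.X) ◁ oddCoad L₀ ≫ oddEvaluation L₀ =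
    (P ⊗ L₀.X) ◁ oddCoad L₀ ≫ oddEvaluation L₀ := by
  rw [← cancel_epi (α_ _ _ _).hom, sw, Category.assoc, Category.assoc, Iso.hom_inv_id_assoc,
    oddCoad_oddEvaluation, ← comp_whiskerRight_assoc, reassoc_of% braiding_tensorμ,
    tensorHom_comp_tensorHom_assoc, L₀.antisymm, braiding_P]
  have e : ((-𝟙 (P ⊗ P)) ≫ oddPairing.hom ⊗ₘ -L₀.bracket) = (oddPairing.hom ⊗ₘ L₀.bracket) := by
    simp [MonoidalCategory.tensorHom_def, whiskerLeft_neg, neg_whiskerRight]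
  rw [e]

end Coadjoint

end SuperTensor

namespace SuperTensor

open scoped MonObj

/-! ### Symmetric algebras on two kinds of generators. -/

section SymDataBiprod

variable {C : Type u} [Category.{v} C] [Preadditive C] [MonoidalCategory C]
  [SymmetricCategory C] [MonoidalPreadditive C] [HasBinaryBiproducts C]

namespace SymData

variable {U V T B : C} (D : SymData (U ⊞ V))

/-- The generators from the first summand. -/
noncomputable def genL : U ⟶ D.A := biprod.inl ≫ D.gen

/-- The generators from the second summand. -/
noncomputable def genR : V ⟶ D.A := biprod.inr ≫ D.gen

/-- The derivation with given values on both kinds of generators. -/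
noncomputable def der₂ (a : T ⊗ U ⟶ D.A) (b : T ⊗ V ⟶ D.A) : T ⊗ D.A ⟶ D.A :=
  D.der (T ◁ biprod.fst ≫ a + T ◁ biprod.snd ≫ b)

lemma isDer_der₂ (a : T ⊗ U ⟶ D.A) (b : T ⊗ V ⟶ D.A) : IsDer (𝟙 D.A) (D.der₂ a b) :=
  D.isDer_der _

lemma genL_der₂ (a : T ⊗ U ⟶ D.A) (b : T ⊗ V ⟶ D.A) : T ◁ D.genL ≫ D.der₂ a b = a := by
  rw [genL, der₂, MonoidalCategory.whiskerLeft_comp_assoc, gen_der]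
  simp [← MonoidalCategory.whiskerLeft_comp_assoc]

lemma genR_der₂ (a : T ⊗ U ⟶ D.A) (b : T ⊗ V ⟶ D.A) : T ◁ D.genR ≫ D.der₂ a b = b := by
  rw [genR, der₂, MonoidalCategory.whiskerLeft_comp_assoc, gen_der]
  simp [← MonoidalCategory.whiskerLeft_comp_assoc]

lemma der₂_ext [MonObj B] {f : D.A ⟶ B} [IsMonHom f] {δ δ' : T ⊗ D.A ⟶ B} (h : IsDer f δ)
    (h' : IsDer f δ') (h₁ : T ◁ D.genL ≫ δ = T ◁ D.genL ≫ δ')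
    (h₂ : T ◁ D.genR ≫ δ = T ◁ D.genR ≫ δ') : δ = δ' := by
  refine D.der_ext h h' (biprod_hom_ext_right ?_ ?_)
  · simpa only [genL, MonoidalCategory.whiskerLeft_comp, Category.assoc] using h₁
  · simpa only [genR, MonoidalCategory.whiskerLeft_comp, Category.assoc] using h₂

lemma algHom₂_ext [MonObj B] {f f' : D.A ⟶ B} [IsMonHom f] [IsMonHom f']
    (h₁ : D.genL ≫ f = D.genL ≫ f') (h₂ : D.genR ≫ f = D.genR ≫ f') : f = f' := by
  refine D.algHom_ext (biprod.hom_ext' _ _ ?_ ?_)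
  · simpa only [genL, Category.assoc] using h₁
  · simpa only [genR, Category.assoc] using h₂

/-- The algebra morphism with given values on both kinds of generators. -/
noncomputable def lift₂ [MonObj B] [IsCommMonObj B] (a : U ⟶ B) (b : V ⟶ B) : D.A ⟶ B :=
  D.lift (biprod.desc a b)

instance [MonObj B] [IsCommMonObj B] (a : U ⟶ B) (b : V ⟶ B) : IsMonHom (D.lift₂ a b) :=
  inferInstanceAs (IsMonHom (D.lift _))

lemma genL_lift₂ [MonObj B] [IsCommMonObj B] (a : U ⟶ B) (b : V ⟶ B) :
    D.genL ≫ D.lift₂ a b = a := by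
  simp [genL, lift₂]

lemma genR_lift₂ [MonObj B] [IsCommMonObj B] (a : U ⟶ B) (b : V ⟶ B) :
    D.genR ≫ D.lift₂ a b = b := by
  simp [genR, lift₂]

lemma der₂_comm {T' : C} {δ : T ⊗ D.A ⟶ D.A} {δ' : T' ⊗ D.A ⟶ D.A} {c : (T ⊗ T') ⊗ D.A ⟶ D.A}
    (h : IsDer (𝟙 _) δ) (h' : IsDer (𝟙 _) δ') (hc : IsDer (𝟙 _) c)
    (h₁ : T ◁ (T' ◁ D.genL ≫ δ') ≫ δ - sw T T' U ≫ T' ◁ (T ◁ D.genL ≫ δ) ≫ δ' =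
      (α_ _ _ _).inv ≫ (T ⊗ T') ◁ D.genL ≫ c)
    (h₂ : T ◁ (T' ◁ D.genR ≫ δ') ≫ δ - sw T T' V ≫ T' ◁ (T ◁ D.genR ≫ δ) ≫ δ' =
      (α_ _ _ _).inv ≫ (T ⊗ T') ◁ D.genR ≫ c) : opComm δ δ' = c :=
  D.der₂_ext (h.opComm h') hc (whiskerLeft_opComm _ h₁) (whiskerLeft_opComm _ h₂)

end SymData

end SymDataBiprod

/-! ### The Weil algebra and its Cartan relations. -/

section Weil

variable {S : Type u} [Category.{v} S] [Abelian S] [Linear ℚ S] [MonoidalCategory S]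
  [SymmetricCategory S] [MonoidalPreadditive S] [Supercategory S]

open Supercategory (P)

variable (L₀ : LieAlg S) [HasRightDual L₀.X] (D : SymData (((P : S) ⊗ (L₀.X)ᘁ) ⊞ (L₀.X)ᘁ))

/-- The differential on the Weil algebra. -/
noncomputable def weilD : P ⊗ D.A ⟶ D.A := D.der₂ (oddContr _ ≫ D.genR) 0

/-- The action of `L₀` on the Weil algebra. -/
noncomputable def weilE : L₀.X ⊗ D.A ⟶ D.A := D.der₂ (coadOdd L₀ ≫ D.genL) (coad L₀ ≫ D.genR)

/-- The contractions on the Weil algebra. -/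
noncomputable def weilI : (P ⊗ L₀.X) ⊗ D.A ⟶ D.A :=
  D.der₂ (oddEvaluation L₀ ≫ η[D.A]) (oddCoad L₀ ≫ D.genL)

lemma genL_weilD : P ◁ D.genL ≫ weilD L₀ D = oddContr _ ≫ D.genR := D.genL_der₂ _ _

lemma genR_weilD : P ◁ D.genR ≫ weilD L₀ D = 0 := D.genR_der₂ _ _

lemma genL_weilE : L₀.X ◁ D.genL ≫ weilE L₀ D = coadOdd L₀ ≫ D.genL := D.genL_der₂ _ _

lemma genR_weilE : L₀.X ◁ D.genR ≫ weilE L₀ D = coad L₀ ≫ D.genR := D.genR_der₂ _ _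

lemma genL_weilI : (P ⊗ L₀.X) ◁ D.genL ≫ weilI L₀ D = oddEvaluation L₀ ≫ η[D.A] :=
  D.genL_der₂ _ _

lemma genR_weilI : (P ⊗ L₀.X) ◁ D.genR ≫ weilI L₀ D = oddCoad L₀ ≫ D.genL := D.genR_der₂ _ _

lemma isDer_weilD : IsDer (𝟙 D.A) (weilD L₀ D) := D.isDer_der₂ _ _

lemma isDer_weilE : IsDer (𝟙 D.A) (weilE L₀ D) := D.isDer_der₂ _ _

lemma isDer_weilI : IsDer (𝟙 D.A) (weilI L₀ D) := D.isDer_der₂ _ _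

/-- The square of d need not be a derivation a priori, but its graded self-commutator is. It
vanishes on generators, and since d is odd it equals 2d². -/
lemma weilD_weilD : P ◁ weilD L₀ D ≫ weilD L₀ D = 0 := by
  have h : opComm (weilD L₀ D) (weilD L₀ D) = 0 := by
    refine D.der₂_comm (isDer_weilD L₀ D) (isDer_weilD L₀ D) (IsDer.zero _) ?_ ?_
    · rw [genL_weilD, MonoidalCategory.whiskerLeft_comp_assoc, genR_weilD]
      simp
    · simp [genR_weilD]
  refine odd_sq_zero (weilD L₀ D) ?_
  rw [opComm, opComp] at h
  rw [h]
  simp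

lemma weilE_weilD : P ◁ weilE L₀ D ≫ weilD L₀ D =
    actR L₀.X D.A (weilD L₀ D) ≫ weilE L₀ D := by
  have h : opComm (weilD L₀ D) (weilE L₀ D) = 0 := by
    refine D.der₂_comm (isDer_weilD L₀ D) (isDer_weilE L₀ D) (IsDer.zero _) ?_ ?_
    · rw [genL_weilD, genL_weilE, MonoidalCategory.whiskerLeft_comp_assoc, genL_weilD,
        MonoidalCategory.whiskerLeft_comp_assoc, genR_weilE, reassoc_of% sw_oddContr, coadOdd,
        actR_eq, MonoidalCategory.whiskerLeft_comp_assoc, reassoc_of% oddContr_naturality]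
      simp
    · rw [genR_weilD, genR_weilE, MonoidalCategory.whiskerLeft_comp_assoc, genR_weilD]
      simp
  rw [opComm_eq_iff, comp_zero] at h
  exact sub_eq_zero.1 h

/-- On θ the contraction is constant, so only the contraction of dθ contributes; on dθ only d of its
contraction does. Both give the coadjoint action, the first with the sign of `sw_oddContr_odd`. -/
lemma weilI_weilD : P ◁ weilI L₀ D ≫ weilD L₀ D =
    actR (P ⊗ L₀.X) D.A (weilD L₀ D) ≫ weilI L₀ D +
      (α_ _ _ _).inv ≫ oddContr L₀.X ▷ D.A ≫ weilE L₀ D := by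
  have h : opComm (weilD L₀ D) (weilI L₀ D) = oddContr L₀.X ▷ D.A ≫ weilE L₀ D := by
    refine D.der₂_comm (isDer_weilD L₀ D) (isDer_weilI L₀ D) ((isDer_weilE L₀ D).param _) ?_ ?_
    · have h0 := sw_oddContr_odd L₀.X (L₀.X)ᘁ =≫ P ◁ coad L₀
      rw [genL_weilD, genL_weilI, MonoidalCategory.whiskerLeft_comp_assoc,
        (isDer_weilD L₀ D).one, MonoidalCategory.whiskerLeft_comp_assoc, genR_weilI,
        whisker_exchange_assoc, genL_weilE, oddCoad, coadOdd, actR_eq]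
      simp only [Category.assoc, Preadditive.neg_comp] at h0 ⊢
      rw [reassoc_of% h0]
      simp
    · rw [genR_weilD, genR_weilI, MonoidalCategory.whiskerLeft_comp_assoc, genL_weilD,
        whisker_exchange_assoc, genR_weilE, oddCoad, MonoidalCategory.whiskerLeft_comp_assoc,
        reassoc_of% oddContr_naturality, reassoc_of% oddContr_tensor]
      simp
  rw [opComm_eq_iff] at h
  rw [← h]
  abel

lemma weilE_weilE : opComm (weilE L₀ D) (weilE L₀ D) = L₀.bracket ▷ D.A ≫ weilE L₀ D := by
  refine D.der₂_comm (isDer_weilE L₀ D) (isDer_weilE L₀ D) ((isDer_weilE L₀ D).param _) ?_ ?_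
  · rw [whisker_exchange_assoc, genL_weilE, reassoc_of% coadOdd_bracket,
      MonoidalCategory.whiskerLeft_comp_assoc, genL_weilE]
    simp [Preadditive.sub_comp, Preadditive.comp_sub, sw]
  · rw [whisker_exchange_assoc, genR_weilE, reassoc_of% coad_bracket,
      MonoidalCategory.whiskerLeft_comp_assoc, genR_weilE]
    simp [Preadditive.sub_comp, Preadditive.comp_sub, sw]

/-- On θ this is invariance of the odd evaluation, on dθ equivariance of `oddCoad`. -/
lemma weilE_weilI : opComm (weilE L₀ D) (weilI L₀ D) =
    actR P L₀.X L₀.bracket ▷ D.A ≫ weilI L₀ D := by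
  refine D.der₂_comm (isDer_weilE L₀ D) (isDer_weilI L₀ D) ((isDer_weilI L₀ D).param _) ?_ ?_
  · have h := oddEvaluation_invariant L₀
    rw [Preadditive.add_comp, actL, actR_eq (M := P ⊗ L₀.X), Category.assoc, Category.assoc] at h
    replace h := eq_neg_of_add_eq_zero_left h
    rw [genL_weilE, genL_weilI, whisker_exchange_assoc, genL_weilI,
      MonoidalCategory.whiskerLeft_comp_assoc, (isDer_weilE L₀ D).one,
      MonoidalCategory.whiskerLeft_comp_assoc, genL_weilI, reassoc_of% h]
    simp
  · have h := oddCoad_equivariant L₀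
    rw [Preadditive.add_comp, actL, actR_eq (M := P ⊗ L₀.X), Category.assoc, Category.assoc] at h
    replace h := eq_sub_of_add_eq h
    rw [genR_weilE, genR_weilI, whisker_exchange_assoc, genR_weilI,
      MonoidalCategory.whiskerLeft_comp_assoc, genL_weilE,
      MonoidalCategory.whiskerLeft_comp_assoc, genR_weilI, reassoc_of% h]
    simp [Preadditive.sub_comp]

lemma weilI_weilI : opComm (weilI L₀ D) (weilI L₀ D) = 0 := by
  refine D.der₂_comm (isDer_weilI L₀ D) (isDer_weilI L₀ D) (IsDer.zero _) ?_ ?_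
  · rw [genL_weilI, MonoidalCategory.whiskerLeft_comp_assoc, (isDer_weilI L₀ D).one]
    simp
  · rw [genR_weilI, MonoidalCategory.whiskerLeft_comp_assoc, genL_weilI,
      reassoc_of% sw_oddCoad_oddEvaluation]
    simp

/-- The Cartan data of the Weil algebra. -/
noncomputable def weilData : CartanData L₀ where
  X := D.A
  d := weilD L₀ D
  e := weilE L₀ D
  i := weilI L₀ D
  d_d := weilD_weilD L₀ D
  d_e := weilE_weilD L₀ D
  d_i := weilI_weilD L₀ D
  e_e := weilE_weilE L₀ D
  e_i := weilE_weilI L₀ D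
  i_i := weilI_weilI L₀ D

end Weil

end SuperTensor

namespace SuperTensor

open scoped MonObj

/-! ### The Weil algebra represents connections. -/

section Weil

variable {S : Type u} [Category.{v} S] [Abelian S] [Linear ℚ S] [MonoidalCategory S]
  [SymmetricCategory S] [MonoidalPreadditive S] [Supercategory S]

open Supercategory (P)

variable (L₀ : LieAlg S) [HasRightDual L₀.X] (D : SymData (((P : S) ⊗ (L₀.X)ᘁ) ⊞ (L₀.X)ᘁ))

/-- The Weil algebra, as a module over `D ⊗ L₀` in supercomplexes. -/
noncomputable def weilMod : DoubleMod L₀ := (weilData L₀ D).toDoubleMod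

noncomputable instance : MonObj (weilData L₀ D).X := inferInstanceAs (MonObj D.A)

instance : IsCommMonObj (weilData L₀ D).X := inferInstanceAs (IsCommMonObj D.A)

noncomputable instance : MonObj (weilMod L₀ D) :=
  (weilData L₀ D).monObj (isDer_weilD L₀ D) (isDer_weilE L₀ D) (isDer_weilI L₀ D)

instance : IsCommMonObj (weilMod L₀ D) :=
  have hd : IsDer (𝟙 (weilData L₀ D).X) (weilData L₀ D).d := isDer_weilD L₀ D
  have he : IsDer (𝟙 (weilData L₀ D).X) (weilData L₀ D).e := isDer_weilE L₀ D
  have hi : IsDer (𝟙 (weilData L₀ D).X) (weilData L₀ D).i := isDer_weilI L₀ D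
  (weilData L₀ D).isCommMonObj hd he hi

lemma evenAct_weilMod : evenAct L₀ (weilMod L₀ D) = weilE L₀ D :=
  (weilData L₀ D).evenAct_toDoubleMod

lemma oddAct_weilMod : oddAct L₀ (weilMod L₀ D) = weilI L₀ D :=
  (weilData L₀ D).oddAct_toDoubleMod

/-- The tautological connection on the Weil algebra. -/
lemma isConnection_genL : IsConnection L₀ η[weilMod L₀ D] D.genL where
  equivariant := by
    rw [evenAct_weilMod]
    exact genL_weilE L₀ D
  contraction := by
    rw [oddAct_weilMod]
    exact genL_weilI L₀ D

variable {L₀}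

/-- The curvature-type generator associated to an odd morphism from the dual. -/
noncomputable def diffGen {X : DoubleMod L₀} (θ : P ⊗ (L₀.X)ᘁ ⟶ X.V.V) : (L₀.X)ᘁ ⟶ X.V.V :=
  oddExp _ ≫ P ◁ θ ≫ diffAct X

lemma diffGen_diffAct {X : DoubleMod L₀} (θ : P ⊗ (L₀.X)ᘁ ⟶ X.V.V) :
    P ◁ diffGen θ ≫ diffAct X = 0 := by
  simp only [diffGen, MonoidalCategory.whiskerLeft_comp, Category.assoc, diffAct_diffAct,
    comp_zero]

/-- The action of L₀ commutes with d, so dθ is equivariant when θ is. -/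
lemma diffGen_evenAct {X : DoubleMod L₀} {θ : P ⊗ (L₀.X)ᘁ ⟶ X.V.V}
    (h : L₀.X ◁ θ ≫ evenAct L₀ X = coadOdd L₀ ≫ θ) :
    L₀.X ◁ diffGen θ ≫ evenAct L₀ X = coad L₀ ≫ diffGen θ := by
  have h1 : L₀.X ◁ diffAct X ≫ evenAct L₀ X = sw _ _ _ ≫ P ◁ evenAct L₀ X ≫ diffAct X := by
    rw [evenAct_diff, actR_eq, Category.assoc, sw_sw_assoc]
  -- Precomposing with these isomorphisms removes the expansion L₀* ≅ P ⊗ P ⊗ L₀* in the definition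
  -- of `diffGen`.
  rw [← cancel_epi (L₀.X ◁ oddContr _), ← cancel_epi (sw P L₀.X _),
    ← MonoidalCategory.whiskerLeft_comp_assoc, diffGen, ← Category.assoc (oddContr _),
    oddContr_oddExp, Category.id_comp, MonoidalCategory.whiskerLeft_comp_assoc, h1,
    reassoc_of% sw_nat₃, sw_sw_assoc, ← MonoidalCategory.whiskerLeft_comp_assoc, h,
    reassoc_of% sw_oddContr, ← reassoc_of% oddContr_naturality, ← Category.assoc (oddContr _),
    oddContr_oddExp, Category.id_comp, coadOdd, actR_eq]
  simp

/-- By Cartan's relation the contraction of dθ is, up to sign, the action of L₀ on θ minus d of the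
contraction of θ. The latter vanishes because the contraction of a connection is a multiple of the
closed element `u`. -/
lemma diffGen_oddAct {X : DoubleMod L₀} {u : 𝟙_ (DoubleMod L₀) ⟶ X} {θ : P ⊗ (L₀.X)ᘁ ⟶ X.V.V}
    (h : IsConnection L₀ u θ) :
    (P ⊗ L₀.X) ◁ diffGen θ ≫ oddAct L₀ X = oddCoad L₀ ≫ θ := by
  have h3 : ∀ g : 𝟙_ S ⟶ X.V.V, P ◁ g ≫ diffAct X = 0 →
      (P ⊗ L₀.X) ◁ θ ≫ oddAct L₀ X = oddEvaluation L₀ ≫ g →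
      P ◁ ((P ⊗ L₀.X) ◁ θ ≫ oddAct L₀ X) ≫ diffAct X = 0 := fun g h0 hg => by
    rw [hg, MonoidalCategory.whiskerLeft_comp_assoc, h0, comp_zero]
  have he : L₀.X ◁ θ ≫ evenAct L₀ X = coadOdd L₀ ≫ θ := h.equivariant
  have h0 := h3 u.hom.hom (u.hom.comm.symm.trans zero_comp) h.contraction
  have h1 : sw _ _ _ ≫ (P ⊗ L₀.X) ◁ diffAct X ≫ oddAct L₀ X = P ◁ oddAct L₀ X ≫ diffAct X -
      (α_ _ _ _).inv ≫ oddContr L₀.X ▷ _ ≫ evenAct L₀ X := by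
    rw [oddAct_diff, actR_eq]
    simp
  have h2 := sw_oddContr_odd L₀.X (L₀.X)ᘁ =≫ P ◁ coad L₀ ≫ θ
  rw [← cancel_epi ((P ⊗ L₀.X) ◁ oddContr _), ← cancel_epi (sw P (P ⊗ L₀.X) _),
    ← MonoidalCategory.whiskerLeft_comp_assoc, diffGen, ← Category.assoc (oddContr _),
    oddContr_oddExp, Category.id_comp, MonoidalCategory.whiskerLeft_comp_assoc,
    ← reassoc_of% sw_nat₃, h1, Preadditive.comp_sub, ← MonoidalCategory.whiskerLeft_comp_assoc,
    h0, oddCoad,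
    associator_inv_naturality_right_assoc, whisker_exchange_assoc, he]
  simp only [Category.assoc, Preadditive.neg_comp, zero_sub] at h2 ⊢
  rw [h2, coadOdd, actR_eq, Category.assoc]

/-- Each intertwining relation compares two derivations along `F`, so it reduces to the values on θ
and dθ supplied by the connection axioms and the `diffGen` lemmas. -/
lemma exists_weil_lift {B : DoubleMod L₀} [MonObj B] [IsCommMonObj B] {θ : P ⊗ (L₀.X)ᘁ ⟶ B.V.V}
    (h : IsConnection L₀ η[B] θ) : ∃ f : weilMod L₀ D ⟶ B, D.genL ≫ f.hom.hom = θ ∧ IsMonHom f := by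
  let := baseMonObj B
  have := base_isCommMonObj B
  let F := D.lift₂ θ (diffGen θ)
  have hL : D.genL ≫ F = θ := D.genL_lift₂ _ _
  have hR : D.genR ≫ F = diffGen θ := D.genR_lift₂ _ _
  have hd : weilD L₀ D ≫ F = P ◁ F ≫ diffAct B := by
    refine D.der₂_ext ((isDer_weilD L₀ D).id_comp F) (isDer_diff B).of_id ?_ ?_
    · rw [reassoc_of% genL_weilD, hR, ← MonoidalCategory.whiskerLeft_comp_assoc, hL, diffGen,
        ← Category.assoc, oddContr_oddExp, Category.id_comp]
    · rw [reassoc_of% genR_weilD, ← MonoidalCategory.whiskerLeft_comp_assoc, hR, diffGen_diffAct,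
        zero_comp]
  have he : weilE L₀ D ≫ F = L₀.X ◁ F ≫ evenAct L₀ B := by
    refine D.der₂_ext ((isDer_weilE L₀ D).id_comp F) (isDer_evenAct B).of_id ?_ ?_
    · rw [reassoc_of% genL_weilE, ← MonoidalCategory.whiskerLeft_comp_assoc, hL, h.equivariant]
      rfl
    · rw [reassoc_of% genR_weilE, ← MonoidalCategory.whiskerLeft_comp_assoc, hR,
        diffGen_evenAct h.equivariant]
  have hi : weilI L₀ D ≫ F = (P ⊗ L₀.X) ◁ F ≫ oddAct L₀ B := by
    refine D.der₂_ext ((isDer_weilI L₀ D).id_comp F) (isDer_oddAct B).of_id ?_ ?_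
    · rw [reassoc_of% genL_weilI, ← MonoidalCategory.whiskerLeft_comp_assoc, hL, h.contraction,
        IsMonHom.one_hom F]
      rfl
    · rw [reassoc_of% genR_weilI, ← MonoidalCategory.whiskerLeft_comp_assoc, hR,
        diffGen_oddAct h, hL]
  refine ⟨doubleModHom F hd ?_ ?_, hL, isMonHom_of_base _ ?_⟩
  · rw [evenAct_weilMod]
    exact he
  · rw [oddAct_weilMod]
    exact hi
  · exact inferInstanceAs (IsMonHom F)

lemma weil_hom_ext {B : DoubleMod L₀} [MonObj B] {f f' : weilMod L₀ D ⟶ B} [hf : IsMonHom f]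
    [hf' : IsMonHom f'] (h : D.genL ≫ f.hom.hom = D.genL ≫ f'.hom.hom) : f = f' := by
  let := baseMonObj B
  have a1 : IsMonHom (M := D.A) (N := B.V.V) f.hom.hom := base_isMonHom f
  have a2 : IsMonHom (M := D.A) (N := B.V.V) f'.hom.hom := base_isMonHom f'
  have hF : ∀ F : D.A ⟶ B.V.V, weilD L₀ D ≫ F = P ◁ F ≫ diffAct B →
      D.genR ≫ F = diffGen (D.genL ≫ F) := fun F h1 => by
    have h2 := P ◁ D.genL ≫= h1
    rw [reassoc_of% genL_weilD] at h2
    rw [diffGen, MonoidalCategory.whiskerLeft_comp_assoc, ← h2, ← Category.assoc (oddExp _),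
      oddExp_oddContr, Category.id_comp]
  have hR (f : weilMod L₀ D ⟶ B) : D.genR ≫ f.hom.hom = diffGen (D.genL ≫ f.hom.hom) :=
    hF f.hom.hom (hom_diffAct f)
  exact LieMod.hom_ext (LieMod.hom_ext (D.algHom₂_ext (f := f.hom.hom) (f' := f'.hom.hom) h
    ((hR f).trans ((congrArg diffGen h).trans (hR f').symm))))

/-- The Weil algebra represents connections. -/
noncomputable def weilObject : CommutativeWeilObject L₀ (CommMon.mk (weilMod L₀ D)) where
  homEquiv {B} :=
    { toFun := fun f => (connections L₀).map f ⟨D.genL, isConnection_genL L₀ D⟩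
      invFun := fun θ => commMonHom (exists_weil_lift D (B := B.X) θ.2).choose
        (exists_weil_lift D (B := B.X) θ.2).choose_spec.2
      left_inv := fun f => by
        apply CommMon.hom_ext
        have h := (exists_weil_lift D (B := B.X)
          ((connections L₀).map f ⟨D.genL, isConnection_genL L₀ D⟩).2).choose_spec
        exact weil_hom_ext D (hf := h.2) (hf' := f.hom.isMonHom_hom) h.1
      right_inv := fun θ => Subtype.ext (exists_weil_lift D (B := B.X) θ.2).choose_spec.1 }
  homEquiv_comp g f := by
    change (connections L₀).map (f ≫ g) _ = _
    rw [Functor.map_comp]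
    rfl

end Weil

end SuperTensor

namespace SuperTensor

open scoped MonObj

/-! ### Multiples of derivations. -/

section Derivations

variable {C : Type u} [Category.{v} C] [Preadditive C] [MonoidalCategory C]
  [SymmetricCategory C] [MonoidalPreadditive C]

/-- The product of an operator with parameters by a morphism to the algebra. -/
def mulOp {A T U : C} [MonObj A] (a : U ⟶ A) (δ : T ⊗ A ⟶ A) : (U ⊗ T) ⊗ A ⟶ A :=
  (α_ _ _ _).hom ≫ (a ⊗ₘ δ) ≫ μ[A]

lemma IsDer.mulOp {A T U : C} [MonObj A] [IsCommMonObj A] {δ : T ⊗ A ⟶ A} (h : IsDer (𝟙 A) δ)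
    (a : U ⟶ A) : IsDer (𝟙 A) (mulOp a δ) := by
  have e : SuperTensor.mulOp a δ = (a ▷ T) ▷ A ≫ (α_ A T A).hom ≫ A ◁ δ ≫ μ[A] := by
    rw [SuperTensor.mulOp, MonoidalCategory.tensorHom_def]
    simp
  rw [e]
  refine IsDer.param ?_ _
  rw [isDer_id_iff] at h ⊢
  have h2 : sw A A (T ⊗ A) ≫ A ◁ A ◁ δ ≫ A ◁ μ[A] ≫ μ[A] = A ◁ A ◁ δ ≫ A ◁ μ[A] ≫ μ[A] := by
    rw [← reassoc_of% sw_nat₃, SymData.mul_left_comm]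
  rw [associator_naturality_right_assoc, ← MonoidalCategory.whiskerLeft_comp_assoc, h,
    Preadditive.add_comp, Preadditive.add_comp, MonoidalPreadditive.whiskerLeft_add,
    Preadditive.add_comp, Preadditive.comp_add]
  congr 1
  · have := MonObj.mul_assoc A
    simp only [actL, MonoidalCategory.whiskerLeft_comp, Category.assoc, comp_whiskerRight]
    rw [this]
    simp
  · simp only [actR_eq, MonoidalCategory.whiskerLeft_comp, Category.assoc]
    rw [sw_tensor_left]
    simp only [Category.assoc]
    rw [← MonoidalCategory.whiskerLeft_comp_assoc A (α_ _ _ _).inv, Iso.inv_hom_id,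
      MonoidalCategory.whiskerLeft_id, Category.id_comp, h2]

lemma IsDer.unit_mul {A : C} [MonObj A] {δ : 𝟙_ C ⊗ A ⟶ A} (h : IsDer (𝟙 A) δ) :
    μ[A] ≫ (λ_ A).inv ≫ δ = (((λ_ A).inv ≫ δ) ▷ A + A ◁ ((λ_ A).inv ≫ δ)) ≫ μ[A] := by
  rw [isDer_id_iff] at h
  rw [leftUnitor_inv_naturality_assoc, h, actL, actR_eq, sw_unit_left, Preadditive.add_comp,
    Preadditive.comp_add, Preadditive.add_comp]
  simp

end Derivations

/-! ### Perfectness of the odd evaluation. -/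

section Coevaluation

variable {S : Type u} [Category.{v} S] [Abelian S] [Linear ℚ S] [MonoidalCategory S]
  [SymmetricCategory S] [MonoidalPreadditive S] [Supercategory S]

open Supercategory (P)

variable (L₀ : LieAlg S) [HasRightDual L₀.X]

lemma oddEvaluation_eq_braiding : oddEvaluation L₀ =
    (β_ P L₀.X).hom ▷ _ ≫ (α_ _ _ _).hom ≫ L₀.X ◁ oddContr _ ≫ coadEv L₀ := by
  have h := sw_oddContr L₀.X (L₀.X)ᘁ
  rw [oddEvaluation_eq, ← reassoc_of% h, sw]
  simp

lemma exists_oddCoevaluation : ∃ c : 𝟙_ S ⟶ (P ⊗ (L₀.X)ᘁ) ⊗ (P ⊗ L₀.X),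
    c ▷ _ ≫ (α_ _ _ _).hom ≫ _ ◁ oddEvaluation L₀ = (λ_ _).hom ≫ (ρ_ _).inv ∧
    _ ◁ c ≫ (α_ _ _ _).inv ≫ oddEvaluation L₀ ▷ _ = (ρ_ _).hom ≫ (λ_ _).inv := by
  let := BraidedCategory.exactPairing_swap L₀.X (L₀.X)ᘁ
  have hP : ε_ (P : S) P = oddPairing.hom := rfl
  have hE : ε_ (L₀.X)ᘁ L₀.X = coadEv L₀ := rfl
  have hT : ε_ ((P : S) ⊗ (L₀.X)ᘁ) (L₀.X ⊗ P) =
      (α_ _ _ _).hom ≫ L₀.X ◁ oddContr _ ≫ coadEv L₀ := by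
    change 𝟙 _ ⊗≫ _ ◁ (ε_ _ _ ▷ _) ⊗≫ ε_ _ _ = _
    rw [hP, hE, oddContr]
    monoidal
  -- The dual of a tensor product carries its factors in reverse order. The braiding restores P ⊗
  -- L₀, and the resulting evaluation is exactly `oddEvaluation`.
  let : ExactPairing ((P : S) ⊗ (L₀.X)ᘁ) (P ⊗ L₀.X) := exactPairingCongrRight (β_ P L₀.X)
  have hε : ε_ ((P : S) ⊗ (L₀.X)ᘁ) (P ⊗ L₀.X) = oddEvaluation L₀ := by
    rw [oddEvaluation_eq_braiding, ← hT]
    rfl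
  rw [← hε]
  exact ⟨η_ _ _, ExactPairing.evaluation_coevaluation _ _,
    ExactPairing.coevaluation_evaluation _ _⟩

end Coevaluation

end SuperTensor

namespace SuperTensor

open scoped MonObj

/-! ### Projection to the zero eigenspace by a polynomial. -/

section EndoPolynomials

variable {C : Type u} [Category.{v} C] [Preadditive C] [Linear ℚ C]

/-- The polynomial `∏ (1 - e / k)`, for `1 ≤ k ≤ n`, in an endomorphism. -/
noncomputable def rootProd {A : C} (e : A ⟶ A) : ℕ → (A ⟶ A)
  | 0 => 𝟙 A
  | n + 1 => rootProd e n - ((n : ℚ) + 1)⁻¹ • (rootProd e n ≫ e)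

lemma comp_rootProd {A : C} (e : A ⟶ A) (n : ℕ) : e ≫ rootProd e n = rootProd e n ≫ e := by
  induction n with
  | zero => simp [rootProd]
  | succ n ih =>
    simp only [rootProd, Preadditive.comp_sub, Preadditive.sub_comp, Linear.comp_smul,
      Linear.smul_comp, reassoc_of% ih, ih, Category.assoc]

/-- The polynomial has constant term 1, so its difference from 1 is divisible by `e`. -/
lemma exists_rootProd_eq {A : C} (e : A ⟶ A) (n : ℕ) : ∃ q, e ≫ q = 𝟙 A - rootProd e n := by
  induction n with
  | zero => exact ⟨0, by simp [rootProd]⟩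
  | succ n ih =>
    obtain ⟨q, hq⟩ := ih
    refine ⟨q + ((n : ℚ) + 1)⁻¹ • rootProd e n, ?_⟩
    rw [Preadditive.comp_add, hq, Linear.comp_smul, comp_rootProd, rootProd]
    abel

lemma comp_rootProd_of_comm {A B : C} {e : A ⟶ A} {e' : B ⟶ B} {j : B ⟶ A}
    (h : j ≫ e = e' ≫ j) (n : ℕ) : j ≫ rootProd e n = rootProd e' n ≫ j := by
  induction n with
  | zero => simp [rootProd]
  | succ n ih =>
    simp only [rootProd, Preadditive.comp_sub, Preadditive.sub_comp, Linear.comp_smul,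
      Linear.smul_comp, reassoc_of% ih, ih, Category.assoc, h]

/-- Here `j` raises eigenvalues by one. Substituting 1 + e' for e turns the factor 1 − e/k into
(k−1−e')/k: the factor k = 1 becomes −e', and the others telescope to 1/(n+1) times the product for
e' of length n. -/
lemma comp_rootProd_of_shift {A B : C} {e : A ⟶ A} {e' : B ⟶ B} {j : B ⟶ A}
    (h : j ≫ e = j + e' ≫ j) (n : ℕ) :
    j ≫ rootProd e (n + 1) = -(((n : ℚ) + 1)⁻¹ • (rootProd e' n ≫ e' ≫ j)) := by
  induction n with
  | zero => simp [rootProd, h]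
  | succ n ih =>
    have hn : (n : ℚ) + 1 ≠ 0 := by positivity
    have hn' : (n : ℚ) + 1 + 1 ≠ 0 := by positivity
    rw [rootProd, Preadditive.comp_sub, Linear.comp_smul, reassoc_of% ih, ih, rootProd,
      Preadditive.sub_comp]
    simp only [Preadditive.neg_comp, Linear.smul_comp, Category.assoc, h, Preadditive.comp_add]
    generalize rootProd e' n ≫ e' ≫ j = x
    generalize rootProd e' n ≫ e' ≫ e' ≫ j = y
    push_cast
    (match_scalars <;> field_simp); ring

lemma map_rootProd {C' : Type*} [Category C'] [Preadditive C'] [Linear ℚ C'] (F : C ⥤ C')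
    [F.Additive] {A : C} (e : A ⟶ A) (n : ℕ) : F.map (rootProd e n) = rootProd (F.map e) n := by
  induction n with
  | zero => simp [rootProd]
  | succ n ih => simp [rootProd, ih, F.map_sub]

end EndoPolynomials

/-! ### The kernel of the derivation counting the first generators. -/

section Counting

variable {C : Type u} [Category.{v} C] [Preadditive C] [Linear ℚ C] [MonoidalCategory C]
  [SymmetricCategory C] [MonoidalPreadditive C] [HasBinaryBiproducts C]

lemma biprod_hom_ext_left {U V Y X : C} {f g : (U ⊞ V) ⊗ X ⟶ Y}
    (h₁ : biprod.inl ▷ X ≫ f = biprod.inl ▷ X ≫ g)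
    (h₂ : biprod.inr ▷ X ≫ f = biprod.inr ▷ X ≫ g) : f = g := by
  have e (f : (U ⊞ V) ⊗ X ⟶ Y) : f = biprod.fst ▷ X ≫ biprod.inl ▷ X ≫ f +
      biprod.snd ▷ X ≫ biprod.inr ▷ X ≫ f := by
    conv_lhs => rw [← Category.id_comp f, ← id_whiskerRight, ← biprod.total,
      MonoidalPreadditive.add_whiskerRight, Preadditive.add_comp]
    simp
  rw [e f, e g, h₁, h₂]

namespace SymData

variable {U V : C} (D : SymData (U ⊞ V))

/-- The derivation counting the generators from the first summand. -/
noncomputable def count : D.A ⟶ D.A := (λ_ _).inv ≫ D.der₂ ((λ_ _).hom ≫ D.genL) 0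

/-- The projection to the subalgebra generated by the second summand. -/
noncomputable def projR : D.A ⟶ D.A := D.lift₂ 0 D.genR

instance : IsMonHom D.projR := inferInstanceAs (IsMonHom (D.lift₂ _ _))

lemma genL_count : D.genL ≫ D.count = D.genL := by
  rw [count, leftUnitor_inv_naturality_assoc, genL_der₂]
  simp

lemma genR_count : D.genR ≫ D.count = 0 := by
  rw [count, leftUnitor_inv_naturality_assoc, genR_der₂]
  simp

lemma m_zero_count : D.m 0 ≫ D.count = 0 := by
  have h := (D.isDer_der₂ ((λ_ _).hom ≫ D.genL) (0 : 𝟙_ C ⊗ V ⟶ _)).one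
  rw [one_eq] at h
  rw [count, leftUnitor_inv_naturality_assoc, h, comp_zero]

lemma mul_count : μ[D.A] ≫ D.count = (D.count ▷ D.A + D.A ◁ D.count) ≫ μ[D.A] :=
  (D.isDer_der₂ _ _).unit_mul

lemma projR_count : D.projR ≫ D.count = 0 := by
  have h : 𝟙_ C ◁ D.projR ≫ D.der₂ ((λ_ _).hom ≫ D.genL) 0 = 0 := by
    refine D.der₂_ext (f := D.projR) (D.isDer_der₂ _ _).of_id (IsDer.zero _) ?_ ?_
    · rw [← MonoidalCategory.whiskerLeft_comp_assoc, projR, genL_lift₂]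
      simp
    · rw [← MonoidalCategory.whiskerLeft_comp_assoc, projR, genR_lift₂, genR_der₂]
      simp
  rw [count, leftUnitor_inv_naturality_assoc, h, comp_zero]

/-- Multiplication by a generator from the first summand. -/
noncomputable def consL : U ⊗ D.A ⟶ D.A := D.genL ▷ D.A ≫ μ[D.A]

/-- Multiplication by a generator from the second summand. -/
noncomputable def consR : V ⊗ D.A ⟶ D.A := D.genR ▷ D.A ≫ μ[D.A]

lemma inl_cons : biprod.inl ▷ D.A ≫ D.cons = D.consL := by
  simp [consL, genL, cons_eq]

lemma inr_cons : biprod.inr ▷ D.A ≫ D.cons = D.consR := by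
  simp [consR, genR, cons_eq]

/-- A generator of the first kind raises the count by one; by `consR_count` one of the second kind
leaves it unchanged. These are the hypotheses of the two lemmas on composing with `rootProd`. -/
lemma consL_count : D.consL ≫ D.count = D.consL + U ◁ D.count ≫ D.consL := by
  rw [consL, Category.assoc, mul_count, Preadditive.add_comp, Preadditive.comp_add,
    ← comp_whiskerRight_assoc, genL_count, whisker_exchange_assoc]

lemma consR_count : D.consR ≫ D.count = V ◁ D.count ≫ D.consR := by
  rw [consR, Category.assoc, mul_count, Preadditive.add_comp, Preadditive.comp_add,
    ← comp_whiskerRight_assoc, genR_count, whisker_exchange_assoc]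
  simp

lemma consL_projR : D.consL ≫ D.projR = 0 := by
  rw [consL, Category.assoc, IsMonHom.mul_hom, ← Category.assoc, whiskerRight_tensorHom, projR,
    genL_lift₂]
  simp

lemma consR_projR : D.consR ≫ D.projR = V ◁ D.projR ≫ D.consR := by
  rw [consR, Category.assoc, IsMonHom.mul_hom, ← Category.assoc, whiskerRight_tensorHom, projR,
    genR_lift₂, MonoidalCategory.tensorHom_def', Category.assoc]

/-- On products of n generators the count has eigenvalues among 0, …, n, so ∏ (1 − count/k) for k ≤
n is the projection to eigenvalue 0, which discards every product containing a first generator. -/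
lemma m_rootProd_count (n : ℕ) : D.m n ≫ rootProd D.count n = D.m n ≫ D.projR := by
  induction n with
  | zero =>
    have h : D.m 0 ≫ D.projR = D.m 0 := IsMonHom.one_hom D.projR
    rw [h, rootProd, Category.comp_id]
  | succ n ih =>
    have hm (X : C) : X ◁ rootProd D.count n = rootProd (X ◁ D.count) n :=
      map_rootProd (tensorLeft X) _ _
    rw [← m_cons, Category.assoc, Category.assoc]
    refine biprod_hom_ext_left ?_ ?_
    -- With a leading first generator, the shift leaves a factor `count` after the projection given
    -- by the induction hypothesis, and `projR_count` kills it.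
    · rw [← whisker_exchange_assoc, ← whisker_exchange_assoc, reassoc_of% D.inl_cons,
        reassoc_of% D.inl_cons, consL_projR, comp_rootProd_of_shift D.consL_count, ← hm,
        ← MonoidalCategory.whiskerLeft_comp_assoc, Preadditive.comp_neg, Linear.comp_smul,
        ← MonoidalCategory.whiskerLeft_comp_assoc, reassoc_of% ih, projR_count]
      simp
    -- With a leading second generator the product for n already projects, and the extra factor at k
    -- = n + 1 acts as the identity on the image.
    · rw [← whisker_exchange_assoc, ← whisker_exchange_assoc, reassoc_of% D.inr_cons,
        reassoc_of% D.inr_cons, consR_projR, comp_rootProd_of_comm D.consR_count, rootProd, ← hm,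
        ← MonoidalCategory.whiskerLeft_comp, Preadditive.sub_comp, Preadditive.comp_sub,
        ← MonoidalCategory.whiskerLeft_comp_assoc, ih, Linear.smul_comp, Linear.comp_smul,
        ← MonoidalCategory.whiskerLeft_comp_assoc, reassoc_of% ih, projR_count]
      simp

/-- Counting preserves tensor degree. This allows operators chosen separately in each degree to be
composed with `count`. -/
lemma exists_m_count (n : ℕ) : ∃ x, D.m n ≫ D.count = x ≫ D.m n := by
  induction n with
  | zero => exact ⟨0, by rw [m_zero_count, zero_comp]⟩
  | succ n ih =>
    obtain ⟨x, hx⟩ := ih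
    refine ⟨(biprod.fst ≫ biprod.inl) ▷ _ + (U ⊞ V) ◁ x, ?_⟩
    have hc : D.cons ≫ D.count = (biprod.fst ≫ biprod.inl) ▷ _ ≫ D.cons +
        (U ⊞ V) ◁ D.count ≫ D.cons := by
      refine biprod_hom_ext_left ?_ ?_
      · rw [reassoc_of% D.inl_cons, consL_count, Preadditive.comp_add, ← whisker_exchange_assoc,
          inl_cons, ← comp_whiskerRight_assoc, biprod.inl_fst_assoc, inl_cons]
      · rw [reassoc_of% D.inr_cons, consR_count, Preadditive.comp_add, ← whisker_exchange_assoc,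
          inr_cons, ← comp_whiskerRight_assoc, biprod.inr_fst_assoc]
        simp
    have e : (biprod.fst ≫ biprod.inl) ▷ _ ≫ D.m (n + 1) =
        (U ⊞ V) ◁ D.m n ≫ (biprod.fst ≫ biprod.inl) ▷ _ ≫ D.cons := by
      rw [whisker_exchange_assoc, m_cons]
    rw [← m_cons, Category.assoc, hc, Preadditive.comp_add, Preadditive.add_comp, m_cons, e,
      ← MonoidalCategory.whiskerLeft_comp_assoc, hx, MonoidalCategory.whiskerLeft_comp_assoc,
      m_cons]

/-- No single polynomial works in all degrees, so `K` is glued from the quotients (1 − ∏)/count, one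
for each n. -/
lemma exists_count_comp : ∃ K, D.count ≫ K = 𝟙 _ - D.projR := by
  choose q hq using exists_rootProd_eq D.count
  obtain ⟨K, hK⟩ := D.exists_desc_unit (fun n => D.m n ≫ q n) fun n i => by
    rw [← Category.assoc, D.tr_m]
  refine ⟨K, D.hom_ext_unit fun n => ?_⟩
  obtain ⟨x, hx⟩ := D.exists_m_count n
  rw [reassoc_of% hx, hK, ← reassoc_of% hx, hq, Preadditive.comp_sub, Preadditive.comp_sub,
    m_rootProd_count]

/-- What is killed by the counting derivation comes from the second summand. -/
lemma eq_comp_projR {X : C} {f : X ⟶ D.A} (h : f ≫ D.count = 0) : f = f ≫ D.projR := by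
  obtain ⟨K, hK⟩ := D.exists_count_comp
  have h2 := f ≫= hK
  rw [reassoc_of% h, zero_comp, Preadditive.comp_sub, Category.comp_id] at h2
  exact sub_eq_zero.1 h2.symm

end SymData

end Counting

end SuperTensor

namespace SuperTensor

open scoped MonObj

/-! ### Shearing by a quadratic expression. -/

section Quadratic

variable {C : Type u} [Category.{v} C] [Preadditive C] [Linear ℚ C] [MonoidalCategory C]
  [SymmetricCategory C] [MonoidalPreadditive C] [HasBinaryBiproducts C]

namespace SymData

variable {U V : C} (D : SymData (U ⊞ V)) (q : V ⟶ U ⊗ U)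

/-- The quadratic expressions in the generators from the first summand given by `q`. -/
noncomputable def quad : V ⟶ D.A := q ≫ (D.genL ⊗ₘ D.genL) ≫ μ[D.A]

lemma quad_comp {B : C} [MonObj B] (f : D.A ⟶ B) [IsMonHom f] :
    D.quad q ≫ f = q ≫ ((D.genL ≫ f) ⊗ₘ (D.genL ≫ f)) ≫ μ[B] := by
  rw [quad, Category.assoc, Category.assoc, IsMonHom.mul_hom, tensorHom_comp_tensorHom_assoc]

lemma quad_der {B T : C} [MonObj B] {f : D.A ⟶ B} {δ : T ⊗ D.A ⟶ B} (h : IsDer f δ) :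
    T ◁ D.quad q ≫ δ = T ◁ q ≫ ((α_ T U U).inv ≫ ((T ◁ D.genL ≫ δ) ⊗ₘ (D.genL ≫ f)) +
      sw T U U ≫ ((D.genL ≫ f) ⊗ₘ (T ◁ D.genL ≫ δ))) ≫ μ[B] := by
  have := associator_inv_naturality (𝟙 T) D.genL D.genL
  simp only [id_tensorHom] at this
  rw [quad, MonoidalCategory.whiskerLeft_comp_assoc, MonoidalCategory.whiskerLeft_comp_assoc, h,
    ← Category.assoc (T ◁ (_ ⊗ₘ _)), Preadditive.comp_add, reassoc_of% this,
    reassoc_of% sw_nat₂₃, tensorHom_comp_tensorHom, tensorHom_comp_tensorHom]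

lemma quad_count : D.quad q ≫ D.count = D.quad q + D.quad q := by
  rw [quad, Category.assoc, Category.assoc, mul_count, Preadditive.add_comp,
    Preadditive.comp_add, Preadditive.comp_add]
  congr 2
  · rw [← tensorHom_id, tensorHom_comp_tensorHom_assoc, genL_count, Category.comp_id]
  · rw [← id_tensorHom, tensorHom_comp_tensorHom_assoc, genL_count, Category.comp_id]

/-- The algebra automorphism adding a multiple of a quadratic expression to the generators from
the second summand. -/
noncomputable def shear (s : ℚ) : D.A ⟶ D.A := D.lift₂ D.genL (D.genR + s • D.quad q)

instance (s : ℚ) : IsMonHom (D.shear q s) := inferInstanceAs (IsMonHom (D.lift₂ _ _))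

lemma genL_shear (s : ℚ) : D.genL ≫ D.shear q s = D.genL := D.genL_lift₂ _ _

lemma genR_shear (s : ℚ) : D.genR ≫ D.shear q s = D.genR + s • D.quad q := D.genR_lift₂ _ _

lemma quad_shear (s : ℚ) : D.quad q ≫ D.shear q s = D.quad q := by
  rw [quad_comp, genL_shear, quad]

lemma shear_neg (s : ℚ) : D.shear q s ≫ D.shear q (-s) = 𝟙 _ := by
  refine D.algHom₂_ext ?_ ?_
  · rw [reassoc_of% genL_shear, genL_shear, Category.comp_id]
  · rw [reassoc_of% genR_shear, Preadditive.add_comp, Linear.smul_comp, quad_shear, genR_shear]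
    simp

/-- A quadratic expression in the first generators has count 2 (`quad_count`), so the shear by ½ q
conjugates a derivation with θ ↦ θ, dθ ↦ q into the counting derivation. This explains the constant
½. -/
lemma count_of_shear {δ : 𝟙_ C ⊗ D.A ⟶ D.A} (h : IsDer (𝟙 _) δ)
    (hL : _ ◁ D.genL ≫ δ = (λ_ _).hom ≫ D.genL)
    (hR : _ ◁ D.genR ≫ δ = (λ_ _).hom ≫ D.quad q) :
    D.shear q 2⁻¹ ≫ D.count = (λ_ _).inv ≫ δ ≫ D.shear q 2⁻¹ := by
  have e : δ ≫ D.shear q 2⁻¹ =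
      _ ◁ D.shear q 2⁻¹ ≫ D.der₂ ((λ_ _).hom ≫ D.genL) (0 : 𝟙_ C ⊗ V ⟶ _) := by
    refine D.der₂_ext (h.id_comp _) (D.isDer_der₂ _ _).of_id ?_ ?_
    · rw [reassoc_of% hL, genL_shear, ← MonoidalCategory.whiskerLeft_comp_assoc, genL_shear,
        genL_der₂]
    · have hq := (λ_ _).hom ≫= D.quad_count q
      rw [count, leftUnitor_inv_naturality_assoc, Iso.hom_inv_id_assoc] at hq
      rw [reassoc_of% hR, quad_shear, ← MonoidalCategory.whiskerLeft_comp_assoc, genR_shear,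
        MonoidalPreadditive.whiskerLeft_add, Preadditive.add_comp, genR_der₂, whiskerLeft_ratsmul,
        Linear.smul_comp, hq, zero_add, ← two_smul ℚ (D.quad q), Linear.comp_smul, smul_smul]
      norm_num
  rw [count, leftUnitor_inv_naturality_assoc, e]

variable (DV : SymData V)

/-- The projection to the symmetric algebra of the second summand. -/
noncomputable def toSymR : D.A ⟶ DV.A := D.lift₂ 0 DV.gen

instance : IsMonHom (D.toSymR DV) := inferInstanceAs (IsMonHom (D.lift₂ _ _))

/-- The embedding of the symmetric algebra of the second summand, sheared. -/
noncomputable def ofSymR : DV.A ⟶ D.A := DV.lift (D.genR + (-2⁻¹ : ℚ) • D.quad q)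

instance : IsMonHom (D.ofSymR q DV) := inferInstanceAs (IsMonHom (DV.lift _))

lemma genL_toSymR : D.genL ≫ D.toSymR DV = 0 := D.genL_lift₂ _ _

lemma genR_toSymR : D.genR ≫ D.toSymR DV = DV.gen := D.genR_lift₂ _ _

lemma quad_toSymR : D.quad q ≫ D.toSymR DV = 0 := by
  rw [quad_comp, genL_toSymR]
  simp

lemma gen_ofSymR : DV.gen ≫ D.ofSymR q DV = D.genR + (-2⁻¹ : ℚ) • D.quad q := DV.gen_lift _

lemma ofSymR_toSymR : D.ofSymR q DV ≫ D.toSymR DV = 𝟙 _ := by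
  refine DV.algHom_ext ?_
  rw [reassoc_of% gen_ofSymR, Preadditive.add_comp, Linear.smul_comp, genR_toSymR, quad_toSymR]
  simp

lemma toSymR_ofSymR : D.toSymR DV ≫ D.ofSymR q DV =
    D.shear q 2⁻¹ ≫ D.projR ≫ D.shear q (-2⁻¹) := by
  refine D.algHom₂_ext ?_ ?_
  · rw [← Category.assoc, genL_toSymR, reassoc_of% genL_shear, projR,
      ← Category.assoc D.genL, genL_lift₂]
    simp
  · have h : D.quad q ≫ D.projR = 0 := by
      rw [quad_comp, projR, genL_lift₂]
      simp
    have h2 : D.genR ≫ D.projR = D.genR := D.genR_lift₂ _ _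
    rw [reassoc_of% genR_toSymR, gen_ofSymR, reassoc_of% genR_shear, Preadditive.add_comp,
      reassoc_of% h2, genR_shear, Linear.smul_comp, reassoc_of% h]
    simp

/-- After shearing, an element killed by δ has count zero, hence involves second generators only.
Undoing the shear makes it a polynomial in the second generators minus ½ q. -/
lemma eq_comp_toSymR_ofSymR {δ : 𝟙_ C ⊗ D.A ⟶ D.A} (h : IsDer (𝟙 _) δ)
    (hL : _ ◁ D.genL ≫ δ = (λ_ _).hom ≫ D.genL)
    (hR : _ ◁ D.genR ≫ δ = (λ_ _).hom ≫ D.quad q) {X : C} {f : X ⟶ D.A}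
    (hf : 𝟙_ C ◁ f ≫ δ = 0) : f = f ≫ D.toSymR DV ≫ D.ofSymR q DV := by
  have h0 : (f ≫ D.shear q 2⁻¹) ≫ D.count = 0 := by
    rw [Category.assoc, D.count_of_shear q h hL hR, leftUnitor_inv_naturality_assoc,
      reassoc_of% hf]
    simp
  have h1 := D.eq_comp_projR h0 =≫ D.shear q (-2⁻¹)
  rw [Category.assoc, shear_neg, Category.comp_id] at h1
  rw [toSymR_ofSymR]
  simpa only [Category.assoc] using h1

end SymData

end Quadratic

/-! ### Horizontal and basic elements of the Weil algebra. -/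

section Weil

variable {S : Type u} [Category.{v} S] [Abelian S] [Linear ℚ S] [MonoidalCategory S]
  [SymmetricCategory S] [MonoidalPreadditive S] [Supercategory S]

open Supercategory (P)

variable (L₀ : LieAlg S) [HasRightDual L₀.X]

/-- The coevaluation `𝟙 ⟶ P L₀* ⊗ P L₀`. -/
noncomputable def oddCoev : 𝟙_ S ⟶ (P ⊗ (L₀.X)ᘁ) ⊗ (P ⊗ L₀.X) :=
  (exists_oddCoevaluation L₀).choose

lemma oddCoev_oddEvaluation : oddCoev L₀ ▷ _ ≫ (α_ _ _ _).hom ≫ _ ◁ oddEvaluation L₀ =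
    (λ_ _).hom ≫ (ρ_ _).inv := (exists_oddCoevaluation L₀).choose_spec.1

lemma oddEvaluation_oddCoev : _ ◁ oddCoev L₀ ≫ (α_ _ _ _).inv ≫ oddEvaluation L₀ ▷ _ =
    (ρ_ _).hom ≫ (λ_ _).inv := (exists_oddCoevaluation L₀).choose_spec.2

/-- The quadratic morphism dual to the bracket. -/
noncomputable def cobracket : (L₀.X)ᘁ ⟶ (P ⊗ (L₀.X)ᘁ) ⊗ (P ⊗ (L₀.X)ᘁ) :=
  (λ_ _).inv ≫ oddCoev L₀ ▷ _ ≫ (α_ _ _ _).hom ≫ _ ◁ oddCoad L₀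

lemma cobracket_left : (P ⊗ L₀.X) ◁ cobracket L₀ ≫ (α_ _ _ _).inv ≫ oddEvaluation L₀ ▷ _ ≫
    (λ_ _).hom = oddCoad L₀ := by
  have h : ((P ⊗ L₀.X) ◁ oddCoev L₀ ≫ (α_ _ _ _).inv ≫ oddEvaluation L₀ ▷ (P ⊗ L₀.X)) ▷
      ((L₀.X)ᘁ : S) = ((ρ_ _).hom ≫ (λ_ _).inv) ▷ _ := by rw [oddEvaluation_oddCoev]
  have h2 := ((P ⊗ L₀.X) ◁ (λ_ _).inv ≫ (α_ _ _ _).inv) ≫= h =≫ ((α_ _ _ _).hom ≫ (λ_ _).hom)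
  rw [cobracket]
  simp only [MonoidalCategory.whiskerLeft_comp, Category.assoc, comp_whiskerRight] at h2 ⊢
  rw [associator_inv_naturality_right_assoc, whisker_exchange_assoc, leftUnitor_naturality,
    ← Category.comp_id (oddCoad L₀)]
  have e : (P ⊗ L₀.X) ◁ (α_ (P ⊗ (L₀.X)ᘁ) (P ⊗ L₀.X) (L₀.X)ᘁ).hom ≫ (α_ _ _ _).inv ≫
      oddEvaluation L₀ ▷ ((P ⊗ L₀.X) ⊗ (L₀.X)ᘁ) =
      (α_ _ _ _).inv ≫ (α_ _ _ _).inv ▷ _ ≫ oddEvaluation L₀ ▷ _ ▷ _ ≫ (α_ _ _ _).hom := by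
    monoidal
  rw [reassoc_of% e, associator_inv_naturality_middle_assoc, reassoc_of% h2]
  simp

/-- Contracting the second slot gives the same result as the first because the dual of the bracket
is symmetric on odd elements, by `sw_oddCoad_oddEvaluation`. -/
lemma cobracket_right : (P ⊗ L₀.X) ◁ cobracket L₀ ≫ sw _ _ _ ≫ _ ◁ oddEvaluation L₀ ≫
    (ρ_ _).hom = oddCoad L₀ := by
  have h1 := sw_oddCoad_oddEvaluation L₀
  have h2 := sw_tensor_mid (P ⊗ L₀.X) (P ⊗ (L₀.X)ᘁ) (P ⊗ L₀.X) (L₀.X)ᘁ =≫ (α_ _ _ _).hom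
  have h3 : (P ⊗ L₀.X) ◁ (λ_ _).inv ≫ (P ⊗ L₀.X) ◁ oddCoev L₀ ▷ (L₀.X)ᘁ ≫ sw _ _ _ =
      (λ_ _).inv ≫ oddCoev L₀ ▷ _ := by
    rw [sw_nat₂, sw_unit_mid]
    simp
  simp only [Category.assoc, Iso.inv_hom_id, Category.comp_id] at h2
  simp only [cobracket, MonoidalCategory.whiskerLeft_comp, Category.assoc]
  rw [reassoc_of% sw_nat₃, ← MonoidalCategory.whiskerLeft_comp_assoc _ (_ ◁ oddCoad L₀), ← h1,
    MonoidalCategory.whiskerLeft_comp_assoc, ← reassoc_of% h2, reassoc_of% h3,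
    MonoidalCategory.whiskerLeft_comp_assoc, ← associator_naturality_right_assoc, ← whisker_exchange_assoc,
    reassoc_of% oddCoev_oddEvaluation]
  simp

variable (D : SymData (((P : S) ⊗ (L₀.X)ᘁ) ⊞ (L₀.X)ᘁ))

/-- The Leibniz rule contracts either slot of q, and each contributes the contraction of dθ. Hence
dθ − ½ q is horizontal. -/
lemma quad_weilI : (P ⊗ L₀.X) ◁ D.quad (cobracket L₀) ≫ weilI L₀ D =
    oddCoad L₀ ≫ D.genL + oddCoad L₀ ≫ D.genL := by
  have h1 : ((oddEvaluation L₀ ≫ η[D.A]) ⊗ₘ D.genL) ≫ μ[D.A] =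
      oddEvaluation L₀ ▷ _ ≫ (λ_ _).hom ≫ D.genL := by
    rw [← whiskerRight_tensorHom, Category.assoc, MonoidalCategory.tensorHom_def', Category.assoc,
      MonObj.one_mul, leftUnitor_naturality]
  have h2 : (D.genL ⊗ₘ (oddEvaluation L₀ ≫ η[D.A])) ≫ μ[D.A] =
      _ ◁ oddEvaluation L₀ ≫ (ρ_ _).hom ≫ D.genL := by
    rw [← whiskerLeft_tensorHom, Category.assoc, MonoidalCategory.tensorHom_def, Category.assoc,
      MonObj.mul_one, rightUnitor_naturality]
  rw [D.quad_der _ (isDer_weilI L₀ D), genL_weilI, Category.comp_id, Preadditive.add_comp,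
    Category.assoc, Category.assoc, h1, h2, Preadditive.comp_add,
    reassoc_of% cobracket_left, reassoc_of% cobracket_right]

/-- The derivation of the Weil algebra counting connection generators. -/
noncomputable def euler : 𝟙_ S ⊗ D.A ⟶ D.A := oddCoev L₀ ▷ D.A ≫ mulOp D.genL (weilI L₀ D)

lemma isDer_euler : IsDer (𝟙 D.A) (euler L₀ D) := ((isDer_weilI L₀ D).mulOp _).param _

lemma whiskerLeft_euler {X : S} (f : X ⟶ D.A) : 𝟙_ S ◁ f ≫ euler L₀ D =
    oddCoev L₀ ▷ X ≫ (α_ _ _ _).hom ≫ (D.genL ⊗ₘ ((P ⊗ L₀.X) ◁ f ≫ weilI L₀ D)) ≫ μ[D.A] := by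
  rw [euler, mulOp, whisker_exchange_assoc, associator_naturality_right_assoc,
    ← Category.assoc (_ ◁ _), whiskerLeft_tensorHom]

lemma genL_euler : 𝟙_ S ◁ D.genL ≫ euler L₀ D = (λ_ _).hom ≫ D.genL := by
  rw [whiskerLeft_euler, genL_weilI, ← whiskerLeft_tensorHom, Category.assoc,
    reassoc_of% oddCoev_oddEvaluation, MonoidalCategory.tensorHom_def, Category.assoc,
    MonObj.mul_one, rightUnitor_naturality]
  simp

lemma genR_euler : 𝟙_ S ◁ D.genR ≫ euler L₀ D = (λ_ _).hom ≫ D.quad (cobracket L₀) := by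
  rw [whiskerLeft_euler, genR_weilI, ← whiskerLeft_tensorHom, Category.assoc, SymData.quad,
    cobracket]
  simp

variable (DM : SymData ((L₀.X)ᘁ : S))

/-- The horizontal elements of the Weil algebra: the symmetric algebra on the curvatures. -/
noncomputable def curvIncl : DM.A ⟶ D.A := D.ofSymR (cobracket L₀) DM

instance : IsMonHom (curvIncl L₀ D DM) := inferInstanceAs (IsMonHom (D.ofSymR _ _))

/-- The curvature. -/
noncomputable def curv : ((L₀.X)ᘁ : S) ⟶ D.A := D.genR + (-2⁻¹ : ℚ) • D.quad (cobracket L₀)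

lemma gen_curvIncl : DM.gen ≫ curvIncl L₀ D DM = curv L₀ D := D.gen_ofSymR _ DM

/-- Horizontal elements are polynomials in the curvature. -/
lemma eq_of_weilI_eq_zero {X : S} {f : X ⟶ D.A} (hf : (P ⊗ L₀.X) ◁ f ≫ weilI L₀ D = 0) :
    f = f ≫ D.toSymR DM ≫ curvIncl L₀ D DM := by
  refine D.eq_comp_toSymR_ofSymR _ DM (isDer_euler L₀ D) (genL_euler L₀ D) (genR_euler L₀ D) ?_
  rw [whiskerLeft_euler, hf]
  simp

lemma curv_weilI : (P ⊗ L₀.X) ◁ curv L₀ D ≫ weilI L₀ D = 0 := by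
  rw [curv, MonoidalPreadditive.whiskerLeft_add, whiskerLeft_ratsmul, Preadditive.add_comp,
    Linear.smul_comp, quad_weilI, genR_weilI, ← two_smul ℚ, smul_smul]
  norm_num

lemma curvIncl_weilI : (P ⊗ L₀.X) ◁ curvIncl L₀ D DM ≫ weilI L₀ D = 0 := by
  refine DM.der_ext (isDer_weilI L₀ D).of_id (IsDer.zero _) ?_
  rw [← MonoidalCategory.whiskerLeft_comp_assoc, gen_curvIncl, curv_weilI, comp_zero]

/-- The coadjoint action on the symmetric algebra of the dual. -/
noncomputable def symCoad : L₀.X ⊗ DM.A ⟶ DM.A := DM.der (coad L₀ ≫ DM.gen)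

/-- Setting θ = 0 is L₀-equivariant because L₀ maps the generators θ to themselves. -/
lemma weilE_toSymR : weilE L₀ D ≫ D.toSymR DM = L₀.X ◁ D.toSymR DM ≫ symCoad L₀ DM := by
  refine D.der₂_ext ((isDer_weilE L₀ D).id_comp _) (DM.isDer_der _).of_id ?_ ?_
  · rw [reassoc_of% genL_weilE, D.genL_toSymR, ← MonoidalCategory.whiskerLeft_comp_assoc,
      D.genL_toSymR]
    simp
  · rw [reassoc_of% genR_weilE, D.genR_toSymR, ← MonoidalCategory.whiskerLeft_comp_assoc,
      D.genR_toSymR, symCoad, DM.gen_der]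

/-- Equivariance of the curvature without computing the action on q: the difference of the two sides
is horizontal and vanishes at θ = 0, hence is zero by `eq_of_weilI_eq_zero`. -/
lemma curv_weilE (DM : SymData ((L₀.X)ᘁ : S)) : L₀.X ◁ curv L₀ D ≫ weilE L₀ D = coad L₀ ≫ curv L₀ D := by
  rw [← sub_eq_zero]
  have hr : curv L₀ D ≫ D.toSymR DM = DM.gen := by
    rw [← gen_curvIncl L₀ D DM, Category.assoc, curvIncl, D.ofSymR_toSymR, Category.comp_id]
  have h1 := (opComm_eq_iff.1 (weilE_weilI L₀ D))
  -- The commutator of L₀ with contractions is again a contraction, so L₀ maps horizontal elements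
  -- to horizontal ones.
  have h2 := L₀.X ◁ (P ⊗ L₀.X) ◁ curv L₀ D ≫= h1
  rw [Preadditive.comp_sub, ← MonoidalCategory.whiskerLeft_comp_assoc, curv_weilI, actR_eq,
    associator_inv_naturality_right_assoc, whisker_exchange_assoc, curv_weilI, Category.assoc,
    reassoc_of% sw_nat₃, ← MonoidalCategory.whiskerLeft_comp_assoc] at h2
  replace h2 := sw _ _ _ ≫= h2
  simp only [MonoidalPreadditive.whiskerLeft_zero, zero_comp, comp_zero, zero_sub,
    Preadditive.comp_neg, sw_sw_assoc, neg_eq_zero] at h2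
  rw [eq_of_weilI_eq_zero L₀ D DM (f := L₀.X ◁ curv L₀ D ≫ weilE L₀ D - coad L₀ ≫ curv L₀ D)]
  · rw [Preadditive.sub_comp, Category.assoc, Category.assoc, reassoc_of% weilE_toSymR,
      ← MonoidalCategory.whiskerLeft_comp_assoc, hr, reassoc_of% hr, symCoad,
      reassoc_of% DM.gen_der, Category.assoc, sub_self]
  · rw [whiskerLeft_sub, Preadditive.sub_comp, h2, MonoidalCategory.whiskerLeft_comp_assoc, curv_weilI]
    simp

lemma curvIncl_weilE : L₀.X ◁ curvIncl L₀ D DM ≫ weilE L₀ D =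
    symCoad L₀ DM ≫ curvIncl L₀ D DM := by
  refine DM.der_ext (isDer_weilE L₀ D).of_id ((DM.isDer_der _).id_comp _) ?_
  rw [← MonoidalCategory.whiskerLeft_comp_assoc, gen_curvIncl, curv_weilE L₀ D DM, symCoad,
    reassoc_of% DM.gen_der, Category.assoc, gen_curvIncl]

/-- As `curvIncl` followed by θ = 0 is the identity, this is an ordinary derivation of the symmetric
algebra. On Ω it gives −½ d q(θ, θ), each term of which still contains a θ. -/
lemma curvIncl_weilD_toSymR : P ◁ curvIncl L₀ D DM ≫ weilD L₀ D ≫ D.toSymR DM = 0 := by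
  have h : IsDer (D.toSymR DM) (weilD L₀ D ≫ D.toSymR DM) := (isDer_weilD L₀ D).id_comp _
  have hc : curvIncl L₀ D DM ≫ D.toSymR DM = 𝟙 _ := D.ofSymR_toSymR _ DM
  have h' := h.precomp (curvIncl L₀ D DM)
  rw [hc] at h'
  refine DM.der_ext h' (IsDer.zero _) ?_
  rw [← MonoidalCategory.whiskerLeft_comp_assoc, gen_curvIncl, curv,
    MonoidalPreadditive.whiskerLeft_add, Preadditive.add_comp, reassoc_of% genR_weilD,
    whiskerLeft_ratsmul, Linear.smul_comp, D.quad_der _ h, D.genL_toSymR]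
  simp

/-- Basic elements of the Weil algebra are closed. -/
lemma weilD_of_basic (DM : SymData ((L₀.X)ᘁ : S)) {X : S} {f : X ⟶ D.A} (he : L₀.X ◁ f ≫ weilE L₀ D = 0)
    (hi : (P ⊗ L₀.X) ◁ f ≫ weilI L₀ D = 0) : P ◁ f ≫ weilD L₀ D = 0 := by
  -- Cartan's relation applied to f: the terms with a contraction of f and the action of L₀ on f
  -- vanish, so df is horizontal.
  have h := P ◁ (P ⊗ L₀.X) ◁ f ≫= weilI_weilD L₀ D
  rw [Preadditive.comp_add, ← MonoidalCategory.whiskerLeft_comp_assoc, hi, actR_eq,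
    associator_inv_naturality_right_assoc, whisker_exchange_assoc, he, Category.assoc,
    reassoc_of% sw_nat₃, ← MonoidalCategory.whiskerLeft_comp_assoc] at h
  replace h := sw _ _ _ ≫= h
  simp only [MonoidalPreadditive.whiskerLeft_zero, zero_comp, comp_zero, add_zero, sw_sw_assoc] at h
  rw [eq_of_weilI_eq_zero L₀ D DM (f := P ◁ f ≫ weilD L₀ D) h.symm]
  have hf := eq_of_weilI_eq_zero L₀ D DM hi
  rw [hf]
  simp only [MonoidalCategory.whiskerLeft_comp, Category.assoc]
  rw [reassoc_of% curvIncl_weilD_toSymR]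
  simp

end Weil

end SuperTensor

namespace SuperTensor

open scoped MonObj

/-! ### Invariants as subobjects and subalgebras. -/

section Invariants

variable {C : Type u} [Category.{v} C] [Preadditive C] [MonoidalCategory C]
  [SymmetricCategory C] [MonoidalPreadditive C] {L : LieAlg C} [(trivialExt L).IsLeftAdjoint]

/-- The inclusion of the invariants. -/
noncomputable def invIncl (X : LieMod L) : (invariants L).obj X ⟶ X.V :=
  ((invariantsAdj L).counit.app X).hom

lemma invIncl_act (X : LieMod L) : L.X ◁ invIncl X ≫ X.act = 0 :=
  ((invariantsAdj L).counit.app X).comm.symm.trans (zero_comp (f := invIncl X))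

/-- A morphism annihilated by `L`, as a morphism of modules from a trivial module. -/
def ofTrivial {X : LieMod L} {Y : C} (f : Y ⟶ X.V) (h : L.X ◁ f ≫ X.act = 0) :
    (trivialExt L).obj Y ⟶ X :=
  ⟨f, (zero_comp (f := f)).trans h.symm⟩

lemma homEquiv_symm_hom {X : LieMod L} {Y : C} (f : Y ⟶ (invariants L).obj X) :
    (((invariantsAdj L).homEquiv Y X).symm f).hom = f ≫ invIncl X := by
  rw [Adjunction.homEquiv_counit]
  rfl

instance (X : LieMod L) : Mono (invIncl X) where
  right_cancellation f g h := by
    apply ((invariantsAdj L).homEquiv _ X).symm.injective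
    apply LieMod.hom_ext
    rw [homEquiv_symm_hom, homEquiv_symm_hom, h]

/-- Morphisms annihilated by `L` factor through the invariants. -/
noncomputable def invLift {X : LieMod L} {Y : C} (f : Y ⟶ X.V) (h : L.X ◁ f ≫ X.act = 0) :
    Y ⟶ (invariants L).obj X :=
  (invariantsAdj L).homEquiv Y X (ofTrivial f h)

lemma invLift_invIncl {X : LieMod L} {Y : C} (f : Y ⟶ X.V) (h : L.X ◁ f ≫ X.act = 0) :
    invLift f h ≫ invIncl X = f := by
  rw [← homEquiv_symm_hom, invLift, Equiv.symm_apply_apply]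
  rfl

lemma invIncl_naturality {X Y : LieMod L} (f : X ⟶ Y) :
    (invariants L).map f ≫ invIncl Y = invIncl X ≫ f.hom :=
  congrArg LieMod.Hom.hom ((invariantsAdj L).counit.naturality f)

lemma ε_invIncl : Functor.LaxMonoidal.ε (invariants L) ≫ invIncl (𝟙_ (LieMod L)) = 𝟙 (𝟙_ C) :=
  let : (invariantsAdj L).IsMonoidal := ⟨rfl, fun _ _ => rfl⟩
  congrArg LieMod.Hom.hom ((invariantsAdj L).map_ε_comp_counit_app_unit)

lemma μ_invIncl (X Y : LieMod L) :
    Functor.LaxMonoidal.μ (invariants L) X Y ≫ invIncl (X ⊗ Y) = invIncl X ⊗ₘ invIncl Y := by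
  let : (invariantsAdj L).IsMonoidal := ⟨rfl, fun _ _ => rfl⟩
  have h := congrArg LieMod.Hom.hom ((invariantsAdj L).map_μ_comp_counit_app_tensor X Y)
  exact h.trans (Category.id_comp _)

/-- The lax structure of the invariants is the mate of that of the trivial extension, so its
structure maps become identities after the counit. The product on invariants is therefore the
restricted one. -/
lemma isMonHom_invIncl (X : LieMod L) [MonObj X] :
    let := (invariants L).monObjObj X
    let := X.underlyingMonObj
    IsMonHom (invIncl X) := by
  let := (invariants L).monObjObj X
  let := X.underlyingMonObj
  constructor
  · have h1 := invIncl_naturality (η : 𝟙_ (LieMod L) ⟶ X)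
    have h2 := ε_invIncl (L := L)
    exact (Category.assoc _ _ _).trans ((congrArg _ h1).trans ((Category.assoc _ _ _).symm.trans
      ((congrArg (· ≫ (η : 𝟙_ (LieMod L) ⟶ X).hom) h2).trans (Category.id_comp _))))
  · have h1 := invIncl_naturality (μ : X ⊗ X ⟶ X)
    exact (Category.assoc _ _ _).trans ((congrArg _ h1).trans ((Category.assoc _ _ _).symm.trans
      (congrArg (· ≫ (μ : X ⊗ X ⟶ X).hom) (μ_invIncl X X))))

end Invariants

/-! ### Basic cocycles and cohomology. -/

section Basic

variable {S : Type u} [Category.{v} S] [Abelian S] [Linear ℚ S] [MonoidalCategory S]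
  [SymmetricCategory S] [MonoidalPreadditive S] [Supercategory S]

open Supercategory (P)

variable {L₀ : LieAlg S} [HasRightDual L₀.X]

/-- The inclusion of the basic cocycles. -/
noncomputable def cocycleIncl (X : DoubleMod L₀) : (basicCocycles L₀).obj X ⟶ X.V.V :=
  invIncl ((invariants (doubleLie L₀)).obj X) ≫ (invIncl X).hom

lemma totalAct_invIncl (X : DoubleMod L₀) :
    ((𝟙_ S ⊞ P) ⊗ L₀.X) ◁ (invIncl X).hom ≫ totalAct X = 0 :=
  congrArg LieMod.Hom.hom (invIncl_act X)

lemma totalAct_cocycleIncl (X : DoubleMod L₀) :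
    ((𝟙_ S ⊞ P) ⊗ L₀.X) ◁ cocycleIncl X ≫ totalAct X = 0 := by
  rw [cocycleIncl, MonoidalCategory.whiskerLeft_comp]
  exact (Category.assoc _ _ _).trans ((congrArg _ (totalAct_invIncl X)).trans comp_zero)

lemma evenAct_cocycleIncl (X : DoubleMod L₀) : L₀.X ◁ cocycleIncl X ≫ evenAct L₀ X = 0 := by
  rw [evenAct_eq, whisker_exchange_assoc, totalAct_cocycleIncl, comp_zero]

lemma oddAct_cocycleIncl (X : DoubleMod L₀) :
    (P ⊗ L₀.X) ◁ cocycleIncl X ≫ oddAct L₀ X = 0 := by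
  rw [oddAct_eq, whisker_exchange_assoc, totalAct_cocycleIncl, comp_zero]

instance (X : DoubleMod L₀) : Mono (cocycleIncl X) where
  right_cancellation {Z} f g h := by
    -- The inclusion of L-invariants is mono among supercomplexes, so the comparison is made there,
    -- after transposing to morphisms from the trivial complex on `Z`.
    have key (f : Z ⟶ (basicCocycles L₀).obj X) :
        ((((invariantsAdj (oddLie S)).homEquiv Z ((invariants (doubleLie L₀)).obj X)).symm f) ≫
          invIncl X).hom = f ≫ cocycleIncl X := by
      rw [cocycleIncl, ← Category.assoc, ← homEquiv_symm_hom]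
      rfl
    apply ((invariantsAdj (oddLie S)).homEquiv _ _).symm.injective
    rw [← cancel_mono (invIncl X)]
    apply LieMod.hom_ext
    rw [key, key, h]

/-- Closed basic morphisms factor through the basic cocycles. -/
lemma exists_cocycleLift {X : DoubleMod L₀} {Z : S} (f : Z ⟶ X.V.V)
    (hd : P ◁ f ≫ diffAct X = 0) (he : L₀.X ◁ f ≫ evenAct L₀ X = 0)
    (hi : (P ⊗ L₀.X) ◁ f ≫ oddAct L₀ X = 0) :
    ∃ g : Z ⟶ (basicCocycles L₀).obj X, g ≫ cocycleIncl X = f := by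
  have ht : ((𝟙_ S ⊞ P) ⊗ L₀.X) ◁ f ≫ totalAct X = 0 := by
    apply double_hom_ext
    · rw [← whisker_exchange_assoc, ← evenAct_eq, he, comp_zero]
    · rw [← whisker_exchange_assoc, ← oddAct_eq, hi, comp_zero]
  let f' : (trivialExt (oddLie S)).obj Z ⟶ X.V := ofTrivial f hd
  let g : (trivialExt (oddLie S)).obj Z ⟶ (invariants (doubleLie L₀)).obj X :=
    invLift f' (LieMod.hom_ext ht)
  have hg : P ◁ g.hom ≫ ((invariants (doubleLie L₀)).obj X).act = 0 :=
    g.comm.symm.trans (zero_comp (f := g.hom))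
  exact ⟨invLift g.hom hg, (Category.assoc _ _ _).symm.trans
    ((congrArg (· ≫ (invIncl X).hom) (invLift_invIncl g.hom hg)).trans
      (congrArg LieMod.Hom.hom (invLift_invIncl f' (LieMod.hom_ext ht))))⟩

lemma isMonHom_cocycleIncl (X : DoubleMod L₀) [MonObj X] :
    let := (basicCocycles L₀).monObjObj X
    let := baseMonObj X
    IsMonHom (cocycleIncl X) := by
  let := (basicCocycles L₀).monObjObj X
  let := baseMonObj X
  let m1 := (invariants (doubleLie L₀)).monObjObj X
  let m2 := X.underlyingMonObj
  let m3 := ((invariants (doubleLie L₀)).obj X).underlyingMonObj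
  let m4 := (cocycles (S := S)).monObjObj ((invariants (doubleLie L₀)).obj X)
  have h1 : IsMonHom (invIncl X) := isMonHom_invIncl X
  have h2 : IsMonHom (invIncl X).hom := LieMod.underlying_isMonHom (invIncl X)
  have h3 : IsMonHom (invIncl ((invariants (doubleLie L₀)).obj X)) := isMonHom_invIncl _
  -- The algebra structure from the composite lax functor agrees with the one obtained by taking
  -- invariants in two stages.
  have e : (basicCocycles L₀).monObjObj X = m4 := by
    apply MonObj.ext
    have h := (cocycles (S := S)).map_comp
      (Functor.LaxMonoidal.μ (invariants (doubleLie L₀)) X X)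
      ((invariants (doubleLie L₀)).map (μ : X ⊗ X ⟶ X))
    exact (Category.assoc _ _ _).trans (congrArg _ h.symm)
  rw [e]
  exact inferInstanceAs (IsMonHom (invIncl _ ≫ (invIncl X).hom))

lemma boundary_eq_zero {X : DoubleMod L₀}
    (h : ∀ {Z : S} (f : Z ⟶ X.V.V), L₀.X ◁ f ≫ evenAct L₀ X = 0 →
      (P ⊗ L₀.X) ◁ f ≫ oddAct L₀ X = 0 → P ◁ f ≫ diffAct X = 0) :
    boundary ((invariants (doubleLie L₀)).obj X) = 0 := by
  have he : L₀.X ◁ (invIncl X).hom ≫ evenAct L₀ X = 0 := by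
    rw [evenAct_eq, whisker_exchange_assoc, totalAct_invIncl, comp_zero]
  have hi : (P ⊗ L₀.X) ◁ (invIncl X).hom ≫ oddAct L₀ X = 0 := by
    rw [oddAct_eq, whisker_exchange_assoc, totalAct_invIncl, comp_zero]
  have hd := h _ he hi
  have hc : ((invariants (doubleLie L₀)).obj X).act ≫ (invIncl X).hom = 0 :=
    (invIncl X).comm.trans hd
  have hb : ((invariants (doubleLie L₀)).obj X).act = 0 := by
    let b : (trivialExt (oddLie S)).obj (P ⊗ ((invariants (doubleLie L₀)).obj X).V) ⟶
        (invariants (doubleLie L₀)).obj X :=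
      ofTrivial ((invariants (doubleLie L₀)).obj X).act (act_act_eq_zero _)
    -- By d² = 0 the differential is a morphism of supercomplexes from a trivial one, so it can be
    -- cancelled against the mono `invIncl X`.
    have h0 : b = 0 := by
      rw [← cancel_mono (invIncl X), zero_comp]
      exact LieMod.hom_ext hc
    exact congrArg LieMod.Hom.hom h0
  rw [← cancel_mono (invIncl _), zero_comp, boundary, ← homEquiv_symm_hom, Equiv.symm_apply_apply]
  exact hb

lemma cohomologyπ_naturality {X Y : DoubleMod L₀} (f : X ⟶ Y) :
    cohomologyπ L₀ X ≫ (cohomology L₀).map f = (basicCocycles L₀).map f ≫ cohomologyπ L₀ Y :=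
  cokernel.π_desc _ _ _

lemma isIso_cohomologyπ {X : DoubleMod L₀}
    (h : boundary ((invariants (doubleLie L₀)).obj X) = 0) : IsIso (cohomologyπ L₀ X) := by
  have key : ∀ {A B : S} (f : A ⟶ B), f = 0 → IsIso (cokernel.π f) := by
    rintro A B f rfl
    infer_instance
  exact key _ h

lemma isIso_cohomologyπ_of_iso {X Y : DoubleMod L₀} (e : X ≅ Y) [IsIso (cohomologyπ L₀ Y)] :
    IsIso (cohomologyπ L₀ X) := by
  have h : cohomologyπ L₀ X =
      (basicCocycles L₀).map e.hom ≫ cohomologyπ L₀ Y ≫ (cohomology L₀).map e.inv := by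
    rw [cohomologyπ_naturality e.inv, ← Functor.map_comp_assoc, e.hom_inv_id,
      CategoryTheory.Functor.map_id,
      Category.id_comp]
  rw [h]
  infer_instance

/-- Transport of structure; uniqueness holds because the product is determined after the epimorphism
f ⊗ f. -/
lemma existsUnique_isMonHom {A B : S} [MonObj A] (f : A ⟶ B) [IsIso f] :
    ∃! _m : MonObj B, IsMonHom f := by
  refine ⟨MonObj.ofIso (asIso f), isMonHom_ofIso (asIso f), fun m h => ?_⟩
  apply MonObj.ext
  have h2 : μ[A] ≫ f = (f ⊗ₘ f) ≫ m.mul := h.mul_hom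
  rw [← cancel_epi (f ⊗ₘ f), ← h2]
  simp [MonObj.ofIso_mul]

lemma existsUnique_isInducedAlgebra (X : DoubleMod L₀) [MonObj X] [IsIso (cohomologyπ L₀ X)] :
    ∃! m : MonObj ((cohomology L₀).obj X), IsInducedAlgebra L₀ X m :=
  let := (basicCocycles L₀).monObjObj X
  existsUnique_isMonHom (cohomologyπ L₀ X)

lemma isMonHom_cohomology_map {X Y : DoubleMod L₀} [MonObj X] [MonObj Y]
    [IsIso (cohomologyπ L₀ X)] (f : X ⟶ Y) [IsMonHom f]
    {m₁ : MonObj ((cohomology L₀).obj X)} {m₂ : MonObj ((cohomology L₀).obj Y)}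
    (h₁ : IsInducedAlgebra L₀ X m₁) (h₂ : IsInducedAlgebra L₀ Y m₂) :
    IsMonHom ((cohomology L₀).map f) := by
  let := (basicCocycles L₀).monObjObj X
  let := (basicCocycles L₀).monObjObj Y
  have h₁' : IsMonHom (cohomologyπ L₀ X) := h₁
  have h₂' : IsMonHom (cohomologyπ L₀ Y) := h₂
  have h₃ : IsMonHom ((basicCocycles L₀).map f) := Functor.map.instIsMonHom ..
  have h₄ : IsMonHom (asIso (cohomologyπ L₀ X)).inv := inferInstance
  have e : (cohomology L₀).map f =
      (asIso (cohomologyπ L₀ X)).inv ≫ (basicCocycles L₀).map f ≫ cohomologyπ L₀ Y := by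
    rw [← cohomologyπ_naturality, asIso_inv, IsIso.inv_hom_id_assoc]
  rw [e]
  infer_instance

end Basic

end SuperTensor

namespace SuperTensor

open scoped MonObj

/-! ### Comparison with invariant polynomials. -/

section Comparison

variable {S : Type u} [Category.{v} S] [Abelian S] [Linear ℚ S] [MonoidalCategory S]
  [SymmetricCategory S] [MonoidalPreadditive S] [Supercategory S]

open Supercategory (P)

variable (L₀ : LieAlg S) [HasRightDual L₀.X] (D : SymData (((P : S) ⊗ (L₀.X)ᘁ) ⊞ (L₀.X)ᘁ))
  (DM : SymData ((L₀.X)ᘁ : S))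

/-- The inclusion of the basic cocycles of the Weil algebra. -/
noncomputable def weilIncl : (basicCocycles L₀).obj (weilMod L₀ D) ⟶ D.A :=
  cocycleIncl (weilMod L₀ D)

instance : Mono (weilIncl L₀ D) := inferInstanceAs (Mono (cocycleIncl (weilMod L₀ D)))

lemma weilIncl_weilE : L₀.X ◁ weilIncl L₀ D ≫ weilE L₀ D = 0 := by
  rw [← evenAct_weilMod]
  exact evenAct_cocycleIncl (weilMod L₀ D)

lemma weilIncl_weilI : (P ⊗ L₀.X) ◁ weilIncl L₀ D ≫ weilI L₀ D = 0 := by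
  rw [← oddAct_weilMod]
  exact oddAct_cocycleIncl (weilMod L₀ D)

lemma exists_weilLift (DM : SymData ((L₀.X)ᘁ : S)) {Z : S} (f : Z ⟶ D.A) (he : L₀.X ◁ f ≫ weilE L₀ D = 0)
    (hi : (P ⊗ L₀.X) ◁ f ≫ weilI L₀ D = 0) :
    ∃ g : Z ⟶ (basicCocycles L₀).obj (weilMod L₀ D), g ≫ weilIncl L₀ D = f :=
  exists_cocycleLift (X := weilMod L₀ D) f (weilD_of_basic L₀ D DM he hi)
    ((congrArg _ (evenAct_weilMod L₀ D)).trans he) ((congrArg _ (oddAct_weilMod L₀ D)).trans hi)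

lemma boundary_weilMod (DM : SymData ((L₀.X)ᘁ : S)) :
    boundary ((invariants (doubleLie L₀)).obj (weilMod L₀ D)) = 0 :=
  boundary_eq_zero fun {Z} (f : Z ⟶ D.A) he hi => weilD_of_basic L₀ D DM
    ((congrArg (L₀.X ◁ f ≫ ·) (evenAct_weilMod L₀ D)).symm.trans he)
    ((congrArg ((P ⊗ L₀.X) ◁ f ≫ ·) (oddAct_weilMod L₀ D)).symm.trans hi)

/-- The symmetric algebra of the coadjoint module. -/
noncomputable def coadMod : LieMod L₀ := symMod L₀.coadjoint DM

noncomputable instance : MonObj (coadMod L₀ DM) :=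
  letI D : SymData L₀.coadjoint.V := DM
  inferInstanceAs (MonObj (symMod L₀.coadjoint D))

instance : IsCommMonObj (coadMod L₀ DM) :=
  letI D : SymData L₀.coadjoint.V := DM
  inferInstanceAs (IsCommMonObj (symMod L₀.coadjoint D))

/-- It is the free commutative algebra on the coadjoint module. -/
noncomputable def coadSymmetric :
    SymmetricAlgebraObject L₀.coadjoint (CommMon.mk (coadMod L₀ DM)) :=
  symModSymmetric L₀.coadjoint DM

/-- The inclusion of the invariant elements of the symmetric algebra. -/
noncomputable def symIncl : (invariants L₀).obj (coadMod L₀ DM) ⟶ DM.A :=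
  invIncl (coadMod L₀ DM)

instance : Mono (symIncl L₀ DM) := inferInstanceAs (Mono (invIncl _))

lemma symIncl_symCoad : L₀.X ◁ symIncl L₀ DM ≫ symCoad L₀ DM = 0 :=
  invIncl_act (coadMod L₀ DM)

/-- Basic elements of the Weil algebra are the invariant polynomials. -/
lemma exists_basicIso : ∃ e : (basicCocycles L₀).obj (weilMod L₀ D) ≅
      (invariants L₀).obj (coadMod L₀ DM),
    e.hom ≫ symIncl L₀ DM = weilIncl L₀ D ≫ D.toSymR DM := by
  have h1 : L₀.X ◁ (weilIncl L₀ D ≫ D.toSymR DM) ≫ symCoad L₀ DM = 0 := by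
    rw [MonoidalCategory.whiskerLeft_comp_assoc, ← weilE_toSymR,
      reassoc_of% (weilIncl_weilE L₀ D), zero_comp]
  -- The inverse substitutes the curvature into an invariant polynomial. The result is basic, hence
  -- closed.
  obtain ⟨g, hg⟩ := exists_weilLift L₀ D DM (symIncl L₀ DM ≫ curvIncl L₀ D DM)
    (by rw [MonoidalCategory.whiskerLeft_comp_assoc, curvIncl_weilE,
          reassoc_of% (symIncl_symCoad L₀ DM), zero_comp])
    (by rw [MonoidalCategory.whiskerLeft_comp_assoc, curvIncl_weilI, comp_zero])
  have hf : invLift (X := coadMod L₀ DM) _ h1 ≫ symIncl L₀ DM =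
    weilIncl L₀ D ≫ D.toSymR DM := invLift_invIncl (X := coadMod L₀ DM) _ h1
  refine ⟨⟨invLift (X := coadMod L₀ DM) _ h1, g, ?_, ?_⟩, hf⟩
  · rw [← cancel_mono (weilIncl L₀ D), Category.assoc, hg, reassoc_of% hf, Category.id_comp]
    exact (eq_of_weilI_eq_zero L₀ D DM (weilIncl_weilI L₀ D)).symm
  · rw [← cancel_mono (symIncl L₀ DM), Category.assoc, hf, reassoc_of% hg, curvIncl,
      D.ofSymR_toSymR, Category.comp_id, Category.id_comp]

lemma isMonHom_weilIncl :
    letI := (basicCocycles L₀).monObjObj (weilMod L₀ D)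
    IsMonHom (weilIncl L₀ D) :=
  isMonHom_cocycleIncl (weilMod L₀ D)

lemma isMonHom_symIncl :
    letI := (invariants L₀).monObjObj (coadMod L₀ DM)
    IsMonHom (symIncl L₀ DM) :=
  isMonHom_invIncl (coadMod L₀ DM)

/-- Multiplicativity of the comparison is tested inside the symmetric algebra, where it is the
restriction of the algebra morphism θ = 0. -/
lemma isMonHom_of_comp_mono {A B E : S} [MonObj A] [MonObj B] [MonObj E] (f : A ⟶ B) (j : B ⟶ E)
    [Mono j] [hj : IsMonHom j] (h : IsMonHom (f ≫ j)) : IsMonHom f where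
  one_hom := by
    rw [← cancel_mono j, Category.assoc, h.one_hom, hj.one_hom]
  mul_hom := by
    rw [← cancel_mono j, Category.assoc, h.mul_hom, Category.assoc, hj.mul_hom,
      tensorHom_comp_tensorHom_assoc]

lemma exists_basic_monIso : ∃ e : (basicCocycles L₀).obj (weilMod L₀ D) ≅
      (invariants L₀).obj (coadMod L₀ DM),
    letI := (basicCocycles L₀).monObjObj (weilMod L₀ D)
    letI := (invariants L₀).monObjObj (coadMod L₀ DM)
    IsMonHom e.hom := by
  obtain ⟨e, he⟩ := exists_basicIso L₀ D DM
  let := (basicCocycles L₀).monObjObj (weilMod L₀ D)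
  let := (invariants L₀).monObjObj (coadMod L₀ DM)
  have h1 := isMonHom_weilIncl L₀ D
  have h2 := isMonHom_symIncl L₀ DM
  refine ⟨e, isMonHom_of_comp_mono e.hom (symIncl L₀ DM) ?_⟩
  rw [he]
  infer_instance

variable {L₀}

/-- The cohomology of a Weil object is the algebra of invariant polynomials. -/
lemma exists_cohomology_monIso (D : SymData (((P : S) ⊗ (L₀.X)ᘁ) ⊞ (L₀.X)ᘁ))
    (DM : SymData ((L₀.X)ᘁ : S)) {W : CommMon (DoubleMod L₀)} (hW : CommutativeWeilObject L₀ W)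
    {A : CommMon (LieMod L₀)} (hA : SymmetricAlgebraObject L₀.coadjoint A)
    [IsIso (cohomologyπ L₀ W.X)]
    {m : MonObj ((cohomology L₀).obj W.X)} (h : IsInducedAlgebra L₀ W.X m) :
    ∃ φ : (cohomology L₀).obj W.X ≅ (invariants L₀).obj A.X,
      letI : MonObj ((invariants L₀).obj A.X) := (invariants L₀).monObjObj A.X
      IsMonHom φ.hom := by
  let e₁ : W ≅ CommMon.mk (weilMod L₀ D) := hW.uniqueUpToIso (weilObject D)
  let e₂ : CommMon.mk (coadMod L₀ DM) ≅ A :=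
    (coadSymmetric L₀ DM).uniqueUpToIso hA
  let f₁ : W.X ≅ weilMod L₀ D := (CommMon.forget _).mapIso e₁
  let f₂ : coadMod L₀ DM ≅ A.X := (CommMon.forget _).mapIso e₂
  have hf₁ : IsMonHom f₁.hom := e₁.hom.hom.isMonHom_hom
  have hf₂ : IsMonHom f₂.hom := e₂.hom.hom.isMonHom_hom
  obtain ⟨e, he⟩ := exists_basic_monIso L₀ D DM
  let := (basicCocycles L₀).monObjObj W.X
  let := (basicCocycles L₀).monObjObj (weilMod L₀ D)
  let := (invariants L₀).monObjObj (coadMod L₀ DM)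
  let := (invariants L₀).monObjObj A.X
  have g₀ : IsMonHom (asIso (cohomologyπ L₀ W.X)).hom := h
  have g₁ : IsMonHom ((basicCocycles L₀).map f₁.hom) := Functor.map.instIsMonHom ..
  have g₂ : IsMonHom ((invariants L₀).map f₂.hom) := Functor.map.instIsMonHom ..
  refine ⟨(asIso (cohomologyπ L₀ W.X)).symm ≪≫ (basicCocycles L₀).mapIso f₁ ≪≫ e ≪≫
    (invariants L₀).mapIso f₂, ?_⟩
  have : IsMonHom (asIso (cohomologyπ L₀ W.X)).inv := inferInstance
  change IsMonHom ((asIso (cohomologyπ L₀ W.X)).inv ≫ (basicCocycles L₀).map f₁.hom ≫ e.hom ≫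
    (invariants L₀).map f₂.hom)
  infer_instance

/-- The constructed Weil algebra has no boundaries among its basic elements, and any other
representing object is isomorphic to it. -/
lemma isIso_cohomologyπ_weil (D : SymData (((P : S) ⊗ (L₀.X)ᘁ) ⊞ (L₀.X)ᘁ)) (DM : SymData ((L₀.X)ᘁ : S)) {W : CommMon (DoubleMod L₀)}
    (hW : CommutativeWeilObject L₀ W) : IsIso (cohomologyπ L₀ W.X) :=
  haveI : IsIso (cohomologyπ L₀ (weilMod L₀ D)) := isIso_cohomologyπ (boundary_weilMod L₀ D DM)
  isIso_cohomologyπ_of_iso (Y := weilMod L₀ D) ((CommMon.forget _).mapIso (hW.uniqueUpToIso (weilObject D)))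

end Comparison

end SuperTensor

/-! ### The main theorem. -/

theorem mainTheorem7 {S : Type u} [Category.{v} S] [Abelian S] [Linear ℚ S]
    [MonoidalCategory S] [SymmetricCategory S] [MonoidalPreadditive S]
    [SuperTensor.Supercategory S] [HasCountableCoproducts S]
    [∀ X : S, PreservesColimitsOfShape (Discrete ℕ) (tensorLeft X)]
    (L₀ : SuperTensor.LieAlg S) [HasRightDual L₀.X] :
    (SuperTensor.connections L₀).IsCorepresentable ∧
    (SuperTensor.morphismsFrom L₀.coadjoint).IsCorepresentable ∧
    ∀ (W : CommMon (SuperTensor.DoubleMod L₀))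
      (_ : SuperTensor.CommutativeWeilObject L₀ W)
      (A : CommMon (SuperTensor.LieMod L₀))
      (_ : SuperTensor.SymmetricAlgebraObject L₀.coadjoint A),
      (∃! m : MonObj ((SuperTensor.equivariantCohomology W).obj (𝟙_ (SuperTensor.DoubleMod L₀))),
        SuperTensor.IsInducedAlgebra L₀ (W.X ⊗ 𝟙_ (SuperTensor.DoubleMod L₀)) m) ∧
      (∃! m : MonObj ((SuperTensor.cohomology L₀).obj W.X),
        SuperTensor.IsInducedAlgebra L₀ W.X m) ∧
      ∀ (m₁ : MonObj ((SuperTensor.equivariantCohomology W).obj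
          (𝟙_ (SuperTensor.DoubleMod L₀))))
        (m₂ : MonObj ((SuperTensor.cohomology L₀).obj W.X)),
        SuperTensor.IsInducedAlgebra L₀ (W.X ⊗ 𝟙_ (SuperTensor.DoubleMod L₀)) m₁ →
        SuperTensor.IsInducedAlgebra L₀ W.X m₂ →
        IsMonHom (M := (SuperTensor.equivariantCohomology W).obj
            (𝟙_ (SuperTensor.DoubleMod L₀)))
          (N := (SuperTensor.cohomology L₀).obj W.X)
          ((SuperTensor.cohomology L₀).mapIso (ρ_ W.X)).hom ∧
        ∃ φ : (SuperTensor.cohomology L₀).obj W.X ≅ (SuperTensor.invariants L₀).obj A.X,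
          letI : MonObj ((SuperTensor.invariants L₀).obj A.X) :=
            (SuperTensor.invariants L₀).monObjObj A.X
          IsMonHom φ.hom := by
  obtain ⟨D⟩ := SuperTensor.exists_symData
    (((SuperTensor.Supercategory.P : S) ⊗ (L₀.X)ᘁ) ⊞ (L₀.X)ᘁ)
  obtain ⟨DM⟩ := SuperTensor.exists_symData ((L₀.X)ᘁ : S)
  refine ⟨⟨_, ⟨SuperTensor.weilObject D⟩⟩,
    ⟨_, ⟨SuperTensor.coadSymmetric L₀ DM⟩⟩, fun W hW A hA => ?_⟩
  have h : IsIso (SuperTensor.cohomologyπ L₀ W.X) :=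
    SuperTensor.isIso_cohomologyπ_weil D DM hW
  -- Equivariant cohomology of the unit is handled by transport along the right unitor, which is
  -- also an isomorphism of algebras.
  have h' : IsIso (SuperTensor.cohomologyπ L₀ (W.X ⊗ 𝟙_ (SuperTensor.DoubleMod L₀))) :=
    SuperTensor.isIso_cohomologyπ_of_iso (ρ_ W.X)
  exact ⟨SuperTensor.existsUnique_isInducedAlgebra (W.X ⊗ 𝟙_ (SuperTensor.DoubleMod L₀)),
    SuperTensor.existsUnique_isInducedAlgebra W.X, fun m₁ m₂ h₁ h₂ =>
      ⟨SuperTensor.isMonHom_cohomology_map (ρ_ W.X).hom h₁ h₂,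
        SuperTensor.exists_cohomology_monIso D DM hW hA h₂⟩⟩
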